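/- Let $M$ be a smooth manifold of dimension $n$ and let $\delta\in\mathbb R$. Let $\mathcal S^k_\delta(M)$ be the space of smooth symmetric contravariant tensor fields of degree $k$ on $M$ with values in $\delta$-densities. A diffeomorphism $f$ acts on it by push-forward $f_*$; in coordinates $(f_*P)^{i_1\dots i_k}(f(x))=|\det Df(x)|^{-\delta}\,\partial_{a_1}f^{i_1}\cdots\partial_{a_k}f^{i_k}P^{a_1\dots a_k}(x)$. For an operator $A:\mathcal S^k_\delta(M)\to\mathcal S^l_\delta(M)$ put $f^*A:=(f_*)^{-1}\circ A\circ f_*$. For a pseudo-Riemannian metric $\mathrm g$ on $M$ with Levi-Civita connection $\nabla$ (also denoted $\Gamma$; it acts on densities by $\nabla_i\phi=\partial_i\phi-\delta\,\Gamma^t_{ti}\phi$) and scalar curvature $R$, and for $f\in\mathrm{Diff}(M)$, let $\ell(f)=f^*\Gamma-\Gamma$ (pullback of the connection), $\ell(f)_j=\ell(f)^t_{tj}$ and $\bar\ell(f)^k_{ij}=\ell(f)^k_{ij}-\frac1n\big(\delta^k_i\ell(f)_j+\delta^k_j\ell(f)_i\big)$. Define operators $\mathcal A^{\mathrm g}(f):\mathcal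 S^2_\delta(M)\to\mathcal S^1_\delta(M)$ and, if $n>2$, $\mathcal B^{\mathrm g}(f):\mathcal S^2_\delta(M)\to\mathcal S^0_\delta(M)$ (acting by contraction with $P^{ij}$) by $$\mathcal A^{\mathrm g}(f)^k_{ij}=f^*\big(\mathrm g^{sk}\mathrm g_{ij}\nabla_s\big)-\mathrm g^{sk}\mathrm g_{ij}\nabla_s+(2-\delta n)\,\bar\ell(f)^k_{ij},$$ $$\begin{aligned}\mathcal B^{\mathrm g}(f)_{ij}={}&f^*\big(\mathrm g^{st}\mathrm g_{ij}\nabla_s\nabla_t\big)-\mathrm g^{st}\mathrm g_{ij}\nabla_s\nabla_t+c_1\,\bar\ell(f)^s_{ij}\nabla_s+c_2\,\ell(f)_i\ell(f)_j+c_3\,\nabla_s\bar\ell(f)^s_{ij}\\&+c_4\,\ell(f)^s_{ij}\ell(f)_s+c_5\,\ell(f)^u_{si}\ell(f)^s_{uj}+c_6\big(f^*(R\,\mathrm g_{ij})-R\,\mathrm g_{ij}\big),\end{aligned}$$ where, with $w=2+n(1-2\delta)$, $c_1=w$, $c_2=\frac{w(\delta-1)}n$, $c_3=\frac{w(\delta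 n-2)}{n-2}$, $c_4=\frac{w(2\delta-2)}{n-2}$, $c_5=\frac{w(1-\delta)n}{n-2}$, $c_6=\frac{n(\delta-1)(n\delta-2)}{(n-1)(n-2)}$. Let $\mathrm g,\tilde{\mathrm g}$ be pseudo-Riemannian metrics on $M$. A diffeomorphism $\psi$ of $M$ is a conformal map $(M,\tilde{\mathrm g})\to(M,\mathrm g)$ if $\psi^*\mathrm g=F\,\tilde{\mathrm g}$ (pullback of the metric) for some smooth positive function $F$. **Proposition.** Let $\psi:(M,\tilde{\mathrm g})\to(M,\mathrm g)$ be conformal. For every $f\in\mathrm{Diff}(M)$, (i) $\mathcal A^{\tilde{\mathrm g}}(f)=\psi^*\mathcal A^{\mathrm g}(\psi\circ f\circ\psi^{-1})$; (ii) if $n>2$, $\mathcal B^{\tilde{\mathrm g}}(f)=\psi^*\mathcal B^{\mathrm g}(\psi\circ f\circ\psi^{-1})$. **Corollary.** If $\psi:(M,\tilde{\mathrm g})\to(M,\mathrm g)$ is conformal, then $\mathcal A^{\tilde{\mathrm g}}(\psi^{-1})=-\mathcal A^{\mathrm g}(\psi)$ and, if $n>2$, $\mathcal B^{\tilde{\mathrm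 g}}(\psi^{-1})=-\mathcal B^{\mathrm g}(\psi)$. Equivalently, if $\psi:(M,\mathrm g)\to(M,\tilde{\mathrm g})$ is conformal, then $\mathcal A^{\tilde{\mathrm g}}(\psi)=-\mathcal A^{\mathrm g}(\psi^{-1})$ and, if $n>2$, $\mathcal B^{\tilde{\mathrm g}}(\psi)=-\mathcal B^{\mathrm g}(\psi^{-1})$. -/

import Mathlib

open scoped Manifold ContDiff

noncomputable section

namespace ConformalSchwarzian

/-! ## Calculus of tensor components on an open piece of `ℝⁿ` -/

/-- The coordinate space `ℝⁿ`. -/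
abbrev Coord (n : ℕ) : Type := EuclideanSpace ℝ (Fin n)

/-- Connection coefficients, or the components of a `(2,1)`-tensor field, in coordinates:
`T y k i j` is `T^k_{ij}` at the point `y`. -/
abbrev Coeff (n : ℕ) : Type := Coord n → Fin n → Fin n → Fin n → ℝ

/-- The partial derivative `∂_i u` at `y`. -/
def pderiv {n : ℕ} (i : Fin n) (u : Coord n → ℝ) (y : Coord n) : ℝ :=
  fderiv ℝ u y (EuclideanSpace.single i 1)

/-- The Christoffel symbols `Γ^k_{ij}` of the Levi-Civita connection of the metric with
components `G`. -/
def christoffel {n : ℕ} (G : Coord n → Matrix (Fin n) (Fin n) ℝ) : Coeff n :=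
  fun y k i j => (1 / 2 : ℝ) * ∑ l, (G y)⁻¹ k l *
    (pderiv i (fun z => G z l j) y + pderiv j (fun z => G z l i) y
      - pderiv l (fun z => G z i j) y)

/-- The contraction `T_j = T^t_{tj}`. -/
def contract {n : ℕ} (T : Coeff n) (y : Coord n) (j : Fin n) : ℝ := ∑ t, T y t t j

/-- The covariant derivative `∇_s P^{ij}` of a twice contravariant tensor density of
weight `δ`. -/
def covDeriv {n : ℕ} (Γ : Coeff n) (δ : ℝ) (P : Coord n → Fin n → Fin n → ℝ)
    (y : Coord n) (s i j : Fin n) : ℝ :=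
  pderiv s (fun z => P z i j) y + ∑ m, (Γ y i s m * P y m j + Γ y j s m * P y i m)
    - δ * contract Γ y s * P y i j

/-- The second covariant derivative `∇_s ∇_t P^{ij}` of a twice contravariant tensor density
of weight `δ`. -/
def covDeriv₂ {n : ℕ} (Γ : Coeff n) (δ : ℝ) (P : Coord n → Fin n → Fin n → ℝ)
    (y : Coord n) (s t i j : Fin n) : ℝ :=
  pderiv s (fun z => covDeriv Γ δ P z t i j) y
    + ∑ m, (Γ y i s m * covDeriv Γ δ P y t m j + Γ y j s m * covDeriv Γ δ P y t i m
        - Γ y m s t * covDeriv Γ δ P y m i j)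
    - δ * contract Γ y s * covDeriv Γ δ P y t i j

/-- The covariant derivative `∇_u T^k_{ij}` of a `(2,1)`-tensor field. -/
def covDerivTensor {n : ℕ} (Γ : Coeff n) (T : Coeff n) (y : Coord n) (u k i j : Fin n) : ℝ :=
  pderiv u (fun z => T z k i j) y
    + ∑ m, (Γ y k u m * T y m i j - Γ y m u i * T y k m j - Γ y m u j * T y k i m)

/-- The Ricci curvature `R_{jk}` of a connection (positive on round spheres). -/
def ricci {n : ℕ} (Γ : Coeff n) (y : Coord n) (j k : Fin n) : ℝ :=
  ∑ i, (pderiv i (fun z => Γ z i j k) y - pderiv k (fun z => Γ z i i j) y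
    + ∑ m, (Γ y i i m * Γ y m j k - Γ y i k m * Γ y m i j))

/-- The scalar curvature `R = g^{jk} R_{jk}` of the metric with components `G`. -/
def scalarCurvature {n : ℕ} (G : Coord n → Matrix (Fin n) (Fin n) ℝ) (y : Coord n) : ℝ :=
  ∑ j, ∑ k, (G y)⁻¹ j k * ricci (christoffel G) y j k

/-- The Jacobian matrix `∂_i F^a` (row `a`, column `i`). -/
def jacobian {n : ℕ} (F : Coord n → Coord n) (y : Coord n) : Matrix (Fin n) (Fin n) ℝ :=
  Matrix.of fun a i => pderiv i (fun z => F z a) y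

/-- The pullback of a connection by a local diffeomorphism `F`:
`(F^*Γ)^k_{ij} = (DF⁻¹)^k_c (∂_i ∂_j F^c + (Γ^c_{ab} ∘ F) ∂_i F^a ∂_j F^b)`. -/
def pullbackConnection {n : ℕ} (Γ : Coeff n) (F : Coord n → Coord n) : Coeff n :=
  fun y k i j => ∑ c, (jacobian F y)⁻¹ k c *
    (pderiv i (pderiv j (fun z => F z c)) y
      + ∑ a, ∑ b, Γ (F y) c a b * jacobian F y a i * jacobian F y b j)

/-- The combination `T^k_{ij} - (1/n) (δ_i^k T_j + δ_j^k T_i)`. -/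
def reduced {n : ℕ} (T : Coeff n) : Coeff n :=
  fun y k i j => T y k i j - (1 / (n : ℝ)) *
    ((if i = k then contract T y j else 0) + (if j = k then contract T y i else 0))

/-! ## Metrics and tensor densities on a manifold -/

/-- The coordinate vector `∂_i` of the chart centred at `c`, at the point with coordinates
`y`. -/
def coordVector {n : ℕ} {M : Type*} [TopologicalSpace M] [ChartedSpace (Coord n) M]
    (c : M) (y : Coord n) (i : Fin n) :
    TangentSpace (𝓡 n) ((extChartAt (𝓡 n) c).symm y) :=
  mfderiv 𝓘(ℝ, Coord n) (𝓡 n) (extChartAt (𝓡 n) c).symm y (EuclideanSpace.single i (1 : ℝ))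

/-- The components `g_{ij} = g(∂_i, ∂_j)` of a field of bilinear forms in the chart centred
at `c`, as functions of the coordinates. -/
def formCoord {n : ℕ} {M : Type*} [TopologicalSpace M] [ChartedSpace (Coord n) M]
    (g : ∀ x : M, LinearMap.BilinForm ℝ (TangentSpace (𝓡 n) x)) (c : M) (y : Coord n) :
    Matrix (Fin n) (Fin n) ℝ :=
  Matrix.of fun i j =>
    g ((extChartAt (𝓡 n) c).symm y) (coordVector c y i) (coordVector c y j)

/-- A smooth pseudo-Riemannian metric (of arbitrary signature) on an `n`-dimensional
manifold. -/
structure PseudoMetric (n : ℕ) (M : Type*) [TopologicalSpace M] [ChartedSpace (Coord n) M] where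
  val : ∀ x : M, LinearMap.BilinForm ℝ (TangentSpace (𝓡 n) x)
  symm : ∀ (x : M) (v w : TangentSpace (𝓡 n) x), val x v w = val x w v
  nondegenerate : ∀ (x : M) (v : TangentSpace (𝓡 n) x), (∀ w, val x v w = 0) → v = 0
  smooth : ∀ (c : M) (i j : Fin n),
    ContDiffOn ℝ ∞ (fun y => formCoord val c y i j) (extChartAt (𝓡 n) c).target

/-- The components of a metric in the chart centred at `c`. -/
def PseudoMetric.coord {n : ℕ} {M : Type*} [TopologicalSpace M] [ChartedSpace (Coord n) M]
    (g : PseudoMetric n M) (c : M) : Coord n → Matrix (Fin n) (Fin n) ℝ :=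
  formCoord g.val c

/-- A (not necessarily smooth) field of contravariant tensor densities of degree `k`. As for
Mathlib's tangent vectors, the value at `x` is given by its components in the coordinates of
the preferred chart at `x`. The weight `δ` of the density enters through `changeFrame`. -/
abbrev DensityField (n : ℕ) (M : Type*) (k : ℕ) : Type _ := M → (Fin k → Fin n) → ℝ

/-- Transformation of the components of a contravariant tensor density of degree `k` and
weight `δ` under an invertible linear map with matrix `J`:
`P^{i₁…i_k} ↦ |det J|^{-δ} J^{i₁}_{a₁} ⋯ J^{i_k}_{a_k} P^{a₁…a_k}`. -/
def changeFrame {n k : ℕ} (δ : ℝ) (J : Matrix (Fin n) (Fin n) ℝ)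
    (p : (Fin k → Fin n) → ℝ) : (Fin k → Fin n) → ℝ :=
  fun i => |J.det| ^ (-δ) * ∑ a : Fin k → Fin n, (∏ r, J (i r) (a r)) * p a

/-- The matrix at `p` of the differential of the chart centred at `c`, from the preferred
coordinates at `p` to the coordinates of that chart. -/
def chartJacobian {n : ℕ} {M : Type*} [TopologicalSpace M] [ChartedSpace (Coord n) M]
    (c p : M) : Matrix (Fin n) (Fin n) ℝ :=
  Matrix.of fun i a => (show Coord n from
    mfderiv (𝓡 n) 𝓘(ℝ, Coord n) (extChartAt (𝓡 n) c) p (EuclideanSpace.single a (1 : ℝ))) i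

/-- The matrix of the differential of `f : M → M` at `p`, in the preferred coordinates at `p`
and at `f p`. -/
def mapJacobian {n : ℕ} {M : Type*} [TopologicalSpace M] [ChartedSpace (Coord n) M]
    (f : M → M) (p : M) : Matrix (Fin n) (Fin n) ℝ :=
  Matrix.of fun i a => (show Coord n from
    mfderiv (𝓡 n) (𝓡 n) f p (EuclideanSpace.single a (1 : ℝ))) i

/-- The components of a field of tensor densities of weight `δ` in the chart centred at `c`,
as functions of the coordinates. -/
def DensityField.coord {n : ℕ} {M : Type*} [TopologicalSpace M] [ChartedSpace (Coord n) M] {k : ℕ}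
    (P : DensityField n M k) (δ : ℝ) (c : M) (y : Coord n) : (Fin k → Fin n) → ℝ :=
  changeFrame δ (chartJacobian c ((extChartAt (𝓡 n) c).symm y))
    (P ((extChartAt (𝓡 n) c).symm y))

/-- `P` belongs to `𝒮ᵏ_δ(M)`: it is a smooth symmetric contravariant tensor field of degree
`k` with values in the densities of weight `δ`. -/
structure DensityField.IsSymbol {n : ℕ} {M : Type*} [TopologicalSpace M] [ChartedSpace (Coord n) M]
    {k : ℕ} (P : DensityField n M k) (δ : ℝ) : Prop where
  symm : ∀ (x : M) (σ : Equiv.Perm (Fin k)) (a : Fin k → Fin n), P x (a ∘ σ) = P x a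
  smooth : ∀ (c : M) (a : Fin k → Fin n),
    ContDiffOn ℝ ∞ (fun y => P.coord δ c y a) (extChartAt (𝓡 n) c).target

/-- The action of a diffeomorphism on contravariant tensor densities of weight `δ`
(push-forward). -/
def push {n : ℕ} {M : Type*} [TopologicalSpace M] [ChartedSpace (Coord n) M] {k : ℕ}
    (δ : ℝ) (f : M ≃ₘ⟮𝓡 n, 𝓡 n⟯ M) (P : DensityField n M k) : DensityField n M k :=
  fun x => changeFrame δ (mapJacobian f (f.symm x)) (P (f.symm x))

/-- The pullback of an operator by a diffeomorphism: `A` is conjugated with the action of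
`f` on tensor densities of weight `δ`. -/
def pullbackOp {n : ℕ} {M : Type*} [TopologicalSpace M] [ChartedSpace (Coord n) M] {k l : ℕ}
    (δ : ℝ) (f : M ≃ₘ⟮𝓡 n, 𝓡 n⟯ M) (A : DensityField n M k → DensityField n M l) :
    DensityField n M k → DensityField n M l :=
  fun P => push δ f.symm (A (push δ f P))

/-- `ψ : (M, g₁) → (M, g₂)` is conformal: `ψ^* g₂ = F g₁` for a smooth positive function
`F`. -/
def IsConformal {n : ℕ} {M : Type*} [TopologicalSpace M] [ChartedSpace (Coord n) M]
    (g₁ g₂ : PseudoMetric n M) (ψ : M ≃ₘ⟮𝓡 n, 𝓡 n⟯ M) : Prop :=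
  ∃ F : M → ℝ, ContMDiff (𝓡 n) 𝓘(ℝ, ℝ) ∞ F ∧ (∀ x, 0 < F x) ∧
    ∀ (x : M) (v w : TangentSpace (𝓡 n) x),
      g₂.val (ψ x) (mfderiv (𝓡 n) (𝓡 n) ψ x v) (mfderiv (𝓡 n) (𝓡 n) ψ x w)
        = F x * g₁.val x v w

/-! ## The operators -/

section Operators

variable {n : ℕ} {M : Type*} [TopologicalSpace M] [ChartedSpace (Coord n) M]

/-- The Christoffel symbols of `g` in the chart centred at `c`. -/
def PseudoMetric.conn (g : PseudoMetric n M) (c : M) : Coeff n := christoffel (g.coord c)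

/-- The components of a degree two field in the chart centred at `c`, with two indices. -/
def DensityField.coord₂ (P : DensityField n M 2) (δ : ℝ) (c : M) (y : Coord n) (i j : Fin n) : ℝ :=
  P.coord δ c y ![i, j]

/-- The tensor field `ℓ(f) = f^*Γ - Γ`, where `Γ` is the Levi-Civita connection of `g`, near
`x`, in the coordinates of the chart centred at `x`. -/
def ell (g : PseudoMetric n M) (f : M ≃ₘ⟮𝓡 n, 𝓡 n⟯ M) (x : M) : Coeff n :=
  fun y k i j =>
    pullbackConnection (g.conn (f x)) (writtenInExtChartAt (𝓡 n) (𝓡 n) x f) y k i j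
      - g.conn x y k i j

/-- The operator `P ↦ g^{sk} g_{ij} ∇_s P^{ij}`. -/
def gradTrace (g : PseudoMetric n M) (δ : ℝ) (P : DensityField n M 2) : DensityField n M 1 :=
  fun x k =>
    let y := extChartAt (𝓡 n) x x
    ∑ s, ∑ i, ∑ j, (g.coord x y)⁻¹ s (k 0) * g.coord x y i j *
      covDeriv (g.conn x) δ (P.coord₂ δ x) y s i j

/-- The operator `P ↦ g^{st} g_{ij} ∇_s ∇_t P^{ij}`. -/
def laplaceTrace (g : PseudoMetric n M) (δ : ℝ) (P : DensityField n M 2) : DensityField n M 0 :=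
  fun x _ =>
    let y := extChartAt (𝓡 n) x x
    ∑ s, ∑ t, ∑ i, ∑ j, (g.coord x y)⁻¹ s t * g.coord x y i j *
      covDeriv₂ (g.conn x) δ (P.coord₂ δ x) y s t i j

/-- The operator `P ↦ R g_{ij} P^{ij}`, with `R` the scalar curvature of `g`. -/
def scalarTrace (g : PseudoMetric n M) (δ : ℝ) (P : DensityField n M 2) : DensityField n M 0 :=
  fun x _ =>
    let y := extChartAt (𝓡 n) x x
    ∑ i, ∑ j, scalarCurvature (g.coord x) y * g.coord x y i j * P.coord₂ δ x y i j

/-- The operator `𝒜(f)` from `𝒮²_δ(M)` to `𝒮¹_δ(M)`. -/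
def schwarzianA (g : PseudoMetric n M) (δ : ℝ) (f : M ≃ₘ⟮𝓡 n, 𝓡 n⟯ M) (P : DensityField n M 2) :
    DensityField n M 1 :=
  fun x k =>
    let y := extChartAt (𝓡 n) x x
    pullbackOp δ f (gradTrace g δ) P x k - gradTrace g δ P x k
      + (2 - δ * n) * ∑ i, ∑ j, reduced (ell g f x) y (k 0) i j * P.coord₂ δ x y i j

/-- The zeroth and first order terms with coefficients `c₁, …, c₅` in the operator
`ℬ(f)`; here `Γ` is the Levi-Civita connection, `L` is `ℓ(f)`, and `P` is the argument, all in
coordinates. -/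
def lowerTerms (δ : ℝ) (Γ L : Coeff n) (P : Coord n → Fin n → Fin n → ℝ) (y : Coord n) : ℝ :=
  let c₁ : ℝ := 2 + n * (1 - 2 * δ)
  let c₂ : ℝ := (2 + n * (1 - 2 * δ)) * (δ - 1) / n
  let c₃ : ℝ := (2 + n * (1 - 2 * δ)) * (δ * n - 2) / (n - 2)
  let c₄ : ℝ := (2 + n * (1 - 2 * δ)) * (2 * δ - 2) / (n - 2)
  let c₅ : ℝ := (2 + n * (1 - 2 * δ)) * (1 - δ) * n / (n - 2)
  ∑ i, ∑ j,
    (c₁ * (∑ s, reduced L y s i j * covDeriv Γ δ P y s i j)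
      + (c₂ * (contract L y i * contract L y j)
        + c₃ * (∑ s, covDerivTensor Γ (reduced L) y s s i j)
        + c₄ * (∑ s, L y s i j * contract L y s)
        + c₅ * (∑ s, ∑ u, L y u s i * L y s u j)) * P y i j)

/-- The operator `ℬ(f)` from `𝒮²_δ(M)` to `𝒮⁰_δ(M)`, for `n > 2`. -/
def schwarzianB (g : PseudoMetric n M) (δ : ℝ) (f : M ≃ₘ⟮𝓡 n, 𝓡 n⟯ M) (P : DensityField n M 2) :
    DensityField n M 0 :=
  fun x k =>
    let c₆ : ℝ := n * (δ - 1) * (n * δ - 2) / ((n - 1) * (n - 2))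
    pullbackOp δ f (laplaceTrace g δ) P x k - laplaceTrace g δ P x k
      + lowerTerms δ (g.conn x) (ell g f x) (P.coord₂ δ x) (extChartAt (𝓡 n) x x)
      + c₆ * (pullbackOp δ f (scalarTrace g δ) P x k - scalarTrace g δ P x k)

end Operators

end ConformalSchwarzian

end

open ConformalSchwarzian

noncomputable section

namespace ConformalSchwarzian

open Matrix Finset

variable {n : ℕ}

/-! ### Partial derivatives -/

section Pderiv

variable {u v : Coord n → ℝ} {y : Coord n} {U : Set (Coord n)}

/-! The diffeomorphism is eliminated in favour of pairs of metrics. Naturality of the Levi-Civita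
connection gives ℓ(f) = Γ(f^*g) - Γ(g), and likewise f^* applied to an operator built from g is the
same operator built from f^*g. So in a chart 𝒜^g(f) and ℬ^g(f) are two-metric operators A(g, f^*g)
and B(g, f^*g), namely `coordA` and `coordB` (`schwarzianA_eq`, `schwarzianB_eq`). Three facts about
these carry the proof.

Naturality (`coordA_natural`, `coordB_natural`): they commute with local diffeomorphisms. Additivity
(`coordA_add`, `coordB_add`): A(G₁,G₂) + A(G₂,G₃) = A(G₁,G₃), and the same for B. For B this rests
on c₁, …, c₅ making the lower order terms a coboundary: relative to the flat connection of the chart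
they are a difference of a term in Γ' and a term in Γ (`lowerTerms_cocycle`). Vanishing: A(G, fG) =
0 and B(G, fG) = 0 for positive f (`IsConformalOn.coordA_eq_zero`, `IsConformalOn.coordB_eq_zero`).
Since ∇g = 0, the principal parts act only on the density u = g_ij P^ij. With φ = df/(2f), their
change under G ↦ fG involves only φ^k u, φ^m ∇_m u, (∇^mφ_m) u and |φ|² u, and the remaining terms
of A and B, including the scalar curvature, cancel these.

Additivity and vanishing show that A and B depend only on the conformal classes of their two metrics
(`coordA_conformal`, `coordB_conformal`). By naturality ψ^*𝒜^g(ψfψ⁻¹) is A(ψ^*g, f^*ψ^*g). As ψ^*g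
is conformal to g', and so f^*ψ^*g to f^*g', this equals A(g', f^*g') = 𝒜^{g'}(f). For the
corollary, 𝒜^g(ψ) = A(g, ψ^*g) = A(g, g') and 𝒜^{g'}(ψ⁻¹) = A(g', g), whose sum is A(g', g') = 0.
The argument for ℬ is the same. -/

lemma differentiableAt_of_contDiffOn (hU : IsOpen U) (hu : ContDiffOn ℝ ∞ u U) (hy : y ∈ U) :
    DifferentiableAt ℝ u y :=
  (hu.contDiffAt (hU.mem_nhds hy)).differentiableAt (by simp)

lemma pderiv_congr (hU : IsOpen U) (hy : y ∈ U) (h : ∀ z ∈ U, u z = v z) (i : Fin n) :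
    pderiv i u y = pderiv i v y := by
  have : u =ᶠ[nhds y] v := Filter.eventuallyEq_of_mem (hU.mem_nhds hy) h
  simp only [pderiv, this.fderiv_eq]

lemma pderiv_add (hu : DifferentiableAt ℝ u y) (hv : DifferentiableAt ℝ v y) (i : Fin n) :
    pderiv i (fun z => u z + v z) y = pderiv i u y + pderiv i v y := by
  simp only [pderiv]; rw [fderiv_fun_add hu hv]; rfl

lemma pderiv_sub (hu : DifferentiableAt ℝ u y) (hv : DifferentiableAt ℝ v y) (i : Fin n) :
    pderiv i (fun z => u z - v z) y = pderiv i u y - pderiv i v y := by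
  simp only [pderiv]; rw [fderiv_fun_sub hu hv]; rfl

lemma pderiv_mul (hu : DifferentiableAt ℝ u y) (hv : DifferentiableAt ℝ v y) (i : Fin n) :
    pderiv i (fun z => u z * v z) y = pderiv i u y * v y + u y * pderiv i v y := by
  simp only [pderiv]; rw [fderiv_fun_mul hu hv]
  simp; ring

lemma pderiv_const (c : ℝ) (i : Fin n) : pderiv i (fun _ : Coord n => c) y = 0 := by
  simp [pderiv]

lemma pderiv_const_mul (hu : DifferentiableAt ℝ u y) (c : ℝ) (i : Fin n) :
    pderiv i (fun z => c * u z) y = c * pderiv i u y := by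
  rw [pderiv_mul (differentiableAt_const c) hu, pderiv_const]; ring

lemma pderiv_sum {ι : Type*} {s : Finset ι} {w : ι → Coord n → ℝ}
    (h : ∀ a ∈ s, DifferentiableAt ℝ (w a) y) (i : Fin n) :
    pderiv i (fun z => ∑ a ∈ s, w a z) y = ∑ a ∈ s, pderiv i (w a) y := by
  simp only [pderiv]; rw [fderiv_fun_sum h]; simp

lemma contDiffOn_pderiv (hU : IsOpen U) (hu : ContDiffOn ℝ ∞ u U) (i : Fin n) :
    ContDiffOn ℝ ∞ (pderiv i u) U :=
  (hu.fderiv_of_isOpen hU (m := ∞) (by simp)).clm_apply contDiffOn_const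

lemma pderiv_comm (hU : IsOpen U) (hu : ContDiffOn ℝ ∞ u U) (hy : y ∈ U) (i j : Fin n) :
    pderiv i (pderiv j u) y = pderiv j (pderiv i u) y := by
  have hc := hu.contDiffAt (hU.mem_nhds hy)
  have hs : IsSymmSndFDerivAt ℝ u y := hc.isSymmSndFDerivAt (by
    simp only [minSmoothness_of_isRCLikeNormedField]; exact WithTop.coe_le_coe.2 le_top)
  have hd : DifferentiableAt ℝ (fderiv ℝ u) y :=
    (hc.fderiv_right (m := ∞) (by simp)).differentiableAt (by simp)
  have key : ∀ i j : Fin n, pderiv i (pderiv j u) y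
      = fderiv ℝ (fderiv ℝ u) y (EuclideanSpace.single i 1) (EuclideanSpace.single j 1) := by
    intro i j
    change fderiv ℝ (fun z => fderiv ℝ u z (EuclideanSpace.single j 1)) y _ = _
    rw [fderiv_clm_apply hd (differentiableAt_const _)]
    simp
  rw [key, key]; exact hs _ _

/-- The chain rule for partial derivatives. -/
lemma pderiv_comp {F : Coord n → Coord n} (hF : DifferentiableAt ℝ F y)
    (hu : DifferentiableAt ℝ u (F y)) (i : Fin n) :
    pderiv i (fun z => u (F z)) y = ∑ a, jacobian F y a i * pderiv a u (F y) := by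
  have h1 : ∀ a, jacobian F y a i = fderiv ℝ F y (EuclideanSpace.single i 1) a := by
    intro a
    have := ((EuclideanSpace.proj a : Coord n →L[ℝ] ℝ).hasFDerivAt.comp y hF.hasFDerivAt).fderiv
    have h2 : (fun z => F z a) = (EuclideanSpace.proj a : Coord n →L[ℝ] ℝ) ∘ F := rfl
    simp only [jacobian, Matrix.of_apply, pderiv]
    rw [h2, this]; rfl
  have h3 : fderiv ℝ F y (EuclideanSpace.single i 1)
      = ∑ a, jacobian F y a i • EuclideanSpace.single a (1 : ℝ) := by
    ext b
    rw [← h1 b]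
    simp [Finset.sum_apply, Pi.single_apply]
  have h4 : fderiv ℝ (fun z => u (F z)) y = (fderiv ℝ u (F y)).comp (fderiv ℝ F y) :=
    fderiv_comp y hu hF
  simp only [pderiv]
  rw [h4, ContinuousLinearMap.comp_apply, h3, map_sum]
  simp

end Pderiv

/-! ### Matrix-valued functions -/

/-- The entrywise partial derivative of a matrix-valued function. -/
def mderiv (s : Fin n) (M : Coord n → Matrix (Fin n) (Fin n) ℝ) (y : Coord n) :
    Matrix (Fin n) (Fin n) ℝ :=
  Matrix.of fun i j => pderiv s (fun z => M z i j) y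

/-- The entries of `M` are smooth on `U`. -/
def MatSmoothOn (M : Coord n → Matrix (Fin n) (Fin n) ℝ) (U : Set (Coord n)) : Prop :=
  ∀ i j, ContDiffOn ℝ ∞ (fun z => M z i j) U

/-- The entries of `M` are differentiable at `y`. -/
def MatDiffAt (M : Coord n → Matrix (Fin n) (Fin n) ℝ) (y : Coord n) : Prop :=
  ∀ i j, DifferentiableAt ℝ (fun z => M z i j) y

section Mderiv

variable {M N : Coord n → Matrix (Fin n) (Fin n) ℝ} {u : Coord n → ℝ} {y : Coord n}
  {U : Set (Coord n)}

lemma MatSmoothOn.matDiffAt (h : MatSmoothOn M U) (hU : IsOpen U) (hy : y ∈ U) : MatDiffAt M y :=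
  fun i j => differentiableAt_of_contDiffOn hU (h i j) hy

lemma MatSmoothOn.mul (hM : MatSmoothOn M U) (hN : MatSmoothOn N U) :
    MatSmoothOn (fun z => M z * N z) U := fun i j => by
  simp only [Matrix.mul_apply]
  exact ContDiffOn.sum fun k _ => (hM i k).mul (hN k j)

lemma MatSmoothOn.smul (hu : ContDiffOn ℝ ∞ u U) (hN : MatSmoothOn N U) :
    MatSmoothOn (fun z => u z • N z) U := fun i j => hu.mul (hN i j)

lemma MatSmoothOn.transpose (hM : MatSmoothOn M U) : MatSmoothOn (fun z => (M z)ᵀ) U :=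
  fun i j => hM j i

lemma MatSmoothOn.sum {ι : Type*} {s : Finset ι} {w : ι → Coord n → Matrix (Fin n) (Fin n) ℝ}
    (h : ∀ a ∈ s, MatSmoothOn (w a) U) : MatSmoothOn (fun z => ∑ a ∈ s, w a z) U := fun i j => by
  simp only [Matrix.sum_apply]
  exact ContDiffOn.sum fun a ha => h a ha i j

lemma contDiffOn_det (hM : MatSmoothOn M U) : ContDiffOn ℝ ∞ (fun z => (M z).det) U := by
  simp only [Matrix.det_apply']
  exact ContDiffOn.sum fun σ _ => contDiffOn_const.mul (contDiffOn_prod fun i _ => hM _ _)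

lemma MatSmoothOn.inv (hM : MatSmoothOn M U) (h0 : ∀ z ∈ U, (M z).det ≠ 0) :
    MatSmoothOn (fun z => (M z)⁻¹) U := fun i j => by
  simp only [Matrix.inv_def, Matrix.smul_apply, smul_eq_mul, Ring.inverse_eq_inv']
  refine ((contDiffOn_det hM).inv h0).mul ?_
  simp only [Matrix.adjugate_apply]
  refine contDiffOn_det fun a b => ?_
  by_cases h : a = j
  · subst h
    simp only [Matrix.updateRow_self]; exact contDiffOn_const
  · simp only [Matrix.updateRow_ne h]; exact hM a b

lemma mderiv_congr (hU : IsOpen U) (hy : y ∈ U) (h : ∀ z ∈ U, M z = N z) (s : Fin n) :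
    mderiv s M y = mderiv s N y := by
  ext i j
  exact pderiv_congr hU hy (fun z hz => by rw [h z hz]) s

lemma mderiv_mul (hM : MatDiffAt M y) (hN : MatDiffAt N y) (s : Fin n) :
    mderiv s (fun z => M z * N z) y = mderiv s M y * N y + M y * mderiv s N y := by
  ext i j
  simp only [mderiv, Matrix.of_apply, Matrix.add_apply, Matrix.mul_apply]
  rw [pderiv_sum (w := fun k z => M z i k * N z k j) (fun k _ => (hM i k).mul (hN k j)),
    ← Finset.sum_add_distrib]
  exact Finset.sum_congr rfl fun k _ => pderiv_mul (hM i k) (hN k j) s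

lemma mderiv_add (hM : MatDiffAt M y) (hN : MatDiffAt N y) (s : Fin n) :
    mderiv s (fun z => M z + N z) y = mderiv s M y + mderiv s N y := by
  ext i j; exact pderiv_add (hM i j) (hN i j) s

lemma mderiv_sub (hM : MatDiffAt M y) (hN : MatDiffAt N y) (s : Fin n) :
    mderiv s (fun z => M z - N z) y = mderiv s M y - mderiv s N y := by
  ext i j; exact pderiv_sub (hM i j) (hN i j) s

lemma mderiv_smul (hu : DifferentiableAt ℝ u y) (hM : MatDiffAt M y) (s : Fin n) :
    mderiv s (fun z => u z • M z) y = pderiv s u y • M y + u y • mderiv s M y := by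
  ext i j; exact pderiv_mul hu (hM i j) s

lemma mderiv_transpose (s : Fin n) : mderiv s (fun z => (M z)ᵀ) y = (mderiv s M y)ᵀ := rfl

lemma mderiv_sum {ι : Type*} {t : Finset ι} {w : ι → Coord n → Matrix (Fin n) (Fin n) ℝ}
    (h : ∀ a ∈ t, MatDiffAt (w a) y) (s : Fin n) :
    mderiv s (fun z => ∑ a ∈ t, w a z) y = ∑ a ∈ t, mderiv s (w a) y := by
  ext i j
  simp only [mderiv, Matrix.sum_apply, Matrix.of_apply]
  exact pderiv_sum (fun a ha => h a ha i j) s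

lemma mderiv_comp {F : Coord n → Coord n} (hF : DifferentiableAt ℝ F y)
    (hM : MatDiffAt M (F y)) (s : Fin n) :
    mderiv s (fun z => M (F z)) y = ∑ a, jacobian F y a s • mderiv a M (F y) := by
  ext i j
  simp only [mderiv, Matrix.sum_apply, Matrix.of_apply, Matrix.smul_apply, smul_eq_mul]
  exact pderiv_comp hF (hM i j) s

/-- Jacobi's formula. -/
lemma pderiv_det (hM : MatDiffAt M y) (s : Fin n) :
    pderiv s (fun z => (M z).det) y = ((M y).adjugate * mderiv s M y).trace := by
  -- The determinant is multilinear in the rows, so its derivative is the sum over i of determinants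
  -- with row i replaced by its derivative. Cramer's rule turns each of these into a row of the
  -- adjugate.
  let f : ContinuousMultilinearMap ℝ (fun _ : Fin n => Fin n → ℝ) ℝ :=
    { toMultilinearMap := (Matrix.detRowAlternating (R := ℝ) (n := Fin n)).toMultilinearMap
      cont := Continuous.matrix_det (A := fun M : Matrix (Fin n) (Fin n) ℝ => M) continuous_id }
  let M' : Coord n → Fin n → Fin n → ℝ := fun z i j => M z i j
  have hM' : DifferentiableAt ℝ M' y :=
    differentiableAt_pi.2 fun i => differentiableAt_pi.2 fun j => hM i j
  have h1 : (fun z => (M z).det) = f ∘ M' := rfl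
  have h2 := (f.hasFDerivAt (M' y)).comp y hM'.hasFDerivAt
  simp only [pderiv]
  rw [h1, h2.fderiv, ContinuousLinearMap.comp_apply, ContinuousMultilinearMap.linearDeriv_apply]
  rw [Matrix.trace_mul_comm]
  simp only [Matrix.trace, Matrix.diag, Matrix.mul_apply]
  refine Finset.sum_congr rfl fun i _ => ?_
  have h3 : ∀ j, fderiv ℝ M' y (EuclideanSpace.single s 1) i j = mderiv s M y i j := by
    intro j
    rw [fderiv_pi (fun i => differentiableAt_pi.2 fun j => hM i j)]
    simp only [ContinuousLinearMap.pi_apply]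
    rw [fderiv_pi (fun j => hM i j)]
    rfl
  change (Matrix.updateRow (M y) i (fderiv ℝ M' y (EuclideanSpace.single s 1) i)).det = _
  rw [← Matrix.cramer_transpose_apply, Matrix.cramer_eq_adjugate_mulVec, ← Matrix.adjugate_transpose]
  simp only [Matrix.mulVec, dotProduct, Matrix.transpose_apply, h3]
  exact Finset.sum_congr rfl fun j _ => mul_comm _ _

/-- Logarithmic derivative of |det|^r. The absolute value is differentiable because the determinant
does not vanish. -/
lemma pderiv_abs_det_rpow (hM : MatDiffAt M y) (h0 : (M y).det ≠ 0) (r : ℝ) (s : Fin n) :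
    pderiv s (fun z => |(M z).det| ^ r) y
      = r * |(M y).det| ^ r * ((M y)⁻¹ * mderiv s M y).trace := by
  have hd : DifferentiableAt ℝ (fun z => (M z).det) y := by
    simp only [Matrix.det_apply']
    refine DifferentiableAt.fun_sum fun σ _ => (differentiableAt_const _).mul ?_
    have h : ∀ i ∈ Finset.univ, HasFDerivAt (fun z => M z (σ i) i)
      (fderiv ℝ (fun z => M z (σ i) i) y) y := fun i _ => (hM (σ i) i).hasFDerivAt
    exact (HasFDerivAt.finsetProd h).differentiableAt
  have h1 := (hasDerivAt_abs h0).comp_hasFDerivAt y hd.hasFDerivAt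
  have h2 := (Real.hasDerivAt_rpow_const (p := r) (Or.inl (abs_ne_zero.2 h0))).comp_hasFDerivAt y h1
  have h3 : pderiv s (fun z => |(M z).det| ^ r) y
      = r * |(M y).det| ^ (r - 1) * (SignType.sign ((M y).det) * pderiv s (fun z => (M z).det) y) := by
    simp only [pderiv]
    have : (fun z => |(M z).det| ^ r) = (fun x => x ^ r) ∘ (abs ∘ fun z => (M z).det) := rfl
    rw [this, h2.fderiv]; simp
  rw [h3, pderiv_det hM, Real.rpow_sub_one (abs_ne_zero.2 h0), Matrix.inv_def, Ring.inverse_eq_inv',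
    Matrix.smul_mul, Matrix.trace_smul, smul_eq_mul]
  -- Writing the sign as |d| d⁻¹ restores the exponent r and supplies the d⁻¹ that turns the
  -- adjugate into the inverse.
  have h4 : (SignType.sign ((M y).det) : ℝ) = |(M y).det| * ((M y).det)⁻¹ := by
    rw [eq_mul_inv_iff_mul_eq₀ h0, sign_mul_self]
  rw [h4]
  have := abs_ne_zero.2 h0
  field_simp

end Mderiv

/-! ### Connection matrices and the Levi-Civita connection -/

/-- The matrix `(Γ^k_{sj})_{kj}` of a connection in the direction `∂_s`. -/
def connMatrix (Γ : Coeff n) (s : Fin n) (y : Coord n) : Matrix (Fin n) (Fin n) ℝ :=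
  Matrix.of fun k j => Γ y k s j

/-- The connection coefficients are symmetric on `U`. -/
def SymmOn (Γ : Coeff n) (U : Set (Coord n)) : Prop := ∀ z ∈ U, ∀ k i j, Γ z k i j = Γ z k j i

/-- The coefficients are smooth on `U`. -/
def CoeffSmoothOn (Γ : Coeff n) (U : Set (Coord n)) : Prop :=
  ∀ k i j, ContDiffOn ℝ ∞ (fun z => Γ z k i j) U

/-- `G` gives the components of a smooth pseudo-Riemannian metric on `U`. -/
structure IsMetricOn (G : Coord n → Matrix (Fin n) (Fin n) ℝ) (U : Set (Coord n)) : Prop where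
  smooth : MatSmoothOn G U
  symm : ∀ z ∈ U, (G z)ᵀ = G z
  det_ne : ∀ z ∈ U, (G z).det ≠ 0

/-- `F` is a smooth map from the open set `U` to the open set `V` with invertible differential. -/
structure IsCoordMap (F : Coord n → Coord n) (U V : Set (Coord n)) : Prop where
  isOpen_source : IsOpen U
  isOpen_target : IsOpen V
  mapsTo : Set.MapsTo F U V
  smooth : ContDiffOn ℝ ∞ F U
  det_ne : ∀ z ∈ U, (jacobian F z).det ≠ 0

/-- The pullback of metric components by a map. -/
def pullMetric (F : Coord n → Coord n) (G : Coord n → Matrix (Fin n) (Fin n) ℝ) (y : Coord n) :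
    Matrix (Fin n) (Fin n) ℝ :=
  (jacobian F y)ᵀ * G (F y) * jacobian F y

/-- The connection matrix at `F y` in the direction of the image of `∂_s` under `DF`. -/
def frameConn (Γ : Coeff n) (F : Coord n → Coord n) (s : Fin n) (y : Coord n) :
    Matrix (Fin n) (Fin n) ℝ :=
  ∑ a, jacobian F y a s • connMatrix Γ a (F y)

section

variable {G : Coord n → Matrix (Fin n) (Fin n) ℝ} {U V : Set (Coord n)} {y : Coord n}
  {F : Coord n → Coord n} {Γ : Coeff n}

lemma CoeffSmoothOn.connMatrix (h : CoeffSmoothOn Γ U) (s : Fin n) :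
    MatSmoothOn (connMatrix Γ s) U := fun k j => h k s j

lemma IsMetricOn.apply_comm (h : IsMetricOn G U) (hy : y ∈ U) (i j : Fin n) : G y i j = G y j i :=
  congrFun (congrFun (h.symm y hy) j) i

lemma IsMetricOn.inv_apply_comm (h : IsMetricOn G U) (hy : y ∈ U) (i j : Fin n) :
    (G y)⁻¹ i j = (G y)⁻¹ j i := by
  have : ((G y)⁻¹)ᵀ = (G y)⁻¹ := by rw [Matrix.transpose_nonsing_inv, h.symm y hy]
  exact congrFun (congrFun this j) i

lemma IsMetricOn.mul_inv (h : IsMetricOn G U) (hy : y ∈ U) : G y * (G y)⁻¹ = 1 :=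
  Matrix.mul_nonsing_inv _ (isUnit_iff_ne_zero.2 (h.det_ne y hy))

lemma IsMetricOn.inv_mul (h : IsMetricOn G U) (hy : y ∈ U) : (G y)⁻¹ * G y = 1 :=
  Matrix.nonsing_inv_mul _ (isUnit_iff_ne_zero.2 (h.det_ne y hy))

lemma IsMetricOn.sum_mul_inv (h : IsMetricOn G U) (hy : y ∈ U) (i j : Fin n) :
    ∑ k, G y i k * (G y)⁻¹ k j = if i = j then 1 else 0 := by
  rw [← Matrix.mul_apply, h.mul_inv hy, Matrix.one_apply]

lemma IsMetricOn.sum_inv_mul (h : IsMetricOn G U) (hy : y ∈ U) (i j : Fin n) :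
    ∑ k, (G y)⁻¹ i k * G y k j = if i = j then 1 else 0 := by
  rw [← Matrix.mul_apply, h.inv_mul hy, Matrix.one_apply]

lemma IsMetricOn.mono (h : IsMetricOn G V) (hUV : U ⊆ V) : IsMetricOn G U :=
  ⟨fun i j => (h.smooth i j).mono hUV, fun z hz => h.symm z (hUV hz),
    fun z hz => h.det_ne z (hUV hz)⟩

lemma IsCoordMap.differentiableAt (h : IsCoordMap F U V) (hy : y ∈ U) : DifferentiableAt ℝ F y :=
  (h.smooth.contDiffAt (h.isOpen_source.mem_nhds hy)).differentiableAt (by simp)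

lemma IsCoordMap.contDiffOn_apply (h : IsCoordMap F U V) (a : Fin n) :
    ContDiffOn ℝ ∞ (fun z => F z a) U := contDiffOn_euclidean.1 h.smooth a

lemma IsCoordMap.matSmoothOn_jacobian (h : IsCoordMap F U V) : MatSmoothOn (jacobian F) U :=
  fun a i => contDiffOn_pderiv h.isOpen_source (h.contDiffOn_apply a) i

lemma IsCoordMap.inv_mul (h : IsCoordMap F U V) (hy : y ∈ U) :
    (jacobian F y)⁻¹ * jacobian F y = 1 :=
  Matrix.nonsing_inv_mul _ (isUnit_iff_ne_zero.2 (h.det_ne y hy))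

lemma IsCoordMap.mul_inv (h : IsCoordMap F U V) (hy : y ∈ U) :
    jacobian F y * (jacobian F y)⁻¹ = 1 :=
  Matrix.mul_nonsing_inv _ (isUnit_iff_ne_zero.2 (h.det_ne y hy))

lemma MatSmoothOn.comp (hG : MatSmoothOn G V) (h : IsCoordMap F U V) :
    MatSmoothOn (fun z => G (F z)) U := fun i j => (hG i j).comp h.smooth h.mapsTo

lemma pderiv_jacobian_comm (h : IsCoordMap F U V) (hy : y ∈ U) (a i j : Fin n) :
    pderiv i (fun z => jacobian F z a j) y = pderiv j (fun z => jacobian F z a i) y :=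
  pderiv_comm h.isOpen_source (h.contDiffOn_apply a) hy i j

lemma IsMetricOn.pullMetric (hG : IsMetricOn G V) (h : IsCoordMap F U V) :
    IsMetricOn (pullMetric F G) U where
  smooth := (h.matSmoothOn_jacobian.transpose.mul (hG.smooth.comp h)).mul h.matSmoothOn_jacobian
  symm z hz := by
    simp only [ConformalSchwarzian.pullMetric, Matrix.transpose_mul, Matrix.transpose_transpose,
      hG.symm _ (h.mapsTo hz), Matrix.mul_assoc]
  det_ne z hz := by
    simp only [ConformalSchwarzian.pullMetric, Matrix.det_mul, Matrix.det_transpose]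
    exact mul_ne_zero (mul_ne_zero (h.det_ne z hz) (hG.det_ne _ (h.mapsTo hz))) (h.det_ne z hz)

lemma IsMetricOn.smul (hG : IsMetricOn G U) {f : Coord n → ℝ} (hf : ContDiffOn ℝ ∞ f U)
    (hpos : ∀ z ∈ U, 0 < f z) : IsMetricOn (fun z => f z • G z) U where
  smooth := hG.smooth.smul hf
  symm z hz := by simp [Matrix.transpose_smul, hG.symm z hz]
  det_ne z hz := by
    simp only [Matrix.det_smul]
    exact mul_ne_zero (pow_ne_zero _ (hpos z hz).ne') (hG.det_ne z hz)

lemma coeffSmoothOn_christoffel (hU : IsOpen U) (hG : IsMetricOn G U) :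
    CoeffSmoothOn (christoffel G) U := fun k i j => by
  refine contDiffOn_const.mul (ContDiffOn.sum fun l _ => (hG.smooth.inv hG.det_ne k l).mul ?_)
  exact ((contDiffOn_pderiv hU (hG.smooth _ _) _).add
    (contDiffOn_pderiv hU (hG.smooth _ _) _)).sub (contDiffOn_pderiv hU (hG.smooth _ _) _)

lemma symmOn_christoffel (hU : IsOpen U) (hG : IsMetricOn G U) : SymmOn (christoffel G) U := by
  intro z hz k i j
  simp only [christoffel]
  congr 1
  refine Finset.sum_congr rfl fun l _ => ?_
  rw [pderiv_congr hU hz (v := fun z => G z j i) (fun w hw => hG.apply_comm hw i j)]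
  ring

/-- Koszul's formula: with the upper index lowered, the inverse metric disappears. Both
compatibility and uniqueness are checked in this form. -/
lemma sum_mul_christoffel (hG : IsMetricOn G U) (hy : y ∈ U) (l i j : Fin n) :
    ∑ k, G y l k * christoffel G y k i j
      = (1 / 2) * (pderiv i (fun z => G z l j) y + pderiv j (fun z => G z l i) y
        - pderiv l (fun z => G z i j) y) := by
  have : ∀ k, G y l k * christoffel G y k i j = ∑ m, (G y l k * (G y)⁻¹ k m) * ((1 / 2) *
      (pderiv i (fun z => G z m j) y + pderiv j (fun z => G z m i) y
        - pderiv m (fun z => G z i j) y)) := by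
    intro k
    simp only [christoffel, Finset.mul_sum]
    exact Finset.sum_congr rfl fun m _ => by ring
  simp only [this]
  rw [Finset.sum_comm]
  simp only [← Finset.sum_mul, hG.sum_mul_inv hy]
  simp

/-- The Levi-Civita connection is compatible with the metric. -/
lemma mderiv_metric (hU : IsOpen U) (hG : IsMetricOn G U) (hy : y ∈ U) (s : Fin n) :
    mderiv s G y
      = (connMatrix (christoffel G) s y)ᵀ * G y + G y * connMatrix (christoffel G) s y := by
  ext i j
  have hsymm : ∀ a b c : Fin n, pderiv c (fun z => G z a b) y = pderiv c (fun z => G z b a) y :=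
    fun a b c => pderiv_congr hU hy (fun w hw => hG.apply_comm hw a b) c
  simp only [mderiv, Matrix.of_apply, Matrix.add_apply, Matrix.mul_apply, Matrix.transpose_apply,
    connMatrix]
  have h1 : ∑ x, christoffel G y x s i * G y x j = ∑ x, G y j x * christoffel G y x s i :=
    Finset.sum_congr rfl fun x _ => by rw [hG.apply_comm hy x j, mul_comm]
  rw [h1, sum_mul_christoffel hG hy, sum_mul_christoffel hG hy]
  rw [hsymm j i s, hsymm j s i, hsymm i s j]
  ring

/-- A symmetric connection compatible with the metric is the Levi-Civita connection. -/
lemma eq_christoffel (hG : IsMetricOn G U) (hy : y ∈ U)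
    (hΓ : ∀ k i j, Γ y k i j = Γ y k j i)
    (hc : ∀ s, mderiv s G y = (connMatrix Γ s y)ᵀ * G y + G y * connMatrix Γ s y) :
    Γ y = christoffel G y := by
  have hS : ∀ s i j, pderiv s (fun z => G z i j) y
      = ∑ m, G y j m * Γ y m s i + ∑ m, G y i m * Γ y m s j := by
    intro s i j
    have := congrFun (congrFun (hc s) i) j
    simp only [mderiv, Matrix.of_apply, Matrix.add_apply, Matrix.mul_apply, Matrix.transpose_apply,
      connMatrix] at this
    rw [this]
    congr 1
    exact Finset.sum_congr rfl fun x _ => by rw [hG.apply_comm hy x j, mul_comm]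
  -- Koszul's permutation: inserting compatibility into ∂_i G_lj + ∂_j G_li - ∂_l G_ij, the symmetry
  -- of Γ leaves twice the lowered Γ.
  have hlow : ∀ l i j, ∑ m, G y l m * Γ y m i j = ∑ m, G y l m * christoffel G y m i j := by
    intro l i j
    rw [sum_mul_christoffel hG hy, hS, hS, hS]
    simp only [hΓ _ l i, hΓ _ j i, hΓ _ j l]
    ring
  funext k i j
  have key : ∀ Γ' : Coeff n,
      Γ' y k i j = ∑ l, (G y)⁻¹ k l * ∑ m, G y l m * Γ' y m i j := by
    intro Γ'
    simp only [Finset.mul_sum, ← mul_assoc]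
    rw [Finset.sum_comm]
    simp only [← Finset.sum_mul, hG.sum_inv_mul hy]
    simp
  rw [key Γ, key (christoffel G)]
  simp only [hlow]

/-- The transformation law of a connection as a matrix identity with the inverse Jacobian cleared.
-/
lemma jacobian_mul_connMatrix_pullback (h : IsCoordMap F U V) (hy : y ∈ U) (s : Fin n) :
    jacobian F y * connMatrix (pullbackConnection Γ F) s y
      = mderiv s (jacobian F) y + frameConn Γ F s y * jacobian F y := by
  have : connMatrix (pullbackConnection Γ F) s y
      = (jacobian F y)⁻¹ * (mderiv s (jacobian F) y + frameConn Γ F s y * jacobian F y) := by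
    ext k j
    simp only [connMatrix, Matrix.of_apply, pullbackConnection, Matrix.mul_apply, Matrix.add_apply,
      frameConn, Matrix.sum_apply, Matrix.smul_apply, smul_eq_mul]
    refine Finset.sum_congr rfl fun c _ => ?_
    congr 1
    congr 1
    simp only [Finset.sum_mul]
    rw [Finset.sum_comm]
    exact Finset.sum_congr rfl fun b _ => Finset.sum_congr rfl fun a _ => by ring
  rw [this, ← Matrix.mul_assoc, h.mul_inv hy, Matrix.one_mul]

lemma symmOn_pullbackConnection (h : IsCoordMap F U V) (hΓ : SymmOn Γ V) :
    SymmOn (pullbackConnection Γ F) U := by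
  intro z hz k i j
  simp only [pullbackConnection]
  refine Finset.sum_congr rfl fun c _ => ?_
  rw [pderiv_comm h.isOpen_source (h.contDiffOn_apply c) hz, Finset.sum_comm]
  congr 2
  exact Finset.sum_congr rfl fun b _ => Finset.sum_congr rfl fun a _ => by
    rw [hΓ _ (h.mapsTo hz)]; ring

/-- Solving the transformation law for ∂J trades the second derivatives of `F` for the two
connections. The naturality computations for connections, densities and curvature all use this
substitution. -/
lemma mderiv_jacobian (h : IsCoordMap F U V) (hy : y ∈ U) (s : Fin n) :
    mderiv s (jacobian F) y = jacobian F y * connMatrix (pullbackConnection Γ F) s y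
      - frameConn Γ F s y * jacobian F y := by
  rw [jacobian_mul_connMatrix_pullback h hy]; abel

/-- Naturality of the Levi-Civita connection. -/
lemma pullbackConnection_christoffel (h : IsCoordMap F U V) (hG : IsMetricOn G V) (hy : y ∈ U) :
    pullbackConnection (christoffel G) F y = christoffel (pullMetric F G) y := by
  have hΓ := symmOn_christoffel h.isOpen_target hG
  -- By uniqueness it is enough that the pulled back connection is symmetric and compatible with the
  -- pulled back metric. In JᵀGJ the connection terms at `F y` coming from ∂J and from ∂(G ∘ F)
  -- cancel.
  refine eq_christoffel (hG.pullMetric h) hy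
    (symmOn_pullbackConnection h hΓ y hy) fun s => ?_
  have hJ := h.matSmoothOn_jacobian
  have hGF := hG.smooth.comp h
  have dJ := hJ.matDiffAt h.isOpen_source hy
  have dG := hGF.matDiffAt h.isOpen_source hy
  have dm := (hJ.transpose.mul hGF).matDiffAt h.isOpen_source hy
  have e1 : mderiv s (pullMetric F G) y
      = (mderiv s (jacobian F) y)ᵀ * G (F y) * jacobian F y
        + (jacobian F y)ᵀ * mderiv s (fun z => G (F z)) y * jacobian F y
        + (jacobian F y)ᵀ * G (F y) * mderiv s (jacobian F) y := by
    have : pullMetric F G = fun z => (jacobian F z)ᵀ * G (F z) * jacobian F z := rfl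
    rw [this, mderiv_mul dm dJ, mderiv_mul (M := fun z => (jacobian F z)ᵀ) (fun i j => dJ j i) dG, mderiv_transpose, Matrix.add_mul]
  have e2 : mderiv s (fun z => G (F z)) y = (frameConn (christoffel G) F s y)ᵀ * G (F y)
      + G (F y) * frameConn (christoffel G) F s y := by
    rw [mderiv_comp (h.differentiableAt hy)
      (hG.smooth.matDiffAt h.isOpen_target (h.mapsTo hy))]
    simp only [mderiv_metric h.isOpen_target hG (h.mapsTo hy), frameConn, Matrix.transpose_sum,
      Matrix.transpose_smul, Matrix.sum_mul, Matrix.mul_sum, smul_add, Finset.sum_add_distrib,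
      Matrix.smul_mul, Matrix.mul_smul]
  rw [e1, e2, mderiv_jacobian (Γ := christoffel G) h hy]
  simp only [pullMetric, Matrix.transpose_sub, Matrix.transpose_mul]
  noncomm_ring

/-! ### Conformal change -/

/-- The difference of the Levi-Civita connections of two conformal metrics, where `φ` is half the
logarithmic differential of the conformal factor. -/
def conformalDiff (G : Coord n → Matrix (Fin n) (Fin n) ℝ) (φ : Fin n → Coord n → ℝ) : Coeff n :=
  fun y k i j => (if k = i then φ j y else 0) + (if k = j then φ i y else 0)
    - G y i j * ∑ m, (G y)⁻¹ k m * φ m y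

/-- Half the logarithmic derivative. -/
def halfLogDeriv (f : Coord n → ℝ) (i : Fin n) (y : Coord n) : ℝ := pderiv i f y / (2 * f y)

/-- Uniqueness again: the correction is symmetric, and its contribution to compatibility is 2φ_s G,
which matches ∂_s f = 2 f φ_s. -/
lemma christoffel_smul (hU : IsOpen U) (hG : IsMetricOn G U) {f : Coord n → ℝ}
    (hf : ContDiffOn ℝ ∞ f U) (hpos : ∀ z ∈ U, 0 < f z) (hy : y ∈ U) (k i j : Fin n) :
    christoffel (fun z => f z • G z) y k i j
      = christoffel G y k i j + conformalDiff G (halfLogDeriv f) y k i j := by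
  have hs := symmOn_christoffel hU hG y hy
  let Γ : Coeff n := fun y k i j =>
    christoffel G y k i j + conformalDiff G (halfLogDeriv f) y k i j
  suffices h : Γ y = christoffel (fun z => f z • G z) y by rw [← h]
  refine eq_christoffel (hG.smul hf hpos) hy (fun k i j => ?_) fun s => ?_
  · simp only [Γ, conformalDiff]
    rw [hs, hG.apply_comm hy i j]; ring
  · rw [mderiv_smul (differentiableAt_of_contDiffOn hU hf hy) (hG.smooth.matDiffAt hU hy),
      mderiv_metric hU hG hy]
    have hΓ : connMatrix Γ s y = connMatrix (christoffel G) s y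
        + connMatrix (conformalDiff G (halfLogDeriv f)) s y := rfl
    rw [hΓ]
    have hΛ : (connMatrix (conformalDiff G (halfLogDeriv f)) s y)ᵀ * G y
        + G y * connMatrix (conformalDiff G (halfLogDeriv f)) s y
        = (2 * halfLogDeriv f s y) • G y := by
      have hE : ∀ i j, ∑ k, G y i k * conformalDiff G (halfLogDeriv f) y k s j
          = G y i s * halfLogDeriv f j y + G y i j * halfLogDeriv f s y
            - G y s j * halfLogDeriv f i y := by
        intro i j
        have : ∑ k, G y i k * ∑ m, (G y)⁻¹ k m * halfLogDeriv f m y = halfLogDeriv f i y := by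
          simp only [Finset.mul_sum, ← mul_assoc]
          rw [Finset.sum_comm]
          simp only [← Finset.sum_mul, hG.sum_mul_inv hy]
          simp
        simp only [conformalDiff, mul_sub, mul_add, Finset.sum_sub_distrib, Finset.sum_add_distrib,
          mul_ite, mul_zero, Finset.sum_ite_eq', Finset.mem_univ, if_true]
        rw [← this, Finset.mul_sum]
        congr 1
        exact Finset.sum_congr rfl fun k _ => by ring
      ext i j
      simp only [Matrix.add_apply, Matrix.mul_apply, Matrix.transpose_apply, connMatrix,
        Matrix.of_apply, Matrix.smul_apply, smul_eq_mul]
      have h1 : ∑ x, conformalDiff G (halfLogDeriv f) y x s i * G y x j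
          = ∑ x, G y j x * conformalDiff G (halfLogDeriv f) y x s i :=
        Finset.sum_congr rfl fun x _ => by rw [hG.apply_comm hy x j, mul_comm]
      rw [h1, hE, hE, hG.apply_comm hy j i, hG.apply_comm hy j s, hG.apply_comm hy i s]
      ring
    have hφ : pderiv s f y = f y * (2 * halfLogDeriv f s y) := by
      have := (hpos y hy).ne'
      simp only [halfLogDeriv]; field_simp
    rw [hφ, mul_smul, ← hΛ, Matrix.transpose_add]
    simp only [smul_add, Matrix.add_mul, Matrix.mul_add, Matrix.mul_smul, Matrix.smul_mul]
    abel

end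

/-! ### Naturality of covariant derivatives of densities -/

/-- The factor `|det DF|^{-δ}`. -/
def densityFactor (δ : ℝ) (F : Coord n → Coord n) (y : Coord n) : ℝ := |(jacobian F y).det| ^ (-δ)

/-- The covariant differential of a density of weight `δ`. -/
def densGrad (Γ : Coeff n) (δ : ℝ) (u : Coord n → ℝ) (y : Coord n) (s : Fin n) : ℝ :=
  pderiv s u y - δ * contract Γ y s * u y

/-- The covariant Hessian of a density of weight `δ`. -/
def densHess (Γ : Coeff n) (δ : ℝ) (u : Coord n → ℝ) (y : Coord n) (s t : Fin n) : ℝ :=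
  pderiv s (fun z => densGrad Γ δ u z t) y - ∑ m, Γ y m s t * densGrad Γ δ u y m
    - δ * contract Γ y s * densGrad Γ δ u y t

/-- The trace of a twice contravariant tensor with respect to a metric. -/
def metricTrace (G : Coord n → Matrix (Fin n) (Fin n) ℝ) (P : Coord n → Fin n → Fin n → ℝ)
    (y : Coord n) : ℝ := ∑ i, ∑ j, G y i j * P y i j

/-- The matrix of components of the covariant derivative in the direction `∂_s`. -/
def covMatrix (Γ : Coeff n) (δ : ℝ) (P : Coord n → Fin n → Fin n → ℝ) (s : Fin n) (y : Coord n) :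
    Matrix (Fin n) (Fin n) ℝ := Matrix.of fun i j => covDeriv Γ δ P y s i j

/-- The components `P` have smooth entries. -/
def FieldSmoothOn (P : Coord n → Fin n → Fin n → ℝ) (U : Set (Coord n)) : Prop :=
  ∀ i j, ContDiffOn ℝ ∞ (fun z => P z i j) U

/-- `Γ'` is the pullback on `U` of the connection `Γ` under `F`. -/
def IsPullConn (F : Coord n → Coord n) (U : Set (Coord n)) (Γ Γ' : Coeff n) : Prop :=
  ∀ z ∈ U, pullbackConnection Γ F z = Γ' z

/-- `L'` is the pullback on `U` of the `(2,1)`-tensor field `L` under `F`. -/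
def IsPullTensor (F : Coord n → Coord n) (U : Set (Coord n)) (L L' : Coeff n) : Prop :=
  ∀ z ∈ U, ∀ s, jacobian F z * connMatrix L' s z = frameConn L F s z * jacobian F z

/-- `Q` is the push-forward of `P` under `F`, as a density of weight `δ`. -/
def IsPushField (F : Coord n → Coord n) (U : Set (Coord n)) (δ : ℝ)
    (P Q : Coord n → Fin n → Fin n → ℝ) : Prop :=
  ∀ z ∈ U, Matrix.of (Q (F z))
    = densityFactor δ F z • (jacobian F z * Matrix.of (P z) * (jacobian F z)ᵀ)

lemma sum_mul_eq_trace (A B : Matrix (Fin n) (Fin n) ℝ) :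
    ∑ i, ∑ j, A i j * B i j = (Aᵀ * B).trace := by
  simp only [Matrix.trace, Matrix.diag, Matrix.mul_apply, Matrix.transpose_apply]
  exact Finset.sum_comm

/-- A contravariant and a covariant 2-tensor are paired invariantly, by cyclicity of the trace. -/
lemma sum_contract {J W W' H H' : Matrix (Fin n) (Fin n) ℝ} (hW : W = J * W' * Jᵀ)
    (hH : H' = Jᵀ * H * J) : ∑ a, ∑ b, W a b * H a b = ∑ s, ∑ t, W' s t * H' s t := by
  rw [sum_mul_eq_trace, sum_mul_eq_trace, hW, hH]
  simp only [Matrix.transpose_mul, Matrix.transpose_transpose, Matrix.mul_assoc]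
  rw [Matrix.trace_mul_comm]
  simp only [Matrix.mul_assoc]

section

variable {G : Coord n → Matrix (Fin n) (Fin n) ℝ} {U V : Set (Coord n)} {y : Coord n}
  {F : Coord n → Coord n} {Γ Γ' : Coeff n} {δ : ℝ} {P Q : Coord n → Fin n → Fin n → ℝ}
  {u v : Coord n → ℝ}

/-- `contract` sums over the first lower index while `connMatrix` keeps that index as the direction.
Symmetry identifies the two traces. -/
lemma contract_eq_trace (hΓ : SymmOn Γ U) (hy : y ∈ U) (s : Fin n) :
    contract Γ y s = (connMatrix Γ s y).trace := by
  simp only [contract, Matrix.trace, Matrix.diag, connMatrix, Matrix.of_apply]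
  exact Finset.sum_congr rfl fun t _ => hΓ y hy t t s

lemma trace_frameConn (h : IsCoordMap F U V) (hΓ : SymmOn Γ V) (hy : y ∈ U) (s : Fin n) :
    (frameConn Γ F s y).trace = ∑ a, jacobian F y a s * contract Γ (F y) a := by
  simp only [frameConn, Matrix.trace_sum, Matrix.trace_smul, smul_eq_mul,
    contract_eq_trace hΓ (h.mapsTo hy)]

lemma IsPullConn.mderiv_jacobian (hp : IsPullConn F U Γ Γ') (h : IsCoordMap F U V) (hy : y ∈ U)
    (s : Fin n) : mderiv s (jacobian F) y
      = jacobian F y * connMatrix Γ' s y - frameConn Γ F s y * jacobian F y := by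
  rw [ConformalSchwarzian.mderiv_jacobian (Γ := Γ) h hy]
  simp only [connMatrix, hp y hy]

lemma IsPullConn.symmOn (hp : IsPullConn F U Γ Γ') (h : IsCoordMap F U V) (hΓ : SymmOn Γ V) :
    SymmOn Γ' U := fun z hz k i j => by
  rw [← hp z hz]; exact symmOn_pullbackConnection h hΓ z hz k i j

lemma contDiffOn_densityFactor (h : IsCoordMap F U V) :
    ContDiffOn ℝ ∞ (densityFactor δ F) U := by
  have hd := contDiffOn_det h.matSmoothOn_jacobian
  refine ContDiffOn.rpow_const_of_ne ?_ fun z hz => abs_ne_zero.2 (h.det_ne z hz)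
  exact fun z hz => ContDiffAt.comp_contDiffWithinAt (g := abs) (f := fun z => (jacobian F z).det) z
    (contDiffAt_abs (h.det_ne z hz)) (hd z hz)

/-- By the transformation law, tr(J⁻¹ ∂J) is the difference of the traces of the two connections. So
the factor absorbs exactly the change of the density term -δ Γ^t_{ts}. -/
lemma pderiv_densityFactor (h : IsCoordMap F U V) (hΓ : SymmOn Γ V) (hp : IsPullConn F U Γ Γ')
    (hy : y ∈ U) (s : Fin n) :
    pderiv s (densityFactor δ F) y = -δ * densityFactor δ F y *
      (contract Γ' y s - ∑ a, jacobian F y a s * contract Γ (F y) a) := by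
  have h1 : pderiv s (densityFactor δ F) y = -δ * densityFactor δ F y *
      ((jacobian F y)⁻¹ * mderiv s (jacobian F) y).trace :=
    pderiv_abs_det_rpow (h.matSmoothOn_jacobian.matDiffAt h.isOpen_source hy) (h.det_ne y hy) _ s
  rw [h1, hp.mderiv_jacobian h hy, contract_eq_trace (hp.symmOn h hΓ) hy, ← trace_frameConn h hΓ hy,
    Matrix.mul_sub, Matrix.trace_sub, ← Matrix.mul_assoc, h.inv_mul hy, Matrix.one_mul,
    Matrix.trace_mul_comm _ (_ * _), Matrix.mul_assoc, h.mul_inv hy, Matrix.mul_one]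

lemma covMatrix_eq (s : Fin n) :
    covMatrix Γ δ P s y = mderiv s (fun z => Matrix.of (P z)) y
      + connMatrix Γ s y * Matrix.of (P y) + Matrix.of (P y) * (connMatrix Γ s y)ᵀ
      - (δ * contract Γ y s) • Matrix.of (P y) := by
  ext i j
  simp only [covMatrix, Matrix.of_apply, covDeriv, Matrix.sub_apply, Matrix.add_apply,
    Matrix.mul_apply, mderiv, connMatrix, Matrix.transpose_apply, Matrix.smul_apply, smul_eq_mul,
    Finset.sum_add_distrib]
  have : ∑ x, Γ y j s x * P y i x = ∑ x, P y i x * Γ y j s x :=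
    Finset.sum_congr rfl fun x _ => mul_comm _ _
  rw [this]; ring

/-- Naturality of the covariant derivative. -/
lemma covMatrix_natural (h : IsCoordMap F U V) (hΓ : SymmOn Γ V) (hp : IsPullConn F U Γ Γ')
    (hP : FieldSmoothOn P U) (hQ : FieldSmoothOn Q V) (hPQ : IsPushField F U δ P Q) (hy : y ∈ U)
    (s : Fin n) :
    ∑ a, jacobian F y a s • covMatrix Γ δ Q a (F y)
      = densityFactor δ F y • (jacobian F y * covMatrix Γ' δ P s y * (jacobian F y)ᵀ) := by
  have hFy := h.mapsTo hy
  have hJ := h.matSmoothOn_jacobian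
  have dJ := hJ.matDiffAt h.isOpen_source hy
  have dP : MatDiffAt (fun z => Matrix.of (P z)) y :=
    MatSmoothOn.matDiffAt (U := U) hP h.isOpen_source hy
  have hJP : MatSmoothOn (fun z => jacobian F z * Matrix.of (P z)) U :=
    hJ.mul (N := fun z => Matrix.of (P z)) hP
  have dJP := hJP.matDiffAt h.isOpen_source hy
  have dJPJ := (hJP.mul hJ.transpose).matDiffAt h.isOpen_source hy
  have dD := differentiableAt_of_contDiffOn h.isOpen_source (contDiffOn_densityFactor (δ := δ) h) hy
  -- Both sides of Q ∘ F = D · J P Jᵀ are differentiated, the left by the chain rule and the right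
  -- by the product rule.
  have e1 : ∑ a, jacobian F y a s • mderiv a (fun z => Matrix.of (Q z)) (F y)
      = mderiv s (fun z => densityFactor δ F z •
          (jacobian F z * Matrix.of (P z) * (jacobian F z)ᵀ)) y := by
    rw [← mderiv_comp (M := fun z => Matrix.of (Q z)) (h.differentiableAt hy)
      (MatSmoothOn.matDiffAt (U := V) hQ h.isOpen_target hFy)]
    exact mderiv_congr h.isOpen_source hy hPQ s
  rw [mderiv_smul dD dJPJ, mderiv_mul dJP (N := fun z => (jacobian F z)ᵀ) (fun i j => dJ j i),
    mderiv_mul dJ dP, mderiv_transpose, hp.mderiv_jacobian h hy,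
    pderiv_densityFactor h hΓ hp hy] at e1
  simp only [covMatrix_eq]
  have e2 : ∑ a, jacobian F y a s • (mderiv a (fun z => Matrix.of (Q z)) (F y)
      + connMatrix Γ a (F y) * Matrix.of (Q (F y)) + Matrix.of (Q (F y)) * (connMatrix Γ a (F y))ᵀ
      - (δ * contract Γ (F y) a) • Matrix.of (Q (F y)))
      = ∑ a, jacobian F y a s • mderiv a (fun z => Matrix.of (Q z)) (F y)
        + frameConn Γ F s y * Matrix.of (Q (F y)) + Matrix.of (Q (F y)) * (frameConn Γ F s y)ᵀ
        - (δ * ∑ a, jacobian F y a s * contract Γ (F y) a) • Matrix.of (Q (F y)) := by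
    simp only [smul_add, smul_sub, Finset.sum_add_distrib, Finset.sum_sub_distrib, frameConn,
      Matrix.transpose_sum, Matrix.transpose_smul, Matrix.sum_mul, Matrix.smul_mul,
      Matrix.mul_smul, Finset.mul_sum, Finset.sum_smul, smul_smul]
    simp only [mul_left_comm δ]
  rw [e2, e1, hPQ y hy]
  generalize ∑ a, jacobian F y a s * contract Γ (F y) a = c
  simp only [Matrix.mul_add, Matrix.add_mul, Matrix.mul_sub, Matrix.sub_mul, smul_add, smul_sub,
    Matrix.transpose_sub, Matrix.transpose_mul, Matrix.smul_mul, Matrix.mul_smul, smul_smul,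
    Matrix.mul_assoc]
  module

lemma contDiffOn_contract (hΓ : CoeffSmoothOn Γ U) (s : Fin n) :
    ContDiffOn ℝ ∞ (fun z => contract Γ z s) U := ContDiffOn.sum fun t _ => hΓ t t s

lemma contDiffOn_densGrad (hU : IsOpen U) (hΓ : CoeffSmoothOn Γ U) (hu : ContDiffOn ℝ ∞ u U)
    (s : Fin n) : ContDiffOn ℝ ∞ (fun z => densGrad Γ δ u z s) U :=
  (contDiffOn_pderiv hU hu s).sub
    ((contDiffOn_const.mul (contDiffOn_contract hΓ s)).mul hu)

lemma contDiffOn_metricTrace (hG : MatSmoothOn G U) (hP : FieldSmoothOn P U) :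
    ContDiffOn ℝ ∞ (metricTrace G P) U :=
  ContDiffOn.sum fun i _ => ContDiffOn.sum fun j _ => (hG i j).mul (hP i j)

lemma fieldSmoothOn_covDeriv (hU : IsOpen U) (hΓ : CoeffSmoothOn Γ U) (hP : FieldSmoothOn P U)
    (s : Fin n) : FieldSmoothOn (fun z => covDeriv Γ δ P z s) U := fun i j =>
  ((contDiffOn_pderiv hU (hP i j) s).add (ContDiffOn.sum fun m _ =>
    ((hΓ i s m).mul (hP m j)).add ((hΓ j s m).mul (hP i m)))).sub
    ((contDiffOn_const.mul (contDiffOn_contract hΓ s)).mul (hP i j))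

/-- Naturality of the covariant differential of a density. -/
lemma densGrad_natural (h : IsCoordMap F U V) (hΓ : SymmOn Γ V) (hp : IsPullConn F U Γ Γ')
    (hu : ContDiffOn ℝ ∞ u V) (hv : ContDiffOn ℝ ∞ v U)
    (huv : ∀ z ∈ U, u (F z) = densityFactor δ F z * v z) (hy : y ∈ U) (s : Fin n) :
    ∑ a, jacobian F y a s * densGrad Γ δ u (F y) a = densityFactor δ F y * densGrad Γ' δ v y s := by
  have e1 : ∑ a, jacobian F y a s * pderiv a u (F y)
      = pderiv s (densityFactor δ F) y * v y + densityFactor δ F y * pderiv s v y := by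
    rw [← pderiv_comp (h.differentiableAt hy)
      (differentiableAt_of_contDiffOn h.isOpen_target hu (h.mapsTo hy)),
      pderiv_congr h.isOpen_source hy huv]
    exact pderiv_mul (differentiableAt_of_contDiffOn h.isOpen_source (contDiffOn_densityFactor h) hy)
      (differentiableAt_of_contDiffOn h.isOpen_source hv hy) s
  have e2 : ∑ a, jacobian F y a s * densGrad Γ δ u (F y) a
      = ∑ a, jacobian F y a s * pderiv a u (F y)
        - δ * (∑ a, jacobian F y a s * contract Γ (F y) a) * u (F y) := by
    simp only [densGrad, mul_sub, Finset.sum_sub_distrib, Finset.mul_sum, Finset.sum_mul]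
    congr 1
    exact Finset.sum_congr rfl fun a _ => by ring
  rw [e2, e1, pderiv_densityFactor h hΓ hp hy, huv y hy, densGrad]
  ring

lemma pderiv_jacobian (hp : IsPullConn F U Γ Γ') (h : IsCoordMap F U V) (hy : y ∈ U)
    (a s t : Fin n) : pderiv s (fun z => jacobian F z a t) y
      = ∑ m, jacobian F y a m * Γ' y m s t
        - ∑ b, ∑ c, jacobian F y b s * jacobian F y c t * Γ (F y) a b c := by
  have := congrFun (congrFun (hp.mderiv_jacobian h hy s) a) t
  simp only [mderiv, Matrix.of_apply, Matrix.sub_apply, Matrix.mul_apply, connMatrix, frameConn,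
    Matrix.sum_apply, Matrix.smul_apply, smul_eq_mul, Finset.sum_mul] at this
  rw [this]
  congr 1
  exact Finset.sum_congr rfl fun b _ => Finset.sum_congr rfl fun c _ => by ring

/-- Naturality of the covariant Hessian of a density. -/
lemma densHess_natural (h : IsCoordMap F U V) (hΓ : SymmOn Γ V) (hp : IsPullConn F U Γ Γ')
    (sΓ : CoeffSmoothOn Γ V) (sΓ' : CoeffSmoothOn Γ' U)
    (hu : ContDiffOn ℝ ∞ u V) (hv : ContDiffOn ℝ ∞ v U)
    (huv : ∀ z ∈ U, u (F z) = densityFactor δ F z * v z) (hy : y ∈ U) (s t : Fin n) :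
    ∑ a, ∑ b, jacobian F y a s * jacobian F y b t * densHess Γ δ u (F y) a b
      = densityFactor δ F y * densHess Γ' δ v y s t := by
  have hFy := h.mapsTo hy
  have hg : ∀ {z}, z ∈ U → ∀ s, _ := fun {z} hz => densGrad_natural h hΓ hp hu hv huv (y := z) hz
  have dg : ∀ b, DifferentiableAt ℝ (fun z => densGrad Γ δ u z b) (F y) := fun b =>
    differentiableAt_of_contDiffOn h.isOpen_target (contDiffOn_densGrad h.isOpen_target sΓ hu b) hFy
  have dgF : ∀ b, DifferentiableAt ℝ (fun z => densGrad Γ δ u (F z) b) y := fun b =>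
    (dg b).comp y (h.differentiableAt hy)
  have dJ := h.matSmoothOn_jacobian.matDiffAt h.isOpen_source hy
  -- Naturality of the gradient is differentiated once more. The derivative of the Jacobian produces
  -- the Christoffel terms of the two Hessians.
  have e1 : pderiv s (fun z => ∑ b, jacobian F z b t * densGrad Γ δ u (F z) b) y
      = pderiv s (densityFactor δ F) y * densGrad Γ' δ v y t
        + densityFactor δ F y * pderiv s (fun z => densGrad Γ' δ v z t) y := by
    rw [pderiv_congr h.isOpen_source hy (fun z hz => hg hz t)]
    exact pderiv_mul (differentiableAt_of_contDiffOn h.isOpen_source (contDiffOn_densityFactor h) hy)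
      (differentiableAt_of_contDiffOn h.isOpen_source
        (contDiffOn_densGrad h.isOpen_source sΓ' hv t) hy) s
  rw [pderiv_sum (w := fun b z => jacobian F z b t * densGrad Γ δ u (F z) b)
    (fun b _ => (dJ b t).mul (dgF b))] at e1
  simp only [pderiv_mul (dJ _ t) (dgF _), pderiv_comp (h.differentiableAt hy) (dg _),
    pderiv_jacobian hp h hy, Finset.sum_add_distrib] at e1
  have e2 : ∑ b, (∑ m, jacobian F y b m * Γ' y m s t
      - ∑ a, ∑ c, jacobian F y a s * jacobian F y c t * Γ (F y) b a c) * densGrad Γ δ u (F y) b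
      = densityFactor δ F y * ∑ m, Γ' y m s t * densGrad Γ' δ v y m
        - ∑ a, ∑ c, jacobian F y a s * jacobian F y c t
            * ∑ b, Γ (F y) b a c * densGrad Γ δ u (F y) b := by
    simp only [sub_mul, Finset.sum_sub_distrib, Finset.sum_mul, Finset.mul_sum]
    congr 1
    · rw [Finset.sum_comm]
      refine Finset.sum_congr rfl fun m _ => ?_
      rw [mul_left_comm, ← hg hy, Finset.mul_sum]
      exact Finset.sum_congr rfl fun b _ => by ring
    · rw [Finset.sum_comm]
      refine Finset.sum_congr rfl fun a _ => ?_
      rw [Finset.sum_comm]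
      exact Finset.sum_congr rfl fun c _ => Finset.sum_congr rfl fun b _ => by ring
  have e3 : ∑ a, ∑ b, jacobian F y a s * jacobian F y b t * densHess Γ δ u (F y) a b
      = ∑ b, jacobian F y b t * ∑ a, jacobian F y a s *
          pderiv a (fun z => densGrad Γ δ u z b) (F y)
        - ∑ a, ∑ c, jacobian F y a s * jacobian F y c t
            * ∑ b, Γ (F y) b a c * densGrad Γ δ u (F y) b
        - δ * (∑ a, jacobian F y a s * contract Γ (F y) a) *
            ∑ b, jacobian F y b t * densGrad Γ δ u (F y) b := by
    simp only [densHess, mul_sub, Finset.sum_sub_distrib]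
    congr 1
    · congr 1
      rw [Finset.sum_comm]
      simp only [Finset.mul_sum]
      exact Finset.sum_congr rfl fun b _ => Finset.sum_congr rfl fun a _ => by ring
    · rw [mul_assoc, Finset.sum_mul, Finset.mul_sum]
      refine Finset.sum_congr rfl fun a _ => ?_
      simp only [Finset.mul_sum]
      exact Finset.sum_congr rfl fun b _ => by ring
  rw [e2, pderiv_densityFactor h hΓ hp hy] at e1
  rw [e3, hg hy, densHess]
  linear_combination e1

/-! ### Traces with respect to the metric -/

/-- The metric trace commutes with the covariant derivative. -/
lemma sum_metric_covDeriv (hU : IsOpen U) (hG : IsMetricOn G U) (hP : FieldSmoothOn P U)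
    (hy : y ∈ U) (s : Fin n) :
    ∑ i, ∑ j, G y i j * covDeriv (christoffel G) δ P y s i j
      = densGrad (christoffel G) δ (metricTrace G P) y s := by
  have hΓ := symmOn_christoffel hU hG
  have dG := hG.smooth.matDiffAt hU hy
  have dP : ∀ i j, DifferentiableAt ℝ (fun z => P z i j) y :=
    fun i j => differentiableAt_of_contDiffOn hU (hP i j) hy
  have e1 : pderiv s (metricTrace G P) y
      = ((mderiv s G y)ᵀ * Matrix.of (P y)).trace
        + ((G y)ᵀ * mderiv s (fun z => Matrix.of (P z)) y).trace := by
    rw [← sum_mul_eq_trace, ← sum_mul_eq_trace, ← Finset.sum_add_distrib]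
    simp only [← Finset.sum_add_distrib]
    unfold metricTrace
    rw [pderiv_sum (w := fun i z => ∑ j, G z i j * P z i j)
      (fun i _ => DifferentiableAt.fun_sum fun j _ => (dG i j).mul (dP i j))]
    refine Finset.sum_congr rfl fun i _ => ?_
    rw [pderiv_sum (w := fun j z => G z i j * P z i j) (fun j _ => (dG i j).mul (dP i j))]
    exact Finset.sum_congr rfl fun j _ => pderiv_mul (dG i j) (dP i j) s
  have e2 : ∑ i, ∑ j, G y i j * covDeriv (christoffel G) δ P y s i j
      = ((G y)ᵀ * covMatrix (christoffel G) δ P s y).trace := (sum_mul_eq_trace _ _)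
  have e3 : metricTrace G P y = ((G y)ᵀ * Matrix.of (P y)).trace := sum_mul_eq_trace _ _
  rw [e2, densGrad, e1, e3, covMatrix_eq, mderiv_metric hU hG hy]
  simp only [Matrix.mul_add, Matrix.mul_sub, Matrix.add_mul, Matrix.trace_add, Matrix.trace_sub,
    Matrix.mul_smul, Matrix.trace_smul, smul_eq_mul, Matrix.transpose_add, Matrix.transpose_mul,
    Matrix.transpose_transpose, hG.symm y hy, Matrix.mul_assoc]
  -- Cyclicity aligns the transposed connection term from ∂G with the one from ∇P.
  rw [Matrix.trace_mul_comm (connMatrix (christoffel G) s y)ᵀ, Matrix.mul_assoc]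
  ring

/-- The metric trace commutes with the second covariant derivative. -/
lemma sum_metric_covDeriv₂ (hU : IsOpen U) (hG : IsMetricOn G U) (hP : FieldSmoothOn P U)
    (hy : y ∈ U) (s t : Fin n) :
    ∑ i, ∑ j, G y i j * covDeriv₂ (christoffel G) δ P y s t i j
      = densHess (christoffel G) δ (metricTrace G P) y s t := by
  have sΓ := coeffSmoothOn_christoffel hU hG
  -- With t frozen, ∇_t P is again a contravariant 2-field, so the first order statement applies to
  -- it. Only the Christoffel term for the slot t is left over.
  have e1 : ∀ i j, covDeriv₂ (christoffel G) δ P y s t i j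
      = covDeriv (christoffel G) δ (fun z => covDeriv (christoffel G) δ P z t) y s i j
        - ∑ m, christoffel G y m s t * covDeriv (christoffel G) δ P y m i j := by
    intro i j
    have e : covDeriv (christoffel G) δ (fun z => covDeriv (christoffel G) δ P z t) y s i j
      = pderiv s (fun z => covDeriv (christoffel G) δ P z t i j) y
        + ∑ m, (christoffel G y i s m * covDeriv (christoffel G) δ P y t m j
          + christoffel G y j s m * covDeriv (christoffel G) δ P y t i m)
        - δ * contract (christoffel G) y s * covDeriv (christoffel G) δ P y t i j := rfl
    rw [e, covDeriv₂]
    simp only [Finset.sum_sub_distrib]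
    ring
  have e2 := sum_metric_covDeriv (δ := δ) hU hG (fieldSmoothOn_covDeriv (δ := δ) hU sΓ hP t) hy s
  have e3 : ∀ z ∈ U, metricTrace G (fun z => covDeriv (christoffel G) δ P z t) z
      = densGrad (christoffel G) δ (metricTrace G P) z t := fun z hz =>
    sum_metric_covDeriv hU hG hP hz t
  have e4 : ∑ i, ∑ j, G y i j * ∑ m, christoffel G y m s t * covDeriv (christoffel G) δ P y m i j
      = ∑ m, christoffel G y m s t * densGrad (christoffel G) δ (metricTrace G P) y m := by
    simp only [← sum_metric_covDeriv hU hG hP hy, Finset.mul_sum]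
    have : ∀ i : Fin n, ∑ j, ∑ m, G y i j *
        (christoffel G y m s t * covDeriv (christoffel G) δ P y m i j)
        = ∑ m, ∑ j, christoffel G y m s t * (G y i j * covDeriv (christoffel G) δ P y m i j) := by
      intro i
      rw [Finset.sum_comm]
      exact Finset.sum_congr rfl fun m _ => Finset.sum_congr rfl fun j _ => by ring
    simp only [this]
    exact Finset.sum_comm
  simp only [e1, mul_sub, Finset.sum_sub_distrib]
  rw [e2, e4, densGrad, densHess, e3 y hy, pderiv_congr hU hy e3]
  ring

/-- Naturality of the metric trace. -/
lemma metricTrace_natural (hPQ : IsPushField F U δ P Q) (hy : y ∈ U) :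
    metricTrace G Q (F y) = densityFactor δ F y * metricTrace (pullMetric F G) P y := by
  have := sum_contract (J := jacobian F y) (W := jacobian F y * Matrix.of (P y) * (jacobian F y)ᵀ)
    (H := G (F y)) rfl (rfl : pullMetric F G y = _)
  have e : ∀ i j, Q (F y) i j = densityFactor δ F y *
      (jacobian F y * Matrix.of (P y) * (jacobian F y)ᵀ) i j := fun i j =>
    congrFun (congrFun (hPQ y hy) i) j
  simp only [metricTrace, e]
  simp only [Matrix.of_apply] at this
  simp only [mul_comm (pullMetric F G y _ _), ← this, Finset.mul_sum]
  exact Finset.sum_congr rfl fun i _ => Finset.sum_congr rfl fun j _ => by ring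

lemma inv_eq_of_pullMetric (h : IsCoordMap F U V) (hy : y ∈ U) :
    (G (F y))⁻¹ = jacobian F y * (pullMetric F G y)⁻¹ * (jacobian F y)ᵀ := by
  have hT : (jacobian F y)ᵀ⁻¹ * (jacobian F y)ᵀ = 1 :=
    Matrix.nonsing_inv_mul _ (by rw [Matrix.det_transpose]; exact isUnit_iff_ne_zero.2 (h.det_ne y hy))
  simp only [pullMetric, Matrix.mul_inv_rev, Matrix.mul_assoc, hT, Matrix.mul_one]
  rw [← Matrix.mul_assoc, h.mul_inv hy, Matrix.one_mul]

end

/-! ### Naturality of curvature and of tensorial expressions -/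

/-- The curvature of a connection in the directions `∂_i`, `∂_k`, as a matrix. -/
def curvMatrix (Γ : Coeff n) (i k : Fin n) (y : Coord n) : Matrix (Fin n) (Fin n) ℝ :=
  mderiv i (connMatrix Γ k) y - mderiv k (connMatrix Γ i) y
    + (connMatrix Γ i y * connMatrix Γ k y - connMatrix Γ k y * connMatrix Γ i y)

/-- The matrix `(∇_u T^k_{ij})_{kj}`. -/
def covTensorMatrix (Γ T : Coeff n) (u i : Fin n) (y : Coord n) : Matrix (Fin n) (Fin n) ℝ :=
  Matrix.of fun k j => covDerivTensor Γ T y u k i j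

section

variable {G : Coord n → Matrix (Fin n) (Fin n) ℝ} {U V : Set (Coord n)} {y : Coord n}
  {F : Coord n → Coord n} {Γ Γ' T T' L L' : Coeff n} {δ : ℝ} {P Q : Coord n → Fin n → Fin n → ℝ}

lemma covTensorMatrix_eq (u i : Fin n) :
    covTensorMatrix Γ T u i y = mderiv u (connMatrix T i) y + connMatrix Γ u y * connMatrix T i y
      - connMatrix T i y * connMatrix Γ u y - ∑ m, Γ y m u i • connMatrix T m y := by
  ext k j
  simp only [covTensorMatrix, Matrix.of_apply, covDerivTensor, mderiv, connMatrix, Matrix.add_apply,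
    Matrix.sub_apply, Matrix.mul_apply, Matrix.sum_apply, Matrix.smul_apply, smul_eq_mul,
    Finset.sum_sub_distrib]
  have : ∑ m, Γ y m u j * T y k i m = ∑ m, T y k i m * Γ y m u j :=
    Finset.sum_congr rfl fun m _ => mul_comm _ _
  rw [this]; ring

lemma matSmoothOn_frameConn (h : IsCoordMap F U V) (sT : CoeffSmoothOn T V) (s : Fin n) :
    MatSmoothOn (frameConn T F s) U :=
  MatSmoothOn.sum fun a _ => MatSmoothOn.smul (N := fun z => connMatrix T a (F z))
    (h.matSmoothOn_jacobian a s) ((sT.connMatrix a).comp h)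

lemma mderiv_frameConn (h : IsCoordMap F U V) (sT : CoeffSmoothOn T V) (hy : y ∈ U)
    (t s : Fin n) :
    mderiv t (frameConn T F s) y
      = ∑ a, pderiv t (fun z => jacobian F z a s) y • connMatrix T a (F y)
        + ∑ b, ∑ a, (jacobian F y b t * jacobian F y a s) • mderiv b (connMatrix T a) (F y) := by
  have dJ := h.matSmoothOn_jacobian.matDiffAt h.isOpen_source hy
  have dT : ∀ a, MatDiffAt (connMatrix T a) (F y) := fun a =>
    (sT.connMatrix a).matDiffAt h.isOpen_target (h.mapsTo hy)
  have dTF : ∀ a, MatDiffAt (fun z => connMatrix T a (F z)) y := fun a =>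
    ((sT.connMatrix a).comp h).matDiffAt h.isOpen_source hy
  have e : frameConn T F s = fun z => ∑ a, jacobian F z a s • connMatrix T a (F z) := rfl
  rw [e, mderiv_sum (fun a _ => MatSmoothOn.matDiffAt (MatSmoothOn.smul
    (N := fun z => connMatrix T a (F z)) (h.matSmoothOn_jacobian a s) ((sT.connMatrix a).comp h))
    h.isOpen_source hy)]
  simp only [mderiv_smul (dJ _ s) (dTF _), mderiv_comp (h.differentiableAt hy) (dT _),
    Finset.sum_add_distrib, Finset.smul_sum, smul_smul]
  congr 1
  rw [Finset.sum_comm]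
  exact Finset.sum_congr rfl fun b _ => Finset.sum_congr rfl fun a _ => by rw [mul_comm]

lemma mderiv_comm {M : Coord n → Matrix (Fin n) (Fin n) ℝ} (hU : IsOpen U) (hM : MatSmoothOn M U)
    (hy : y ∈ U) (s t : Fin n) : mderiv s (mderiv t M) y = mderiv t (mderiv s M) y := by
  ext i j; exact pderiv_comm hU (hM i j) hy s t

lemma frameConn_mul {A B : Coeff n} (t s : Fin n) :
    frameConn A F t y * frameConn B F s y = ∑ b, ∑ a, (jacobian F y b t * jacobian F y a s) •
      (connMatrix A b (F y) * connMatrix B a (F y)) := by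
  simp only [frameConn, Matrix.sum_mul, Matrix.mul_sum]
  rw [Finset.sum_comm]
  refine Finset.sum_congr rfl fun b _ => Finset.sum_congr rfl fun a _ => ?_
  rw [Matrix.smul_mul, Matrix.mul_smul, smul_smul]

lemma frameConn_mul' {A B : Coeff n} (t s : Fin n) :
    frameConn B F s y * frameConn A F t y = ∑ b, ∑ a, (jacobian F y b t * jacobian F y a s) •
      (connMatrix B a (F y) * connMatrix A b (F y)) := by
  rw [frameConn_mul, Finset.sum_comm]
  simp only [mul_comm (jacobian F y _ s)]

/-- Naturality of the curvature. -/
lemma curvMatrix_natural (h : IsCoordMap F U V) (hp : IsPullConn F U Γ Γ')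
    (sΓ : CoeffSmoothOn Γ V) (sΓ' : CoeffSmoothOn Γ' U) (hy : y ∈ U) (t s : Fin n) :
    jacobian F y * curvMatrix Γ' t s y
      = (∑ b, ∑ a, (jacobian F y b t * jacobian F y a s) • curvMatrix Γ b a (F y))
          * jacobian F y := by
  have hJ := h.matSmoothOn_jacobian
  have dJ := hJ.matDiffAt h.isOpen_source hy
  have E : ∀ t s, mderiv t (mderiv s (jacobian F)) y
      = mderiv t (jacobian F) y * connMatrix Γ' s y + jacobian F y * mderiv t (connMatrix Γ' s) y
        - (mderiv t (frameConn Γ F s) y * jacobian F y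
          + frameConn Γ F s y * mderiv t (jacobian F) y) := by
    intro t s
    rw [mderiv_congr h.isOpen_source hy (fun z hz => hp.mderiv_jacobian h hz s),
      mderiv_sub ((hJ.mul (sΓ'.connMatrix s)).matDiffAt h.isOpen_source hy)
        (((matSmoothOn_frameConn h sΓ s).mul hJ).matDiffAt h.isOpen_source hy),
      mderiv_mul dJ ((sΓ'.connMatrix s).matDiffAt h.isOpen_source hy),
      mderiv_mul ((matSmoothOn_frameConn h sΓ s).matDiffAt h.isOpen_source hy) dJ]
  -- The curvature relation is the integrability condition of the first order system for J: the
  -- second derivatives of J commute.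
  have E0 := mderiv_comm h.isOpen_source hJ hy t s
  rw [E, E] at E0
  -- The terms with derivatives of J are symmetric in s and t and drop out of the
  -- antisymmetrisation.
  have hR : ∑ b, ∑ a, (jacobian F y b t * jacobian F y a s) • curvMatrix Γ b a (F y)
      = mderiv t (frameConn Γ F s) y - mderiv s (frameConn Γ F t) y
        + (frameConn Γ F t y * frameConn Γ F s y - frameConn Γ F s y * frameConn Γ F t y) := by
    rw [mderiv_frameConn h sΓ hy, mderiv_frameConn h sΓ hy]
    simp only [pderiv_jacobian_comm h hy _ s t]
    have c1 : ∑ b, ∑ a, (jacobian F y b s * jacobian F y a t) • mderiv b (connMatrix Γ a) (F y)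
        = ∑ b, ∑ a, (jacobian F y b t * jacobian F y a s) • mderiv a (connMatrix Γ b) (F y) := by
      rw [Finset.sum_comm]
      exact Finset.sum_congr rfl fun b _ => Finset.sum_congr rfl fun a _ => by rw [mul_comm]
    rw [c1, frameConn_mul, frameConn_mul']
    simp only [curvMatrix, smul_add, smul_sub, Finset.sum_add_distrib, Finset.sum_sub_distrib]
    abel
  rw [hR, curvMatrix]
  rw [hp.mderiv_jacobian h hy, hp.mderiv_jacobian h hy] at E0
  rw [← sub_eq_zero] at E0 ⊢
  rw [← E0]
  noncomm_ring

/-- Naturality of the covariant derivative of a `(2,1)`-tensor field. -/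
lemma covTensorMatrix_natural (h : IsCoordMap F U V) (hp : IsPullConn F U Γ Γ')
    (sT : CoeffSmoothOn T V) (sT' : CoeffSmoothOn T' U) (hT : IsPullTensor F U T T') (hy : y ∈ U)
    (u i : Fin n) :
    jacobian F y * covTensorMatrix Γ' T' u i y
      = (∑ b, ∑ a, (jacobian F y b u * jacobian F y a i) • covTensorMatrix Γ T b a (F y))
          * jacobian F y := by
  have hJ := h.matSmoothOn_jacobian
  have dJ := hJ.matDiffAt h.isOpen_source hy
  have E := mderiv_congr h.isOpen_source hy (fun z hz => hT z hz i) u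
  rw [mderiv_mul dJ ((sT'.connMatrix i).matDiffAt h.isOpen_source hy),
    mderiv_mul ((matSmoothOn_frameConn h sT i).matDiffAt h.isOpen_source hy) dJ,
    hp.mderiv_jacobian h hy, mderiv_frameConn h sT hy] at E
  have e1 : ∑ a, pderiv u (fun z => jacobian F z a i) y • connMatrix T a (F y)
      = ∑ m, Γ' y m u i • frameConn T F m y
        - ∑ b, ∑ a, (jacobian F y b u * jacobian F y a i) •
            ∑ m, Γ (F y) m b a • connMatrix T m (F y) := by
    simp only [pderiv_jacobian hp h hy, sub_smul, Finset.sum_sub_distrib, frameConn,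
      Finset.smul_sum, Finset.sum_smul, smul_smul]
    congr 1
    · rw [Finset.sum_comm]
      exact Finset.sum_congr rfl fun b _ => Finset.sum_congr rfl fun a _ => by rw [mul_comm]
    · rw [Finset.sum_comm]
      exact Finset.sum_congr rfl fun b _ => Finset.sum_comm
  have e2 : ∑ b, ∑ a, (jacobian F y b u * jacobian F y a i) • covTensorMatrix Γ T b a (F y)
      = ∑ b, ∑ a, (jacobian F y b u * jacobian F y a i) • mderiv b (connMatrix T a) (F y)
        + frameConn Γ F u y * frameConn T F i y - frameConn T F i y * frameConn Γ F u y
        - ∑ b, ∑ a, (jacobian F y b u * jacobian F y a i) •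
            ∑ m, Γ (F y) m b a • connMatrix T m (F y) := by
    rw [frameConn_mul, frameConn_mul']
    simp only [covTensorMatrix_eq, smul_add, smul_sub, Finset.sum_add_distrib,
      Finset.sum_sub_distrib]
  have e3 : jacobian F y * ∑ m, Γ' y m u i • connMatrix T' m y
      = (∑ m, Γ' y m u i • frameConn T F m y) * jacobian F y := by
    simp only [Matrix.mul_sum, Matrix.sum_mul, Matrix.mul_smul, Matrix.smul_mul, hT y hy]
  have e4 := hT y hy i
  rw [e1] at E
  rw [e2, covTensorMatrix_eq, Matrix.mul_sub, e3]
  generalize ∑ m, Γ' y m u i • frameConn T F m y = X at *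
  generalize ∑ b, ∑ a, (jacobian F y b u * jacobian F y a i) • mderiv b (connMatrix T a) (F y) = Y
    at *
  generalize ∑ b, ∑ a, (jacobian F y b u * jacobian F y a i) •
            ∑ m, Γ (F y) m b a • connMatrix T m (F y) = Z at *
  have e5 : frameConn Γ F u y * (jacobian F y * connMatrix T' i y)
      = frameConn Γ F u y * (frameConn T F i y * jacobian F y) := by rw [e4]
  have e6 : (jacobian F y * connMatrix T' i y) * connMatrix Γ' u y
      = (frameConn T F i y * jacobian F y) * connMatrix Γ' u y := by rw [e4]
  rw [← sub_eq_zero] at E e5 e6 ⊢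
  -- The three zeros are replaced by E, e5 and e6, exhibiting the goal as the combination E + e5 -
  -- e6.
  have : (0 : Matrix (Fin n) (Fin n) ℝ) = 0 + 0 - 0 := by simp
  rw [this]
  nth_rewrite 1 [← E]
  nth_rewrite 1 [← e5]
  rw [← e6]
  noncomm_ring

/-- Contracting the upper index of a family of matrices against its first lower index. -/
lemma trace_natural (h : IsCoordMap F U V) (hy : y ∈ U)
    {X X' : Fin n → Fin n → Matrix (Fin n) (Fin n) ℝ}
    (hX : ∀ u i, jacobian F y * X' u i
      = (∑ b, ∑ a, (jacobian F y b u * jacobian F y a i) • X b a) * jacobian F y) :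
    (Matrix.of fun i j => ∑ u, X' u i u j)
      = (jacobian F y)ᵀ * (Matrix.of fun a m => ∑ b, X b a b m) * jacobian F y := by
  ext i j
  have e1 : ∀ u, X' u i = (jacobian F y)⁻¹ *
      ((∑ b, ∑ a, (jacobian F y b u * jacobian F y a i) • X b a) * jacobian F y) := fun u => by
    rw [← hX, ← Matrix.mul_assoc, h.inv_mul hy, Matrix.one_mul]
  have e2 : ∀ u, X' u i u j = ∑ b, (jacobian F y b u) * ∑ c, (jacobian F y)⁻¹ u c *
      ∑ a, jacobian F y a i * (X b a * jacobian F y) c j := by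
    intro u
    rw [e1, Matrix.sum_mul, Matrix.mul_sum, Matrix.sum_apply]
    refine Finset.sum_congr rfl fun b _ => ?_
    rw [Matrix.sum_mul, Matrix.mul_apply, Finset.mul_sum]
    refine Finset.sum_congr rfl fun c _ => ?_
    simp only [Matrix.sum_apply, Matrix.smul_mul, Matrix.smul_apply, smul_eq_mul, Finset.mul_sum]
    exact Finset.sum_congr rfl fun a _ => by ring
  have e3 : ∑ u, X' u i u j = ∑ b, ∑ a, jacobian F y a i * (X b a * jacobian F y) b j := by
    simp only [e2]
    rw [Finset.sum_comm]
    refine Finset.sum_congr rfl fun b _ => ?_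
    have : ∀ u, jacobian F y b u * ∑ c, (jacobian F y)⁻¹ u c *
        ∑ a, jacobian F y a i * (X b a * jacobian F y) c j
        = ∑ c, (jacobian F y b u * (jacobian F y)⁻¹ u c) *
        ∑ a, jacobian F y a i * (X b a * jacobian F y) c j := fun u => by
      rw [Finset.mul_sum]; exact Finset.sum_congr rfl fun c _ => by rw [mul_assoc]
    simp only [this]
    rw [Finset.sum_comm]
    simp only [← Finset.sum_mul, ← Matrix.mul_apply, h.mul_inv hy, Matrix.one_apply]
    simp
  rw [Matrix.of_apply, e3, Finset.sum_comm, Matrix.mul_assoc, Matrix.mul_apply]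
  refine Finset.sum_congr rfl fun a _ => ?_
  simp only [Matrix.transpose_apply, Matrix.mul_apply, Matrix.of_apply, ← Finset.mul_sum]
  congr 1
  rw [Finset.sum_comm]
  simp only [Finset.sum_mul]

/-- Symmetry of Γ moves j into the column position, so Ricci becomes a contraction of curvature
matrices, to which `trace_natural` applies. -/
lemma ricci_eq (hU : IsOpen U) (hΓ : SymmOn Γ U) (hy : y ∈ U) (j k : Fin n) :
    ricci Γ y j k = ∑ i, curvMatrix Γ i k y i j := by
  simp only [ricci, curvMatrix, Matrix.add_apply, Matrix.sub_apply, mderiv, Matrix.of_apply,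
    connMatrix, Matrix.mul_apply]
  refine Finset.sum_congr rfl fun i _ => ?_
  rw [pderiv_congr hU hy (fun z hz => hΓ z hz i j k), Finset.sum_sub_distrib]
  simp only [hΓ y hy _ j k]

/-- Naturality of the scalar curvature. -/
lemma scalarCurvature_natural (h : IsCoordMap F U V) (hG : IsMetricOn G V) (hy : y ∈ U) :
    scalarCurvature G (F y) = scalarCurvature (pullMetric F G) y := by
  have hp : IsPullConn F U (christoffel G) (christoffel (pullMetric F G)) :=
    fun z hz => pullbackConnection_christoffel h hG hz
  have hΓ := symmOn_christoffel h.isOpen_target hG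
  have hR := trace_natural h hy (curvMatrix_natural h hp (coeffSmoothOn_christoffel h.isOpen_target hG)
    (coeffSmoothOn_christoffel h.isOpen_source (hG.pullMetric h)) hy)
  have hW := inv_eq_of_pullMetric (G := G) h hy
  have := sum_contract hW hR
  simp only [scalarCurvature, ricci_eq h.isOpen_target hΓ (h.mapsTo hy),
    ricci_eq h.isOpen_source (hp.symmOn h hΓ) hy]
  -- The contraction of the curvature has its indices in the order (k, j). Symmetry of the inverse
  -- metric is used to swap them, so symmetry of Ricci is not needed.
  have key : ∀ (A W : Matrix (Fin n) (Fin n) ℝ), (∀ i j, A i j = A j i) →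
      ∑ j, ∑ k, A j k * W k j = ∑ a, ∑ b, A a b * W a b := fun A W hA => by
    rw [Finset.sum_comm]
    exact Finset.sum_congr rfl fun a _ => Finset.sum_congr rfl fun b _ => by rw [hA]
  exact ((key _ _ (hG.inv_apply_comm (h.mapsTo hy))).trans this).trans
    (key _ _ ((hG.pullMetric h).inv_apply_comm hy)).symm

end

/-! ### Naturality of the lower order terms -/

/-- The matrix `(T^k_{ij})_{ij}`. -/
def lowerSlice (T : Coeff n) (k : Fin n) (y : Coord n) : Matrix (Fin n) (Fin n) ℝ :=
  Matrix.of fun i j => T y k i j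

/-- The coefficients of the zeroth order part of `lowerTerms`. -/
def lowerMatrix (δ : ℝ) (Γ L : Coeff n) (y : Coord n) : Matrix (Fin n) (Fin n) ℝ :=
  ((2 + n * (1 - 2 * δ)) * (δ - 1) / n) • (Matrix.of fun i j => contract L y i * contract L y j)
  + ((2 + n * (1 - 2 * δ)) * (δ * n - 2) / (n - 2)) •
      (Matrix.of fun i j => ∑ s, covDerivTensor Γ (reduced L) y s s i j)
  + ((2 + n * (1 - 2 * δ)) * (2 * δ - 2) / (n - 2)) • (∑ s, contract L y s • lowerSlice L s y)
  + ((2 + n * (1 - 2 * δ)) * (1 - δ) * n / (n - 2)) •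
      (Matrix.of fun i j => ∑ s, ∑ u, L y u s i * L y s u j)

section

variable {G : Coord n → Matrix (Fin n) (Fin n) ℝ} {U V : Set (Coord n)} {y : Coord n}
  {F : Coord n → Coord n} {Γ Γ' T T' L L' : Coeff n} {δ : ℝ} {P Q : Coord n → Fin n → Fin n → ℝ}

lemma lowerTerms_eq : lowerTerms δ Γ L P y
    = (2 + n * (1 - 2 * δ)) * ∑ s, ∑ i, ∑ j, reduced L y s i j * covMatrix Γ δ P s y i j
      + ∑ i, ∑ j, lowerMatrix δ Γ L y i j * P y i j := by
  have e : ∑ s, ∑ i, ∑ j, reduced L y s i j * covMatrix Γ δ P s y i j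
      = ∑ i, ∑ j, ∑ s, reduced L y s i j * covDeriv Γ δ P y s i j := by
    rw [Finset.sum_comm]
    exact Finset.sum_congr rfl fun i _ => Finset.sum_comm
  rw [e]
  simp only [lowerTerms, lowerMatrix, Matrix.add_apply, Matrix.smul_apply, Matrix.of_apply,
    smul_eq_mul, Matrix.sum_apply, lowerSlice, Finset.mul_sum, ← Finset.sum_add_distrib]
  refine Finset.sum_congr rfl fun i _ => Finset.sum_congr rfl fun j _ => ?_
  congr 4
  simp only [← Finset.mul_sum]
  congr 1
  exact Finset.sum_congr rfl fun s _ => mul_comm _ _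

/-- The tensor law read with the upper index fixed, the form suited to contraction with a
contravariant 2-tensor. -/
lemma sum_smul_lowerSlice (hT : IsPullTensor F U T T') (hy : y ∈ U) (c : Fin n) :
    ∑ s, jacobian F y c s • lowerSlice T' s y
      = (jacobian F y)ᵀ * lowerSlice T c (F y) * jacobian F y := by
  ext i j
  have := congrFun (congrFun (hT y hy i) c) j
  simpa only [Matrix.mul_apply, connMatrix, frameConn, Matrix.of_apply, Matrix.sum_apply,
    Matrix.smul_apply, smul_eq_mul, lowerSlice, Matrix.transpose_apply] using this

lemma IsPullTensor.connMatrix_eq (hT : IsPullTensor F U T T') (h : IsCoordMap F U V) (hy : y ∈ U)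
    (s : Fin n) :
    connMatrix T' s y = (jacobian F y)⁻¹ * (frameConn T F s y * jacobian F y) := by
  rw [← hT y hy, ← Matrix.mul_assoc, h.inv_mul hy, Matrix.one_mul]

lemma contract_natural (h : IsCoordMap F U V) (hT : IsPullTensor F U T T') (hs : SymmOn T V)
    (hs' : SymmOn T' U) (hy : y ∈ U) (j : Fin n) :
    contract T' y j = ∑ a, jacobian F y a j * contract T (F y) a := by
  rw [contract_eq_trace hs' hy, ← trace_frameConn h hs hy, hT.connMatrix_eq h hy,
    Matrix.trace_mul_comm, Matrix.mul_assoc, h.mul_inv hy, Matrix.mul_one]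

lemma coeffSmoothOn_reduced (hT : CoeffSmoothOn T U) : CoeffSmoothOn (reduced T) U := by
  intro k i j
  refine (hT k i j).sub (contDiffOn_const.mul ?_)
  refine ContDiffOn.add ?_ ?_
  · split_ifs
    · exact contDiffOn_contract hT j
    · exact contDiffOn_const
  · split_ifs
    · exact contDiffOn_contract hT i
    · exact contDiffOn_const

/-- The Kronecker delta is an invariant tensor and the contraction is natural, so the subtracted
trace part obeys the same tensor law as `T`. -/
lemma isPullTensor_reduced (h : IsCoordMap F U V) (hT : IsPullTensor F U T T') (hs : SymmOn T V)
    (hs' : SymmOn T' U) : IsPullTensor F U (reduced T) (reduced T') := by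
  intro z hz s
  have e : ∀ (T : Coeff n) (s : Fin n) (z : Coord n), connMatrix (reduced T) s z
      = connMatrix T s z - (1 / (n : ℝ)) • (Matrix.vecMulVec (Pi.single s 1) (contract T z)
        + contract T z s • (1 : Matrix (Fin n) (Fin n) ℝ)) := by
    intro T s z
    ext k j
    simp only [connMatrix, reduced, Matrix.of_apply, Matrix.sub_apply, Matrix.smul_apply,
      smul_eq_mul, Matrix.add_apply, Matrix.vecMulVec_apply, Pi.single_apply, Matrix.one_apply,
      ite_mul, one_mul, zero_mul, mul_ite, mul_one, mul_zero, eq_comm]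
  have e1 : frameConn (reduced T) F s z = frameConn T F s z
      - (1 / (n : ℝ)) • (Matrix.vecMulVec (fun a => jacobian F z a s) (contract T (F z))
        + contract T' z s • (1 : Matrix (Fin n) (Fin n) ℝ)) := by
    rw [contract_natural h hT hs hs' hz]
    simp only [frameConn, e, smul_sub, Finset.sum_sub_distrib, smul_add, Finset.sum_add_distrib,
      Finset.sum_smul, Finset.smul_sum, smul_smul]
    congr 1
    congr 1
    · ext c j
      simp only [Matrix.sum_apply, Matrix.smul_apply, Matrix.vecMulVec_apply, smul_eq_mul,
        Pi.single_apply, ite_mul, one_mul, zero_mul, mul_ite, mul_zero, Finset.sum_ite_eq,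
        Finset.mem_univ, if_true]
      ring
    · exact Finset.sum_congr rfl fun a _ => by congr 1; ring
  have e2 : jacobian F z * Matrix.vecMulVec (Pi.single s 1) (contract T' z)
      = Matrix.vecMulVec (fun a => jacobian F z a s) (contract T (F z)) * jacobian F z := by
    ext c j
    simp only [Matrix.mul_apply, Matrix.vecMulVec_apply, contract_natural h hT hs hs' hz j,
      Finset.mul_sum, Pi.single_apply, ite_mul, one_mul, zero_mul, mul_ite, mul_zero]
    rw [Finset.sum_eq_single s (fun b _ hb => by simp [hb]) (by simp)]
    simp only [if_true]
    exact Finset.sum_congr rfl fun b _ => by ring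
  rw [e, e1, Matrix.mul_sub, Matrix.sub_mul, hT z hz, Matrix.mul_smul, Matrix.smul_mul,
    Matrix.mul_add, Matrix.add_mul, e2]
  simp only [Matrix.mul_smul, Matrix.smul_mul, Matrix.mul_one, Matrix.one_mul]

/-- Both connections account for the same ∂J, so the inhomogeneous terms cancel in the difference.
-/
lemma isPullTensor_sub {Γ₁ Γ₁' Γ₂ Γ₂' : Coeff n} (h : IsCoordMap F U V)
    (h₁ : IsPullConn F U Γ₁ Γ₁') (h₂ : IsPullConn F U Γ₂ Γ₂') :
    IsPullTensor F U (Γ₂ - Γ₁) (Γ₂' - Γ₁') := by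
  intro z hz s
  have e1 := h₁.mderiv_jacobian h hz s
  rw [h₂.mderiv_jacobian h hz s] at e1
  have e2 : connMatrix (Γ₂' - Γ₁') s z = connMatrix Γ₂' s z - connMatrix Γ₁' s z := rfl
  have e3 : frameConn (Γ₂ - Γ₁) F s z = frameConn Γ₂ F s z - frameConn Γ₁ F s z := by
    simp only [frameConn, ← Finset.sum_sub_distrib, ← smul_sub]; rfl
  rw [e2, e3, Matrix.mul_sub, Matrix.sub_mul]
  rw [← sub_eq_zero] at e1 ⊢
  rw [← e1]; abel

lemma lowerMatrix_natural (h : IsCoordMap F U V) (hp : IsPullConn F U Γ Γ')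
    (hL : IsPullTensor F U L L') (hs : SymmOn L V) (hs' : SymmOn L' U)
    (sL : CoeffSmoothOn L V) (sL' : CoeffSmoothOn L' U) (hy : y ∈ U) :
    lowerMatrix δ Γ' L' y = (jacobian F y)ᵀ * lowerMatrix δ Γ L (F y) * jacobian F y := by
  have e2 : (Matrix.of fun i j => contract L' y i * contract L' y j)
      = (jacobian F y)ᵀ * (Matrix.of fun i j => contract L (F y) i * contract L (F y) j)
        * jacobian F y := by
    ext i j
    simp only [Matrix.of_apply, contract_natural h hL hs hs' hy, Matrix.mul_apply,
      Matrix.transpose_apply, Finset.sum_mul, Finset.mul_sum]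
    exact Finset.sum_congr rfl fun a _ => Finset.sum_congr rfl fun b _ => by ring
  have e3 := trace_natural h hy (covTensorMatrix_natural h hp (coeffSmoothOn_reduced sL)
    (coeffSmoothOn_reduced sL') (isPullTensor_reduced h hL hs hs') hy)
  have e4 : ∑ s, contract L' y s • lowerSlice L' s y
      = (jacobian F y)ᵀ * (∑ s, contract L (F y) s • lowerSlice L s (F y)) * jacobian F y := by
    simp only [Matrix.mul_sum, Matrix.sum_mul, Matrix.mul_smul, Matrix.smul_mul,
      ← sum_smul_lowerSlice hL hy, contract_natural h hL hs hs' hy, Finset.sum_smul,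
      Finset.smul_sum, smul_smul]
    rw [Finset.sum_comm]
    exact Finset.sum_congr rfl fun a _ => Finset.sum_congr rfl fun b _ => by rw [mul_comm]
  have e5 : (Matrix.of fun i j => ∑ s, ∑ u, L' y u s i * L' y s u j)
      = (jacobian F y)ᵀ * (Matrix.of fun i j => ∑ s, ∑ u, L (F y) u s i * L (F y) s u j)
        * jacobian F y := by
    -- By symmetry the quadratic contraction is the trace of a product of two connection matrices,
    -- in which the inner J J⁻¹ cancels.
    have q : ∀ {L : Coeff n} {U : Set (Coord n)} {y : Coord n}, SymmOn L U → y ∈ U → ∀ i j,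
        ∑ s, ∑ u, L y u s i * L y s u j = (connMatrix L i y * connMatrix L j y).trace := by
      intro L U y hs hy i j
      simp only [Matrix.trace, Matrix.diag, Matrix.mul_apply, connMatrix, Matrix.of_apply]
      rw [Finset.sum_comm]
      exact Finset.sum_congr rfl fun u _ => Finset.sum_congr rfl fun s _ => by
        rw [hs y hy u, hs y hy s]
    ext i j
    simp only [Matrix.of_apply]
    rw [q hs' hy, hL.connMatrix_eq h hy, hL.connMatrix_eq h hy]
    have : (jacobian F y)⁻¹ * (frameConn L F i y * jacobian F y) *
        ((jacobian F y)⁻¹ * (frameConn L F j y * jacobian F y))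
        = (jacobian F y)⁻¹ * (frameConn L F i y * frameConn L F j y) * jacobian F y := by
      simp only [Matrix.mul_assoc]
      rw [← Matrix.mul_assoc (jacobian F y) ((jacobian F y)⁻¹), h.mul_inv hy, Matrix.one_mul]
    rw [this, Matrix.trace_mul_comm, ← Matrix.mul_assoc, h.mul_inv hy, Matrix.one_mul, frameConn_mul]
    simp only [Matrix.trace_sum, Matrix.trace_smul, smul_eq_mul, Matrix.mul_apply,
      Matrix.transpose_apply, Matrix.of_apply, q hs (h.mapsTo hy), Finset.sum_mul]
    rw [Finset.sum_comm]
    exact Finset.sum_congr rfl fun a _ => Finset.sum_congr rfl fun b _ => by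
      simp only [Matrix.trace, Matrix.diag, Matrix.mul_apply]; ring
  simp only [lowerMatrix, Matrix.mul_add, Matrix.add_mul, Matrix.mul_smul, Matrix.smul_mul]
  rw [← e2, ← e4, ← e5]
  congr 3
  congr 1

/-- Naturality of the metric trace uses neither symmetry nor nondegeneracy, so it applies to a
constant matrix in place of the metric. -/
lemma sum_mul_push (hPQ : IsPushField F U δ P Q) (hy : y ∈ U) {W W' : Matrix (Fin n) (Fin n) ℝ}
    (hW : W' = (jacobian F y)ᵀ * W * jacobian F y) :
    ∑ i, ∑ j, W i j * Q (F y) i j = densityFactor δ F y * ∑ i, ∑ j, W' i j * P y i j := by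
  have := metricTrace_natural (G := fun _ => W) hPQ hy
  rwa [metricTrace, metricTrace, show pullMetric F (fun _ => W) y = W' from hW.symm] at this

/-- Naturality of the lower order terms. -/
lemma lowerTerms_natural (h : IsCoordMap F U V) (hΓ : SymmOn Γ V) (hp : IsPullConn F U Γ Γ')
    (hL : IsPullTensor F U L L') (hs : SymmOn L V) (hs' : SymmOn L' U)
    (sL : CoeffSmoothOn L V) (sL' : CoeffSmoothOn L' U)
    (hP : FieldSmoothOn P U) (hQ : FieldSmoothOn Q V) (hPQ : IsPushField F U δ P Q) (hy : y ∈ U) :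
    lowerTerms δ Γ L Q (F y) = densityFactor δ F y * lowerTerms δ Γ' L' P y := by
  have hR := isPullTensor_reduced h hL hs hs'
  have e1 : ∑ s, ∑ i, ∑ j, reduced L (F y) s i j * covMatrix Γ δ Q s (F y) i j
      = densityFactor δ F y * ∑ s, ∑ i, ∑ j, reduced L' y s i j * covMatrix Γ' δ P s y i j := by
    let B : Fin n → Matrix (Fin n) (Fin n) ℝ → ℝ := fun c X =>
      ((lowerSlice (reduced L) c (F y))ᵀ * X).trace
    have t1 : ∀ c, ∑ i, ∑ j, reduced L (F y) c i j * covMatrix Γ δ Q c (F y) i j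
        = ∑ a, (if a = c then (1 : ℝ) else 0) * B c (covMatrix Γ δ Q a (F y)) := by
      intro c
      simp only [ite_mul, one_mul, zero_mul, Finset.sum_ite_eq', Finset.mem_univ, if_true]
      exact sum_mul_eq_trace _ _
    -- The contracted index s is split by inserting J J⁻¹ = 1, which gives the derivative index the
    -- factor J required by `covMatrix_natural`.
    have t2 : ∀ a c, (if a = c then (1 : ℝ) else 0)
        = ∑ s, jacobian F y a s * (jacobian F y)⁻¹ s c := by
      intro a c
      rw [← Matrix.mul_apply, h.mul_inv hy, Matrix.one_apply]
    have t3 : ∀ c s, ∑ a, jacobian F y a s * B c (covMatrix Γ δ Q a (F y))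
        = densityFactor δ F y * ∑ t, jacobian F y c t *
            ((lowerSlice (reduced L') t y)ᵀ * covMatrix Γ' δ P s y).trace := by
      intro c s
      have : ∑ a, jacobian F y a s * B c (covMatrix Γ δ Q a (F y))
          = ((lowerSlice (reduced L) c (F y))ᵀ *
            ∑ a, jacobian F y a s • covMatrix Γ δ Q a (F y)).trace := by
        simp only [B, Matrix.mul_sum, Matrix.trace_sum, Matrix.mul_smul, Matrix.trace_smul,
          smul_eq_mul]
      rw [this, covMatrix_natural h hΓ hp hP hQ hPQ hy, Matrix.mul_smul, Matrix.trace_smul,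
        smul_eq_mul]
      congr 1
      have e := sum_smul_lowerSlice hR hy c
      have e' : ((lowerSlice (reduced L) c (F y))ᵀ *
          (jacobian F y * covMatrix Γ' δ P s y * (jacobian F y)ᵀ)).trace
          = (((jacobian F y)ᵀ * lowerSlice (reduced L) c (F y) * jacobian F y)ᵀ
              * covMatrix Γ' δ P s y).trace := by
        rw [← Matrix.mul_assoc, Matrix.trace_mul_comm]
        simp only [Matrix.transpose_mul, Matrix.transpose_transpose, Matrix.mul_assoc]
      rw [e', ← e]
      simp only [Matrix.transpose_sum, Matrix.transpose_smul, Matrix.sum_mul, Matrix.smul_mul,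
        Matrix.trace_sum, Matrix.trace_smul, smul_eq_mul]
    have t4 : ∀ c, ∑ a, (∑ s, jacobian F y a s * (jacobian F y)⁻¹ s c)
          * B c (covMatrix Γ δ Q a (F y))
        = ∑ s, (jacobian F y)⁻¹ s c * (densityFactor δ F y * ∑ t, jacobian F y c t *
            ((lowerSlice (reduced L') t y)ᵀ * covMatrix Γ' δ P s y).trace) := by
      intro c
      simp only [← t3, Finset.sum_mul, Finset.mul_sum]
      rw [Finset.sum_comm]
      exact Finset.sum_congr rfl fun s _ => Finset.sum_congr rfl fun a _ => by ring
    simp only [t1, t2, t4]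
    rw [Finset.sum_comm, Finset.mul_sum]
    refine Finset.sum_congr rfl fun s _ => ?_
    have t5 : ∀ c, (jacobian F y)⁻¹ s c * (densityFactor δ F y * ∑ t, jacobian F y c t *
            ((lowerSlice (reduced L') t y)ᵀ * covMatrix Γ' δ P s y).trace)
        = ∑ t, densityFactor δ F y * (((jacobian F y)⁻¹ s c * jacobian F y c t) *
            ((lowerSlice (reduced L') t y)ᵀ * covMatrix Γ' δ P s y).trace) := by
      intro c
      simp only [Finset.mul_sum]
      exact Finset.sum_congr rfl fun t _ => by ring
    simp only [t5]
    rw [Finset.sum_comm]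
    simp only [← Finset.mul_sum, ← Finset.sum_mul, ← Matrix.mul_apply, h.inv_mul hy,
      Matrix.one_apply, ite_mul, one_mul, zero_mul, Finset.sum_ite_eq, Finset.mem_univ, if_true]
    congr 1
    exact (sum_mul_eq_trace _ _).symm
  rw [lowerTerms_eq, lowerTerms_eq, e1,
    sum_mul_push hPQ hy (lowerMatrix_natural h hp hL hs hs' sL sL' hy)]
  ring

end

/-! ### The operators in coordinates -/

/-- The operator `g^{sk} g_{ij} ∇_s` in coordinates. -/
def coordGradTrace (G : Coord n → Matrix (Fin n) (Fin n) ℝ) (δ : ℝ)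
    (P : Coord n → Fin n → Fin n → ℝ) (y : Coord n) (k : Fin n) : ℝ :=
  ∑ s, ∑ i, ∑ j, (G y)⁻¹ s k * G y i j * covDeriv (christoffel G) δ P y s i j

/-- The operator `g^{st} g_{ij} ∇_s ∇_t` in coordinates. -/
def coordLaplaceTrace (G : Coord n → Matrix (Fin n) (Fin n) ℝ) (δ : ℝ)
    (P : Coord n → Fin n → Fin n → ℝ) (y : Coord n) : ℝ :=
  ∑ s, ∑ t, ∑ i, ∑ j, (G y)⁻¹ s t * G y i j * covDeriv₂ (christoffel G) δ P y s t i j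

/-- The operator `R g_{ij}` in coordinates. -/
def coordScalarTrace (G : Coord n → Matrix (Fin n) (Fin n) ℝ)
    (P : Coord n → Fin n → Fin n → ℝ) (y : Coord n) : ℝ :=
  ∑ i, ∑ j, scalarCurvature G y * G y i j * P y i j

/-- The operator `𝒜` attached to two metrics, in coordinates. -/
def coordA (δ : ℝ) (G H : Coord n → Matrix (Fin n) (Fin n) ℝ)
    (P : Coord n → Fin n → Fin n → ℝ) (y : Coord n) (k : Fin n) : ℝ :=
  coordGradTrace H δ P y k - coordGradTrace G δ P y k
    + (2 - δ * n) * ∑ i, ∑ j, reduced (christoffel H - christoffel G) y k i j * P y i j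

/-- The operator `ℬ` attached to two metrics, in coordinates. -/
def coordB (δ : ℝ) (G H : Coord n → Matrix (Fin n) (Fin n) ℝ)
    (P : Coord n → Fin n → Fin n → ℝ) (y : Coord n) : ℝ :=
  coordLaplaceTrace H δ P y - coordLaplaceTrace G δ P y
    + lowerTerms δ (christoffel G) (christoffel H - christoffel G) P y
    + (n * (δ - 1) * (n * δ - 2) / ((n - 1) * (n - 2)))
      * (coordScalarTrace H P y - coordScalarTrace G P y)

section

variable {G H : Coord n → Matrix (Fin n) (Fin n) ℝ} {U V : Set (Coord n)} {y : Coord n}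
  {F : Coord n → Coord n} {Γ Γ' L L' : Coeff n} {δ : ℝ} {P Q : Coord n → Fin n → Fin n → ℝ}

/-- Since the metric is parallel, the operator sees `P` only through its trace, a scalar density.
The second order operator reduces in the same way. -/
lemma coordGradTrace_eq (hU : IsOpen U) (hG : IsMetricOn G U) (hP : FieldSmoothOn P U)
    (hy : y ∈ U) (k : Fin n) : coordGradTrace G δ P y k
      = ∑ s, (G y)⁻¹ s k * densGrad (christoffel G) δ (metricTrace G P) y s := by
  simp only [coordGradTrace, ← sum_metric_covDeriv hU hG hP hy, Finset.mul_sum, mul_assoc]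

lemma coordLaplaceTrace_eq (hU : IsOpen U) (hG : IsMetricOn G U) (hP : FieldSmoothOn P U)
    (hy : y ∈ U) : coordLaplaceTrace G δ P y
      = ∑ s, ∑ t, (G y)⁻¹ s t * densHess (christoffel G) δ (metricTrace G P) y s t := by
  simp only [coordLaplaceTrace, ← sum_metric_covDeriv₂ hU hG hP hy, Finset.mul_sum, mul_assoc]

lemma coordScalarTrace_eq : coordScalarTrace G P y = scalarCurvature G y * metricTrace G P y := by
  simp only [coordScalarTrace, metricTrace, Finset.mul_sum, mul_assoc]

lemma coordGradTrace_natural (h : IsCoordMap F U V) (hG : IsMetricOn G V)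
    (hP : FieldSmoothOn P U) (hQ : FieldSmoothOn Q V) (hPQ : IsPushField F U δ P Q) (hy : y ∈ U)
    (c : Fin n) : coordGradTrace G δ Q (F y) c
      = densityFactor δ F y * ∑ k, jacobian F y c k * coordGradTrace (pullMetric F G) δ P y k := by
  have hp : IsPullConn F U (christoffel G) (christoffel (pullMetric F G)) :=
    fun z hz => pullbackConnection_christoffel h hG hz
  have hΓ := symmOn_christoffel h.isOpen_target hG
  have hg := densGrad_natural h hΓ hp (contDiffOn_metricTrace hG.smooth hQ)
    (contDiffOn_metricTrace (hG.pullMetric h).smooth hP)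
    (fun z hz => metricTrace_natural (G := G) hPQ hz) hy
  rw [coordGradTrace_eq h.isOpen_target hG hQ (h.mapsTo hy)]
  simp only [coordGradTrace_eq h.isOpen_source (hG.pullMetric h) hP hy]
  have e : ∀ a, (G (F y))⁻¹ a c
      = ∑ k, jacobian F y c k * ∑ s, jacobian F y a s * (pullMetric F G y)⁻¹ s k := by
    intro a
    rw [inv_eq_of_pullMetric h hy, Matrix.mul_apply]
    simp only [Matrix.mul_apply, Matrix.transpose_apply]
    exact Finset.sum_congr rfl fun k _ => mul_comm _ _
  simp only [e, Finset.sum_mul, Finset.mul_sum, mul_left_comm (densityFactor δ F y), ← hg]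
  rw [Finset.sum_comm]
  refine Finset.sum_congr rfl fun k _ => ?_
  rw [Finset.sum_comm]
  exact Finset.sum_congr rfl fun s _ => Finset.sum_congr rfl fun a _ => by ring

lemma coordLaplaceTrace_natural (h : IsCoordMap F U V) (hG : IsMetricOn G V)
    (hP : FieldSmoothOn P U) (hQ : FieldSmoothOn Q V) (hPQ : IsPushField F U δ P Q) (hy : y ∈ U) :
    coordLaplaceTrace G δ Q (F y)
      = densityFactor δ F y * coordLaplaceTrace (pullMetric F G) δ P y := by
  have hp : IsPullConn F U (christoffel G) (christoffel (pullMetric F G)) :=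
    fun z hz => pullbackConnection_christoffel h hG hz
  have hΓ := symmOn_christoffel h.isOpen_target hG
  have hg := densHess_natural h hΓ hp (coeffSmoothOn_christoffel h.isOpen_target hG)
    (coeffSmoothOn_christoffel h.isOpen_source (hG.pullMetric h))
    (contDiffOn_metricTrace hG.smooth hQ)
    (contDiffOn_metricTrace (hG.pullMetric h).smooth hP)
    (fun z hz => metricTrace_natural (G := G) hPQ hz) hy
  rw [coordLaplaceTrace_eq h.isOpen_target hG hQ (h.mapsTo hy),
    coordLaplaceTrace_eq h.isOpen_source (hG.pullMetric h) hP hy]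
  have hH : (Matrix.of fun s t => densityFactor δ F y *
      densHess (christoffel (pullMetric F G)) δ (metricTrace (pullMetric F G) P) y s t)
      = (jacobian F y)ᵀ * (Matrix.of (densHess (christoffel G) δ (metricTrace G Q) (F y)))
        * jacobian F y := by
    ext s t
    simp only [Matrix.of_apply, ← hg, Matrix.mul_apply, Matrix.transpose_apply, Finset.sum_mul]
    rw [Finset.sum_comm]
    exact Finset.sum_congr rfl fun b _ => Finset.sum_congr rfl fun a _ => by ring
  have := sum_contract (inv_eq_of_pullMetric (G := G) h hy) hH
  simp only [Matrix.of_apply] at this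
  rw [this]
  simp only [Finset.mul_sum, mul_left_comm (densityFactor δ F y)]

lemma coordScalarTrace_natural (h : IsCoordMap F U V) (hG : IsMetricOn G V)
    (hPQ : IsPushField F U δ P Q) (hy : y ∈ U) :
    coordScalarTrace G Q (F y) = densityFactor δ F y * coordScalarTrace (pullMetric F G) P y := by
  rw [coordScalarTrace_eq, coordScalarTrace_eq, scalarCurvature_natural h hG hy,
    metricTrace_natural hPQ hy]
  ring

lemma IsMetricOn.symmOn_sub_christoffel (hU : IsOpen U) (hG : IsMetricOn G U)
    (hH : IsMetricOn H U) : SymmOn (christoffel H - christoffel G) U := fun z hz k i j => by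
  simp only [Pi.sub_apply, symmOn_christoffel hU hG z hz k i j, symmOn_christoffel hU hH z hz k i j]

lemma IsMetricOn.coeffSmoothOn_sub_christoffel (hU : IsOpen U) (hG : IsMetricOn G U)
    (hH : IsMetricOn H U) : CoeffSmoothOn (christoffel H - christoffel G) U := fun k i j =>
  (coeffSmoothOn_christoffel hU hH k i j).sub (coeffSmoothOn_christoffel hU hG k i j)

/-- Naturality of the operator `𝒜`. -/
lemma coordA_natural (h : IsCoordMap F U V) (hG : IsMetricOn G V) (hH : IsMetricOn H V)
    (hP : FieldSmoothOn P U) (hQ : FieldSmoothOn Q V) (hPQ : IsPushField F U δ P Q) (hy : y ∈ U)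
    (c : Fin n) : coordA δ G H Q (F y) c
      = densityFactor δ F y *
        ∑ k, jacobian F y c k * coordA δ (pullMetric F G) (pullMetric F H) P y k := by
  have hL : IsPullTensor F U (christoffel H - christoffel G)
      (christoffel (pullMetric F H) - christoffel (pullMetric F G)) :=
    isPullTensor_sub h (fun z hz => pullbackConnection_christoffel h hG hz)
      (fun z hz => pullbackConnection_christoffel h hH hz)
  have hR := isPullTensor_reduced h hL (hG.symmOn_sub_christoffel h.isOpen_target hH)
    ((hG.pullMetric h).symmOn_sub_christoffel h.isOpen_source (hH.pullMetric h))
  have e := sum_mul_push hPQ hy (sum_smul_lowerSlice hR hy c)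
  simp only [lowerSlice, Matrix.of_apply, Matrix.sum_apply, Matrix.smul_apply, smul_eq_mul] at e
  have e' : ∑ i, ∑ j, (∑ k, jacobian F y c k *
      reduced (christoffel (pullMetric F H) - christoffel (pullMetric F G)) y k i j) * P y i j
      = ∑ k, jacobian F y c k * ∑ i, ∑ j,
        reduced (christoffel (pullMetric F H) - christoffel (pullMetric F G)) y k i j * P y i j := by
    simp only [Finset.sum_mul, Finset.mul_sum, mul_assoc]
    rw [Finset.sum_comm' (t' := univ) (s' := fun _ => univ) (by simp)]
    conv_rhs => rw [Finset.sum_comm]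
    rw [Finset.sum_comm]
    exact Finset.sum_congr rfl fun i _ => Finset.sum_comm
  rw [coordA, coordGradTrace_natural h hG hP hQ hPQ hy, coordGradTrace_natural h hH hP hQ hPQ hy, e,
    e']
  simp only [coordA, mul_add, mul_sub, Finset.sum_add_distrib, Finset.sum_sub_distrib,
    mul_left_comm _ (2 - δ * (n : ℝ)), ← Finset.mul_sum]

/-- Naturality of the operator `ℬ`. -/
lemma coordB_natural (h : IsCoordMap F U V) (hG : IsMetricOn G V) (hH : IsMetricOn H V)
    (hP : FieldSmoothOn P U) (hQ : FieldSmoothOn Q V) (hPQ : IsPushField F U δ P Q) (hy : y ∈ U) :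
    coordB δ G H Q (F y)
      = densityFactor δ F y * coordB δ (pullMetric F G) (pullMetric F H) P y := by
  have hp : IsPullConn F U (christoffel G) (christoffel (pullMetric F G)) :=
    fun z hz => pullbackConnection_christoffel h hG hz
  have hL : IsPullTensor F U (christoffel H - christoffel G)
      (christoffel (pullMetric F H) - christoffel (pullMetric F G)) :=
    isPullTensor_sub h hp (fun z hz => pullbackConnection_christoffel h hH hz)
  have e := lowerTerms_natural h (symmOn_christoffel h.isOpen_target hG) hp hL
    (hG.symmOn_sub_christoffel h.isOpen_target hH)
    ((hG.pullMetric h).symmOn_sub_christoffel h.isOpen_source (hH.pullMetric h))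
    (hG.coeffSmoothOn_sub_christoffel h.isOpen_target hH)
    ((hG.pullMetric h).coeffSmoothOn_sub_christoffel h.isOpen_source (hH.pullMetric h))
    hP hQ hPQ hy
  rw [coordB, coordB, coordLaplaceTrace_natural h hG hP hQ hPQ hy,
    coordLaplaceTrace_natural h hH hP hQ hPQ hy, e, coordScalarTrace_natural h hG hPQ hy,
    coordScalarTrace_natural h hH hPQ hy]
  ring

/-! ### The cocycle property of the lower order terms -/

lemma contract_sub (y : Coord n) (i : Fin n) :
    contract (Γ' - Γ) y i = contract Γ' y i - contract Γ y i := by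
  simp only [contract, Pi.sub_apply, Finset.sum_sub_distrib]

lemma reduced_sub (y : Coord n) (k i j : Fin n) :
    reduced (Γ' - Γ) y k i j = reduced Γ' y k i j - reduced Γ y k i j := by
  simp only [reduced, contract_sub, Pi.sub_apply]
  split_ifs <;> ring

lemma sum_covDerivTensor (T : Coeff n) (y : Coord n) (i j : Fin n) :
    ∑ s, covDerivTensor Γ T y s s i j = ∑ s, pderiv s (fun z => T z s i j) y
      + ∑ s, contract Γ y s * T y s i j
      - ∑ s, ∑ m, (Γ y m s i * T y s m j + Γ y m s j * T y s i m) := by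
  have : ∑ s, contract Γ y s * T y s i j = ∑ s, ∑ m, Γ y s s m * T y m i j := by
    simp only [contract, Finset.sum_mul]
    exact Finset.sum_comm
  rw [this]
  simp only [covDerivTensor, Finset.sum_add_distrib, Finset.sum_sub_distrib]
  ring

/-- The Kronecker corrections in `reduced` produce products of traces and, once from each of the two
terms, Γ^s_ij L_s. -/
lemma sum_mul_reduced (hs : SymmOn Γ U) (hy : y ∈ U) (L : Coeff n) (i j : Fin n) :
    ∑ s, ∑ m, (Γ y m s i * reduced L y s m j + Γ y m s j * reduced L y s i m)
      = ∑ s, ∑ m, (Γ y m s i * L y s m j + Γ y m s j * L y s i m)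
        - (1 / (n : ℝ)) * (contract Γ y i * contract L y j + contract L y i * contract Γ y j
          + 2 * ∑ s, Γ y s i j * contract L y s) := by
  have e1 : ∀ i j, ∑ s, ∑ m, Γ y m s i * reduced L y s m j = ∑ s, ∑ m, Γ y m s i * L y s m j
      - (1 / (n : ℝ)) * (contract Γ y i * contract L y j + ∑ s, Γ y s i j * contract L y s) := by
    intro i j
    simp only [reduced, mul_sub, mul_add, Finset.sum_sub_distrib, Finset.sum_add_distrib, mul_ite,
      mul_zero, Finset.sum_ite_eq', Finset.mem_univ, if_true]
    congr 1
    congr 1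
    · rw [show contract Γ y i = ∑ t, Γ y t t i from rfl, Finset.sum_mul, Finset.mul_sum]
      exact Finset.sum_congr rfl fun s _ => by ring
    · rw [Finset.sum_comm, Finset.mul_sum]
      refine Finset.sum_congr rfl fun m _ => ?_
      simp only [Finset.sum_ite_eq, Finset.mem_univ, if_true]
      rw [hs y hy m i j]; ring
  have e2 : ∀ i j, ∑ s, ∑ m, Γ y m s j * reduced L y s i m = ∑ s, ∑ m, Γ y m s j * L y s i m
      - (1 / (n : ℝ)) * (contract L y i * contract Γ y j + ∑ s, Γ y s i j * contract L y s) := by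
    intro i j
    simp only [reduced, mul_sub, mul_add, Finset.sum_sub_distrib, Finset.sum_add_distrib, mul_ite,
      mul_zero, Finset.sum_ite_eq', Finset.mem_univ, if_true]
    rw [add_comm (1 / (n : ℝ) * (contract L y i * _))]
    congr 1
    congr 1
    · rw [Finset.sum_comm, Finset.mul_sum]
      refine Finset.sum_congr rfl fun m _ => ?_
      simp only [Finset.sum_ite_eq, Finset.mem_univ, if_true]
      ring
    · rw [show contract Γ y j = ∑ t, Γ y t t j from rfl, Finset.mul_sum, Finset.mul_sum]
      exact Finset.sum_congr rfl fun s _ => by ring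
  simp only [Finset.sum_add_distrib, e1, e2]
  ring

/-- The connection is moved off the derivative of `P`: with only ∂P left, expressions for different
Γ can be compared coefficient by coefficient. -/
lemma lowerTerms_eq' : lowerTerms δ Γ L P y
    = (2 + n * (1 - 2 * δ)) * ∑ s, ∑ i, ∑ j, reduced L y s i j * pderiv s (fun z => P z i j) y
      + ∑ i, ∑ j, ((2 + n * (1 - 2 * δ)) *
        (∑ s, ∑ m, (Γ y m s i * reduced L y s m j + Γ y m s j * reduced L y s i m)
          - δ * ∑ s, contract Γ y s * reduced L y s i j) + lowerMatrix δ Γ L y i j) * P y i j := by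
  have e1 : ∀ s, ∑ i, ∑ j, reduced L y s i j * covMatrix Γ δ P s y i j
      = ∑ i, ∑ j, reduced L y s i j * pderiv s (fun z => P z i j) y
        + ∑ i, ∑ j, (∑ m, (Γ y m s i * reduced L y s m j + Γ y m s j * reduced L y s i m)
          - δ * (contract Γ y s * reduced L y s i j)) * P y i j := by
    intro s
    have t := congrArg Matrix.trace (congrArg (fun X => (lowerSlice (reduced L) s y)ᵀ * X)
      (covMatrix_eq (Γ := Γ) (δ := δ) (P := P) (y := y) s))
    have t1 : ((lowerSlice (reduced L) s y)ᵀ *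
          (connMatrix Γ s y * Matrix.of (P y) + Matrix.of (P y) * (connMatrix Γ s y)ᵀ
            - (δ * contract Γ y s) • Matrix.of (P y))).trace
        = (((connMatrix Γ s y)ᵀ * lowerSlice (reduced L) s y
            + lowerSlice (reduced L) s y * connMatrix Γ s y
            - (δ * contract Γ y s) • lowerSlice (reduced L) s y)ᵀ * Matrix.of (P y)).trace := by
      simp only [Matrix.mul_add, Matrix.mul_sub, Matrix.add_mul, Matrix.sub_mul, Matrix.trace_add,
        Matrix.trace_sub, Matrix.transpose_add, Matrix.transpose_sub, Matrix.transpose_mul,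
        Matrix.transpose_transpose, Matrix.transpose_smul, Matrix.mul_smul, Matrix.smul_mul]
      rw [← Matrix.mul_assoc _ (Matrix.of (P y)), Matrix.trace_mul_comm _ (connMatrix Γ s y)ᵀ]
      simp only [Matrix.mul_assoc]
    simp only [add_assoc, add_sub_assoc, Matrix.mul_add, Matrix.trace_add] at t
    rw [← Matrix.trace_add, ← Matrix.mul_add, ← add_sub_assoc, t1, ← sum_mul_eq_trace,
      ← sum_mul_eq_trace, ← sum_mul_eq_trace] at t
    refine t.trans ?_
    congr 1
    refine Finset.sum_congr rfl fun i _ => Finset.sum_congr rfl fun j _ => ?_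
    simp only [Matrix.sub_apply, Matrix.add_apply, Matrix.mul_apply, Matrix.transpose_apply,
      connMatrix, lowerSlice, Matrix.of_apply, Matrix.smul_apply, smul_eq_mul,
      Finset.sum_add_distrib, mul_comm (reduced L y s i _)]
    ring
  have e2 : ∑ s, ∑ i, ∑ j, (∑ m, (Γ y m s i * reduced L y s m j + Γ y m s j * reduced L y s i m)
        - δ * (contract Γ y s * reduced L y s i j)) * P y i j
      = ∑ i, ∑ j, (∑ s, ∑ m, (Γ y m s i * reduced L y s m j + Γ y m s j * reduced L y s i m)
        - δ * ∑ s, contract Γ y s * reduced L y s i j) * P y i j := by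
    rw [Finset.sum_comm]
    refine Finset.sum_congr rfl fun i _ => ?_
    rw [Finset.sum_comm]
    refine Finset.sum_congr rfl fun j _ => ?_
    rw [← Finset.sum_mul, Finset.sum_sub_distrib, Finset.mul_sum]
  have e3 : ∀ (c : ℝ) (Z W : Fin n → Fin n → ℝ), ∑ i, ∑ j, (c * Z i j + W i j) * P y i j
      = c * ∑ i, ∑ j, Z i j * P y i j + ∑ i, ∑ j, W i j * P y i j := by
    intro c Z W
    simp only [add_mul, Finset.sum_add_distrib, mul_assoc, ← Finset.mul_sum]
  rw [lowerTerms_eq, Finset.sum_congr rfl fun s _ => e1 s, Finset.sum_add_distrib, e2, mul_add,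
    add_assoc]
  congr 1
  exact (e3 _ (fun i j => ∑ s, ∑ m, (Γ y m s i * reduced L y s m j + Γ y m s j * reduced L y s i m)
        - δ * ∑ s, contract Γ y s * reduced L y s i j) (lowerMatrix δ Γ L y)).symm

/-- The zeroth order part of `lowerTerms` satisfies a cocycle identity. -/
lemma lowerMatrix_cocycle (hn : 2 < n) (hU : IsOpen U) (hs : SymmOn Γ U)
    (hs' : SymmOn Γ' U) (sΓ : CoeffSmoothOn Γ U) (sΓ' : CoeffSmoothOn Γ' U) (hy : y ∈ U) (i j : Fin n) :
    (2 + n * (1 - 2 * δ)) *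
        (∑ s, ∑ m, (Γ y m s i * reduced (Γ' - Γ) y s m j + Γ y m s j * reduced (Γ' - Γ) y s i m)
          - δ * ∑ s, contract Γ y s * reduced (Γ' - Γ) y s i j) + lowerMatrix δ Γ (Γ' - Γ) y i j
      = lowerMatrix δ 0 Γ' y i j - lowerMatrix δ 0 Γ y i j := by
  have hn0 : (n : ℝ) ≠ 0 := by positivity
  have hn2 : (n : ℝ) - 2 ≠ 0 := by
    have : (2 : ℝ) < n := by exact_mod_cast hn
    linarith
  have dR : ∀ {T : Coeff n}, CoeffSmoothOn T U → ∀ s i j,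
      DifferentiableAt ℝ (fun z => reduced T z s i j) y := fun hT s i j =>
    differentiableAt_of_contDiffOn hU (coeffSmoothOn_reduced hT s i j) hy
  have e1 : ∑ s, pderiv s (fun z => reduced (Γ' - Γ) z s i j) y
      = ∑ s, pderiv s (fun z => reduced Γ' z s i j) y
        - ∑ s, pderiv s (fun z => reduced Γ z s i j) y := by
    simp only [reduced_sub, pderiv_sub (dR sΓ' _ _ _) (dR sΓ _ _ _), Finset.sum_sub_distrib]
  have e2 : ∀ T : Coeff n, ∑ s, covDerivTensor 0 (reduced T) y s s i j
      = ∑ s, pderiv s (fun z => reduced T z s i j) y := by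
    intro T
    rw [sum_covDerivTensor]
    simp [contract]
  have e3 : ∑ s, contract Γ y s * reduced (Γ' - Γ) y s i j
      = ∑ s, contract Γ y s * (Γ' - Γ) y s i j - (1 / (n : ℝ)) *
        (contract Γ y i * contract (Γ' - Γ) y j + contract Γ y j * contract (Γ' - Γ) y i) := by
    simp only [reduced, mul_sub, mul_add, Finset.sum_sub_distrib, Finset.sum_add_distrib, mul_ite,
      mul_zero, Finset.sum_ite_eq, Finset.mem_univ, if_true]
    ring
  -- Polarisation with L = Γ' - Γ: the square of L is the difference of the squares minus the cross
  -- terms of Γ and L. The next identity does the same for the contraction with the trace.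
  have e4 : ∑ s, ∑ u, (Γ' - Γ) y u s i * (Γ' - Γ) y s u j
      = ∑ s, ∑ u, Γ' y u s i * Γ' y s u j - ∑ s, ∑ u, Γ y u s i * Γ y s u j
        - ∑ s, ∑ m, (Γ y m s i * (Γ' - Γ) y s m j + Γ y m s j * (Γ' - Γ) y s i m) := by
    have a : ∑ s, ∑ m, Γ y m s j * (Γ' - Γ) y s i m = ∑ s, ∑ u, (Γ' - Γ) y u s i * Γ y s u j := by
      rw [Finset.sum_comm]
      refine Finset.sum_congr rfl fun s _ => Finset.sum_congr rfl fun u _ => ?_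
      simp only [Pi.sub_apply, hs y hy u i s, hs' y hy u i s]; ring
    simp only [Finset.sum_add_distrib, a]
    simp only [← Finset.sum_add_distrib, ← Finset.sum_sub_distrib]
    exact Finset.sum_congr rfl fun s _ => Finset.sum_congr rfl fun u _ => by
      simp only [Pi.sub_apply]; ring
  have e5 : ∑ s, contract (Γ' - Γ) y s * (Γ' - Γ) y s i j
      = ∑ s, contract Γ' y s * Γ' y s i j - ∑ s, contract Γ y s * Γ y s i j
        - ∑ s, contract Γ y s * (Γ' - Γ) y s i j - ∑ s, Γ y s i j * contract (Γ' - Γ) y s := by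
    simp only [← Finset.sum_sub_distrib]
    exact Finset.sum_congr rfl fun s _ => by simp only [contract_sub, Pi.sub_apply]; ring
  simp only [lowerMatrix, Matrix.add_apply, Matrix.smul_apply, Matrix.of_apply, smul_eq_mul,
    Matrix.sum_apply, lowerSlice, e2]
  rw [sum_covDerivTensor, e1, e3, sum_mul_reduced hs hy, e4, e5]
  -- The coefficients of X1, X2 and X3 vanish because c₁ = c₃ + c₅, c₄ = 2(c₃ - c₁)/n and c₃ = δc₁ +
  -- c₄. The mixed products of traces have coefficient (δ - 1)c₁/n = c₂, which completes c₂ L_i L_j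
  -- to a difference.
  generalize ∑ s, ∑ m, (Γ y m s i * (Γ' - Γ) y s m j + Γ y m s j * (Γ' - Γ) y s i m) = X1
  generalize ∑ s, Γ y s i j * contract (Γ' - Γ) y s = X2
  generalize ∑ s, contract Γ y s * (Γ' - Γ) y s i j = X3
  simp only [contract_sub]
  field_simp
  ring

/-- The lower order terms satisfy a cocycle identity. -/
lemma lowerTerms_cocycle (hn : 2 < n) (hU : IsOpen U) (hs : SymmOn Γ U) (hs' : SymmOn Γ' U)
    (sΓ : CoeffSmoothOn Γ U) (sΓ' : CoeffSmoothOn Γ' U) (hy : y ∈ U) :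
    lowerTerms δ Γ (Γ' - Γ) P y = lowerTerms δ 0 Γ' P y - lowerTerms δ 0 Γ P y := by
  have e0 : ∀ T : Coeff n, lowerTerms δ 0 T P y
      = (2 + n * (1 - 2 * δ)) * ∑ s, ∑ i, ∑ j, reduced T y s i j * pderiv s (fun z => P z i j) y
      + ∑ i, ∑ j, lowerMatrix δ 0 T y i j * P y i j := by
    intro T
    rw [lowerTerms_eq']
    simp [contract]
  rw [lowerTerms_eq', e0, e0]
  simp only [lowerMatrix_cocycle hn hU hs hs' sΓ sΓ' hy]
  simp only [reduced_sub, sub_mul, Finset.sum_sub_distrib]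
  ring

end

/-! ### Conformal invariance in coordinates -/

/-- The components `φ^k = g^{km} φ_m`. -/
def raise (G : Coord n → Matrix (Fin n) (Fin n) ℝ) (φ : Fin n → Coord n → ℝ) (y : Coord n)
    (k : Fin n) : ℝ := ∑ m, (G y)⁻¹ k m * φ m y

/-- The covariant derivative `∇_u φ_l` of a one-form. -/
def covForm (Γ : Coeff n) (φ : Fin n → Coord n → ℝ) (y : Coord n) (u l : Fin n) : ℝ :=
  pderiv u (φ l) y - ∑ m, Γ y m u l * φ m y

/-- The tensor field `α (δ^k_i φ_j + δ^k_j φ_i) - g_{ij} φ^k`. -/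
def confTensor (α : ℝ) (G : Coord n → Matrix (Fin n) (Fin n) ℝ) (φ : Fin n → Coord n → ℝ) :
    Coeff n := fun y k i j =>
  α * ((if k = i then φ j y else 0) + (if k = j then φ i y else 0)) - G y i j * raise G φ y k

section

variable {G H : Coord n → Matrix (Fin n) (Fin n) ℝ} {U V : Set (Coord n)} {y : Coord n}
  {Γ Γ' L L' : Coeff n} {δ : ℝ} {P : Coord n → Fin n → Fin n → ℝ} {φ : Fin n → Coord n → ℝ}

lemma confTensor_one : conformalDiff G φ = confTensor 1 G φ := by
  funext y k i j
  simp only [conformalDiff, confTensor, raise, one_mul]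

lemma IsMetricOn.sum_mul_raise (hG : IsMetricOn G U) (hy : y ∈ U) (l : Fin n) :
    ∑ k, G y l k * raise G φ y k = φ l y := by
  simp only [raise, Finset.mul_sum, ← mul_assoc]
  rw [Finset.sum_comm]
  simp only [← Finset.sum_mul, hG.sum_mul_inv hy]
  simp

lemma contDiffOn_raise (hG : IsMetricOn G U) (hφ : ∀ i, ContDiffOn ℝ ∞ (φ i) U) (k : Fin n) :
    ContDiffOn ℝ ∞ (fun z => raise G φ z k) U :=
  ContDiffOn.sum fun m _ => (hG.smooth.inv hG.det_ne k m).mul (hφ m)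

lemma pderiv_metric (hU : IsOpen U) (hG : IsMetricOn G U) (hy : y ∈ U) (u i j : Fin n) :
    pderiv u (fun z => G z i j) y
      = ∑ m, christoffel G y m u i * G y m j + ∑ m, G y i m * christoffel G y m u j :=
  congrFun (congrFun (mderiv_metric hU hG hy u) i) j

/-- Covariant differentiation commutes with raising an index. The identity is obtained with the
index lowered, by differentiating G_lk φ^k = φ_l, and then inverted. -/
lemma pderiv_raise (hU : IsOpen U) (hG : IsMetricOn G U) (hφ : ∀ i, ContDiffOn ℝ ∞ (φ i) U)
    (hy : y ∈ U) (u k : Fin n) :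
    pderiv u (fun z => raise G φ z k) y + ∑ m, christoffel G y k u m * raise G φ y m
      = ∑ l, (G y)⁻¹ k l * covForm (christoffel G) φ y u l := by
  have dG := hG.smooth.matDiffAt hU hy
  have dr : ∀ k, DifferentiableAt ℝ (fun z => raise G φ z k) y := fun k =>
    differentiableAt_of_contDiffOn hU (contDiffOn_raise hG hφ k) hy
  let X : Fin n → ℝ := fun k => pderiv u (fun z => raise G φ z k) y
    + ∑ m, christoffel G y k u m * raise G φ y m
  have hX : ∀ l, ∑ k, G y l k * X k = covForm (christoffel G) φ y u l := by
    intro l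
    have e1 : pderiv u (φ l) y = ∑ k, (pderiv u (fun z => G z l k) y * raise G φ y k
        + G y l k * pderiv u (fun z => raise G φ z k) y) := by
      rw [← pderiv_congr hU hy (fun z hz => hG.sum_mul_raise (φ := φ) hz l),
        pderiv_sum (w := fun k z => G z l k * raise G φ z k) (fun k _ => (dG l k).mul (dr k))]
      exact Finset.sum_congr rfl fun k _ => pderiv_mul (dG l k) (dr k) u
    have e2 : ∑ k, (∑ m, christoffel G y m u l * G y m k) * raise G φ y k
        = ∑ m, christoffel G y m u l * φ m y := by
      simp only [← hG.sum_mul_raise (φ := φ) hy, Finset.sum_mul, Finset.mul_sum, mul_assoc]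
      exact Finset.sum_comm
    have e3 : ∑ k, (∑ m, G y l m * christoffel G y m u k) * raise G φ y k
        = ∑ k, G y l k * ∑ m, christoffel G y k u m * raise G φ y m := by
      simp only [Finset.sum_mul, Finset.mul_sum, mul_assoc]
      exact Finset.sum_comm
    rw [covForm, e1, ← e2]
    simp only [pderiv_metric hU hG hy, add_mul, mul_add, X, Finset.sum_add_distrib, e3]
    ring
  change X k = _
  simp only [← hX, Finset.mul_sum, ← mul_assoc]
  rw [Finset.sum_comm]
  simp only [← Finset.sum_mul, hG.sum_inv_mul hy]
  simp

/-- The covariant derivative of `confTensor`. -/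
lemma covDerivTensor_confTensor (hU : IsOpen U) (hG : IsMetricOn G U)
    (hφ : ∀ i, ContDiffOn ℝ ∞ (φ i) U) (hy : y ∈ U) (α : ℝ) (u k i j : Fin n) :
    covDerivTensor (christoffel G) (confTensor α G φ) y u k i j
      = α * ((if k = i then covForm (christoffel G) φ y u j else 0)
          + (if k = j then covForm (christoffel G) φ y u i else 0))
        - G y i j * ∑ l, (G y)⁻¹ k l * covForm (christoffel G) φ y u l := by
  have dG := hG.smooth.matDiffAt hU hy
  have dr : ∀ k, DifferentiableAt ℝ (fun z => raise G φ z k) y := fun k =>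
    differentiableAt_of_contDiffOn hU (contDiffOn_raise hG hφ k) hy
  have dφ : ∀ i, DifferentiableAt ℝ (φ i) y := fun i => differentiableAt_of_contDiffOn hU (hφ i) hy
  have dite : ∀ (p : Prop) [Decidable p] (i : Fin n),
      DifferentiableAt ℝ (fun z => if p then φ i z else 0) y := by
    intro p _ i
    split_ifs
    · exact dφ i
    · exact differentiableAt_const _
  have pite : ∀ (p : Prop) [Decidable p] (i : Fin n),
      pderiv u (fun z => if p then φ i z else 0) y = if p then pderiv u (φ i) y else 0 := by
    intro p _ i
    split_ifs
    · rfl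
    · exact pderiv_const 0 u
  have e1 : pderiv u (fun z => confTensor α G φ z k i j) y
      = α * ((if k = i then pderiv u (φ j) y else 0) + (if k = j then pderiv u (φ i) y else 0))
        - (pderiv u (fun z => G z i j) y * raise G φ y k
          + G y i j * pderiv u (fun z => raise G φ z k) y) := by
    have d0 : DifferentiableAt ℝ
        (fun z => (if k = i then φ j z else 0) + (if k = j then φ i z else 0)) y :=
      (dite _ j).add (dite _ i)
    have d1 : DifferentiableAt ℝ
        (fun z => α * ((if k = i then φ j z else 0) + (if k = j then φ i z else 0))) y :=
      d0.const_mul α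
    have d2 : DifferentiableAt ℝ (fun z => G z i j * raise G φ z k) y := (dG i j).mul (dr k)
    unfold confTensor
    rw [pderiv_sub d1 d2, pderiv_const_mul d0, pderiv_add (dite _ j) (dite _ i), pite, pite,
      pderiv_mul (dG i j) (dr k)]
  have e2 : ∑ m, christoffel G y k u m * confTensor α G φ y m i j
      = α * (christoffel G y k u i * φ j y + christoffel G y k u j * φ i y)
        - G y i j * ∑ m, christoffel G y k u m * raise G φ y m := by
    simp only [confTensor, mul_sub, mul_add, Finset.sum_sub_distrib, Finset.sum_add_distrib,
      mul_ite, mul_zero, Finset.sum_ite_eq', Finset.mem_univ, if_true, Finset.mul_sum]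
    congr 1
    · ring
    · exact Finset.sum_congr rfl fun m _ => by ring
  have e3 : ∑ m, christoffel G y m u i * confTensor α G φ y k m j
      = α * (christoffel G y k u i * φ j y
          + (if k = j then ∑ m, christoffel G y m u i * φ m y else 0))
        - (∑ m, christoffel G y m u i * G y m j) * raise G φ y k := by
    simp only [confTensor, mul_sub, mul_add, Finset.sum_sub_distrib, Finset.sum_add_distrib,
      mul_ite, mul_zero, Finset.sum_ite_eq, Finset.mem_univ, if_true, Finset.sum_mul]
    congr 1
    · congr 1
      · ring
      · split_ifs
        · rw [Finset.mul_sum]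
          exact Finset.sum_congr rfl fun m _ => by ring
        · simp
    · exact Finset.sum_congr rfl fun m _ => by ring
  have e4 : ∑ m, christoffel G y m u j * confTensor α G φ y k i m
      = α * ((if k = i then ∑ m, christoffel G y m u j * φ m y else 0)
          + christoffel G y k u j * φ i y)
        - (∑ m, G y i m * christoffel G y m u j) * raise G φ y k := by
    simp only [confTensor, mul_sub, mul_add, Finset.sum_sub_distrib, Finset.sum_add_distrib,
      mul_ite, mul_zero, Finset.sum_ite_eq, Finset.mem_univ, if_true, Finset.sum_mul]
    congr 1
    · congr 1
      · split_ifs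
        · rw [Finset.mul_sum]
          exact Finset.sum_congr rfl fun m _ => by ring
        · simp
      · ring
    · exact Finset.sum_congr rfl fun m _ => by ring
  rw [covDerivTensor, Finset.sum_sub_distrib, Finset.sum_sub_distrib, e1, e2, e3, e4,
    pderiv_metric hU hG hy, ← pderiv_raise hU hG hφ hy]
  simp only [covForm]
  split_ifs <;> ring

lemma covDerivTensor_congr (hU : IsOpen U) (hy : y ∈ U) {T T' : Coeff n}
    (h : ∀ z ∈ U, T z = T' z) (u k i j : Fin n) :
    covDerivTensor Γ T y u k i j = covDerivTensor Γ T' y u k i j := by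
  simp only [covDerivTensor, h y hy]
  rw [pderiv_congr hU hy (fun z hz => by rw [h z hz])]

lemma reduced_congr (h : L y = L' y) : reduced L y = reduced L' y := by
  funext k i j
  simp only [reduced, contract, h]

lemma lowerTerms_congr (hU : IsOpen U) (hy : y ∈ U) (h : ∀ z ∈ U, L z = L' z) :
    lowerTerms δ Γ L P y = lowerTerms δ Γ L' P y := by
  have hR : ∀ z ∈ U, reduced L z = reduced L' z := fun z hz => reduced_congr (h z hz)
  simp only [lowerTerms, hR y hy, covDerivTensor_congr hU hy hR, contract, h y hy]

lemma sum_confTensor_mul (a : Fin n → ℝ) (i j : Fin n) :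
    ∑ k, confTensor 1 G φ y k i j * a k
      = φ j y * a i + φ i y * a j - G y i j * ∑ k, raise G φ y k * a k := by
  simp only [confTensor, sub_mul, add_mul, one_mul, Finset.sum_sub_distrib, Finset.sum_add_distrib,
    ite_mul, zero_mul, Finset.sum_ite_eq', Finset.mem_univ, if_true, Finset.mul_sum, mul_assoc]

lemma contract_confTensor (hG : IsMetricOn G U) (hy : y ∈ U) (j : Fin n) :
    contract (confTensor 1 G φ) y j = n * φ j y := by
  have e : ∑ t, G y t j * raise G φ y t = φ j y := by
    rw [← hG.sum_mul_raise (φ := φ) hy j]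
    exact Finset.sum_congr rfl fun t _ => by rw [hG.apply_comm hy]
  simp only [contract, confTensor, one_mul, if_true, Finset.sum_sub_distrib, Finset.sum_add_distrib,
    Finset.sum_ite_eq', Finset.mem_univ, e]
  simp

/-- The contraction is nφ, so removing the trace removes precisely the two Kronecker terms, which is
the passage from α = 1 to α = 0. -/
lemma reduced_confTensor (hG : IsMetricOn G U) (hy : y ∈ U) :
    reduced (confTensor 1 G φ) y = confTensor 0 G φ y := by
  funext k i j
  -- The existence of an index `k` already forces n to be nonzero, so no dimension hypothesis is
  -- needed.
  have hn : (n : ℝ) ≠ 0 := by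
    have := k.pos
    positivity
  simp only [reduced, contract_confTensor hG hy, confTensor, eq_comm (a := i), eq_comm (a := j)]
  split_ifs <;> field_simp <;> ring

/-- The terms φ^s φ_j from the first Kronecker delta and from the metric part cancel, leaving |φ|²
times the identity. -/
lemma sum_raise_confTensor (hG : IsMetricOn G U) (hy : y ∈ U) (s j : Fin n) :
    ∑ u, raise G φ y u * confTensor 1 G φ y s u j
      = if s = j then ∑ u, raise G φ y u * φ u y else 0 := by
  have e : ∑ u, raise G φ y u * G y u j = φ j y := by
    rw [← hG.sum_mul_raise (φ := φ) hy j]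
    exact Finset.sum_congr rfl fun t _ => by rw [hG.apply_comm hy, mul_comm]
  have : ∀ u, raise G φ y u * confTensor 1 G φ y s u j
      = (if s = u then raise G φ y u * φ j y else 0)
        + (if s = j then raise G φ y u * φ u y else 0)
        - (raise G φ y u * G y u j) * raise G φ y s := by
    intro u
    simp only [confTensor]
    split_ifs <;> ring
  simp only [this, Finset.sum_sub_distrib, Finset.sum_add_distrib, ← Finset.sum_mul, e,
    Finset.sum_ite_eq, Finset.mem_univ, if_true]
  split_ifs
  · ring
  · simp; ring

/-- The quadratic contraction of `confTensor`. -/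
lemma sum_confTensor_sq (hG : IsMetricOn G U) (hy : y ∈ U) (i j : Fin n) :
    ∑ s, ∑ u, confTensor 1 G φ y u s i * confTensor 1 G φ y s u j
      = (n + 2) * (φ i y * φ j y) - 2 * (G y i j * ∑ u, raise G φ y u * φ u y) := by
  simp only [sum_confTensor_mul (fun u => confTensor 1 G φ y _ u j), sum_raise_confTensor hG hy,
    Finset.sum_add_distrib, Finset.sum_sub_distrib, mul_ite, mul_zero, Finset.sum_ite_eq',
    Finset.mem_univ, if_true, ← Finset.mul_sum]
  have e1 : ∑ s, φ s y * confTensor 1 G φ y s i j = 2 * (φ i y * φ j y)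
      - G y i j * ∑ u, raise G φ y u * φ u y := by
    have := sum_confTensor_mul (G := G) (φ := φ) (y := y) (fun s => φ s y) i j
    simp only [mul_comm (φ _ y) (confTensor _ _ _ _ _ _ _), this]
    ring
  have e2 : ∑ s, confTensor 1 G φ y s s j = n * φ j y := contract_confTensor hG hy j
  rw [e1, e2, hG.apply_comm hy j i]
  ring

end

/-! ### Effect of a conformal change on each term -/

section

variable {G H : Coord n → Matrix (Fin n) (Fin n) ℝ} {U V : Set (Coord n)} {y : Coord n}
  {Γ Γ' L L' : Coeff n} {δ : ℝ} {P : Coord n → Fin n → Fin n → ℝ} {φ : Fin n → Coord n → ℝ}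
  {f : Coord n → ℝ}

/-- `H = f G` on `U` for a smooth positive function `f`. -/
structure IsConformalOn (G H : Coord n → Matrix (Fin n) (Fin n) ℝ) (f : Coord n → ℝ)
    (U : Set (Coord n)) : Prop where
  isOpen : IsOpen U
  left : IsMetricOn G U
  right : IsMetricOn H U
  smooth : ContDiffOn ℝ ∞ f U
  pos : ∀ z ∈ U, 0 < f z
  eq : ∀ z ∈ U, H z = f z • G z

lemma christoffel_congr (hU : IsOpen U) (h : ∀ z ∈ U, G z = H z) (hy : y ∈ U) :
    christoffel G y = christoffel H y := by
  funext k i j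
  simp only [christoffel, h y hy]
  congr 1
  refine Finset.sum_congr rfl fun l _ => ?_
  have e : ∀ a b c : Fin n, pderiv c (fun z => G z a b) y = pderiv c (fun z => H z a b) y :=
    fun a b c => pderiv_congr hU hy (fun z hz => by rw [h z hz]) c
  simp only [e]

lemma IsConformalOn.christoffel_eq (h : IsConformalOn G H f U) (hy : y ∈ U) :
    christoffel H y = christoffel G y + confTensor 1 G (halfLogDeriv f) y := by
  rw [christoffel_congr h.isOpen h.eq hy, ← confTensor_one]
  funext k i j
  exact christoffel_smul h.isOpen h.left h.smooth h.pos hy k i j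

lemma IsConformalOn.contDiffOn_halfLogDeriv (h : IsConformalOn G H f U) (i : Fin n) :
    ContDiffOn ℝ ∞ (halfLogDeriv f i) U :=
  (contDiffOn_pderiv h.isOpen h.smooth i).div (contDiffOn_const.mul h.smooth) fun z hz =>
    mul_ne_zero two_ne_zero (h.pos z hz).ne'

lemma IsConformalOn.pderiv_eq (h : IsConformalOn G H f U) (hy : y ∈ U) (s : Fin n) :
    pderiv s f y = 2 * f y * halfLogDeriv f s y := by
  have := (h.pos y hy).ne'
  simp only [halfLogDeriv]; field_simp

lemma IsConformalOn.metricTrace_eq (h : IsConformalOn G H f U) (hy : y ∈ U) :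
    metricTrace H P y = f y * metricTrace G P y := by
  simp only [metricTrace, h.eq y hy, Matrix.smul_apply, smul_eq_mul, mul_assoc, Finset.mul_sum]

lemma IsConformalOn.inv_eq (h : IsConformalOn G H f U) (hy : y ∈ U) :
    (H y)⁻¹ = (f y)⁻¹ • (G y)⁻¹ := by
  have hf := (h.pos y hy).ne'
  refine Matrix.inv_eq_right_inv ?_
  rw [h.eq y hy, Matrix.smul_mul, Matrix.mul_smul, smul_smul, mul_inv_cancel₀ hf, one_smul,
    h.left.mul_inv hy]

lemma IsConformalOn.contract_eq (h : IsConformalOn G H f U) (hy : y ∈ U) (s : Fin n) :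
    contract (christoffel H) y s = contract (christoffel G) y s + n * halfLogDeriv f s y := by
  rw [← contract_confTensor h.left hy (φ := halfLogDeriv f)]
  simp only [contract, h.christoffel_eq hy, Pi.add_apply, Finset.sum_add_distrib]

/-- In the factor 2 - δn, the 2 comes from ∂f = 2fφ, as the trace is scaled by f, and -δn from the
change nφ of the trace of the connection. -/
lemma IsConformalOn.densGrad_eq (h : IsConformalOn G H f U) (hP : FieldSmoothOn P U) (hy : y ∈ U)
    (t : Fin n) : densGrad (christoffel H) δ (metricTrace H P) y t
      = f y * (densGrad (christoffel G) δ (metricTrace G P) y t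
        + (2 - δ * n) * halfLogDeriv f t y * metricTrace G P y) := by
  have e : pderiv t (metricTrace H P) y
      = pderiv t f y * metricTrace G P y + f y * pderiv t (metricTrace G P) y := by
    rw [pderiv_congr h.isOpen hy (fun z hz => h.metricTrace_eq hz)]
    exact pderiv_mul (differentiableAt_of_contDiffOn h.isOpen h.smooth hy)
      (differentiableAt_of_contDiffOn h.isOpen (contDiffOn_metricTrace h.left.smooth hP) hy) t
  rw [densGrad, densGrad, e, h.pderiv_eq hy, h.contract_eq hy, h.metricTrace_eq hy]
  ring

/-- The gradient formula is differentiated and corrected by the new connection. In 1 - δn, the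
scaling by f gives 2, the density term -δn, and the connection correction -1; the latter also gives
the last two lines. -/
lemma IsConformalOn.densHess_eq (h : IsConformalOn G H f U) (hP : FieldSmoothOn P U) (hy : y ∈ U)
    (s t : Fin n) : densHess (christoffel H) δ (metricTrace H P) y s t
      = f y * (densHess (christoffel G) δ (metricTrace G P) y s t
        + (2 - δ * n) * covForm (christoffel G) (halfLogDeriv f) y s t * metricTrace G P y
        + (2 - δ * n) * halfLogDeriv f t y * densGrad (christoffel G) δ (metricTrace G P) y s
        + (1 - δ * n) * halfLogDeriv f s y * (densGrad (christoffel G) δ (metricTrace G P) y t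
            + (2 - δ * n) * halfLogDeriv f t y * metricTrace G P y)
        - halfLogDeriv f t y * (densGrad (christoffel G) δ (metricTrace G P) y s
            + (2 - δ * n) * halfLogDeriv f s y * metricTrace G P y)
        + G y s t * ∑ m, raise G (halfLogDeriv f) y m *
            (densGrad (christoffel G) δ (metricTrace G P) y m
            + (2 - δ * n) * halfLogDeriv f m y * metricTrace G P y)) := by
  have hφ := h.contDiffOn_halfLogDeriv
  have su := contDiffOn_metricTrace h.left.smooth hP
  have du := differentiableAt_of_contDiffOn h.isOpen su hy
  have dφ := differentiableAt_of_contDiffOn h.isOpen (hφ t) hy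
  have df := differentiableAt_of_contDiffOn h.isOpen h.smooth hy
  have dU := differentiableAt_of_contDiffOn h.isOpen
    (contDiffOn_densGrad (δ := δ) h.isOpen (coeffSmoothOn_christoffel h.isOpen h.left) su t) hy
  have dφ' : DifferentiableAt ℝ (fun z => (2 - δ * n) * halfLogDeriv f t z) y := dφ.const_mul _
  have dφu : DifferentiableAt ℝ
      (fun z => (2 - δ * n) * halfLogDeriv f t z * metricTrace G P z) y := dφ'.mul du
  have dX : DifferentiableAt ℝ (fun z => densGrad (christoffel G) δ (metricTrace G P) z t
        + (2 - δ * n) * halfLogDeriv f t z * metricTrace G P z) y := dU.add dφu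
  have e1 : pderiv s (fun z => densGrad (christoffel H) δ (metricTrace H P) z t) y
      = 2 * f y * halfLogDeriv f s y * (densGrad (christoffel G) δ (metricTrace G P) y t
            + (2 - δ * n) * halfLogDeriv f t y * metricTrace G P y)
        + f y * (pderiv s (fun z => densGrad (christoffel G) δ (metricTrace G P) z t) y
          + ((2 - δ * n) * pderiv s (halfLogDeriv f t) y * metricTrace G P y
            + (2 - δ * n) * halfLogDeriv f t y * pderiv s (metricTrace G P) y)) := by
    rw [pderiv_congr h.isOpen hy (fun z hz => h.densGrad_eq hP hz t), pderiv_mul df dX,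
      pderiv_add dU dφu, pderiv_mul dφ' du, pderiv_const_mul dφ, h.pderiv_eq hy]
  have e2 : ∑ m, christoffel H y m s t * densGrad (christoffel H) δ (metricTrace H P) y m
      = f y * (∑ m, christoffel G y m s t * densGrad (christoffel G) δ (metricTrace G P) y m
          + (2 - δ * n) * metricTrace G P y * ∑ m, christoffel G y m s t * halfLogDeriv f m y
          + ∑ m, confTensor 1 G (halfLogDeriv f) y m s t *
            (densGrad (christoffel G) δ (metricTrace G P) y m
            + (2 - δ * n) * halfLogDeriv f m y * metricTrace G P y)) := by
    simp only [h.densGrad_eq hP hy, h.christoffel_eq hy, Pi.add_apply, Finset.mul_sum,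
      ← Finset.sum_add_distrib]
    exact Finset.sum_congr rfl fun m _ => by ring
  rw [densHess, e1, e2, h.contract_eq hy, h.densGrad_eq hP hy, sum_confTensor_mul, densHess, covForm]
  have e3 : pderiv s (metricTrace G P) y = densGrad (christoffel G) δ (metricTrace G P) y s
      + δ * contract (christoffel G) y s * metricTrace G P y := by rw [densGrad]; ring
  rw [e3]
  ring

lemma IsConformalOn.coordGradTrace_eq (h : IsConformalOn G H f U) (hP : FieldSmoothOn P U)
    (hy : y ∈ U) (k : Fin n) : coordGradTrace H δ P y k = coordGradTrace G δ P y k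
      + (2 - δ * n) * raise G (halfLogDeriv f) y k * metricTrace G P y := by
  have hf := (h.pos y hy).ne'
  rw [ConformalSchwarzian.coordGradTrace_eq h.isOpen h.right hP hy,
    ConformalSchwarzian.coordGradTrace_eq h.isOpen h.left hP hy]
  simp only [h.inv_eq hy, h.densGrad_eq hP hy, Matrix.smul_apply, smul_eq_mul, raise,
    Finset.mul_sum, Finset.sum_mul, ← Finset.sum_add_distrib]
  refine Finset.sum_congr rfl fun s _ => ?_
  rw [h.left.inv_apply_comm hy k s]
  field_simp

/-- Tracing the Hessian formula, the metric term contributes n. The first order coefficient is (2 -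
δn) + (1 - δn) - 1 + n = 2 + n(1 - 2δ), which explains c₁, and the coefficient of |φ|² is (2 -
δn)((1 - δn) - 1 + n). -/
lemma IsConformalOn.coordLaplaceTrace_eq (h : IsConformalOn G H f U) (hP : FieldSmoothOn P U)
    (hy : y ∈ U) : coordLaplaceTrace H δ P y = coordLaplaceTrace G δ P y
      + (2 - δ * n) * (∑ s, ∑ t, (G y)⁻¹ s t * covForm (christoffel G) (halfLogDeriv f) y s t)
          * metricTrace G P y
      + (2 + n * (1 - 2 * δ)) * (∑ m, raise G (halfLogDeriv f) y m *
          densGrad (christoffel G) δ (metricTrace G P) y m)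
      + (2 - δ * n) * (n - δ * n) * (∑ m, raise G (halfLogDeriv f) y m * halfLogDeriv f m y)
          * metricTrace G P y := by
  have hf := (h.pos y hy).ne'
  rw [ConformalSchwarzian.coordLaplaceTrace_eq h.isOpen h.right hP hy,
    ConformalSchwarzian.coordLaplaceTrace_eq h.isOpen h.left hP hy]
  set u := metricTrace G P y
  set W := densGrad (christoffel G) δ (metricTrace G P) y
  set K := covForm (christoffel G) (halfLogDeriv f) y
  have q : ∀ a : Fin n → ℝ, ∑ s, ∑ t, (G y)⁻¹ s t * (halfLogDeriv f s y * a t)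
      = ∑ m, raise G (halfLogDeriv f) y m * a m := by
    intro a
    rw [Finset.sum_comm]
    refine Finset.sum_congr rfl fun t _ => ?_
    rw [raise, Finset.sum_mul]
    exact Finset.sum_congr rfl fun s _ => by rw [h.left.inv_apply_comm hy]; ring
  have q' : ∀ a : Fin n → ℝ, ∑ s, ∑ t, (G y)⁻¹ s t * (halfLogDeriv f t y * a s)
      = ∑ m, raise G (halfLogDeriv f) y m * a m := by
    intro a
    refine Finset.sum_congr rfl fun s _ => ?_
    rw [raise, Finset.sum_mul]
    exact Finset.sum_congr rfl fun t _ => by ring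
  have hg : ∑ s, ∑ t, (G y)⁻¹ s t * G y s t = n := by
    have : ∀ s, ∑ t, (G y)⁻¹ s t * G y s t = 1 := fun s => by
      have := h.left.sum_inv_mul hy s s
      rw [if_pos rfl] at this
      rw [← this]
      exact Finset.sum_congr rfl fun t _ => by rw [h.left.apply_comm hy]
    simp [this]
  have e : ∀ s t, (H y)⁻¹ s t * densHess (christoffel H) δ (metricTrace H P) y s t
      = (G y)⁻¹ s t * densHess (christoffel G) δ (metricTrace G P) y s t
        + (2 - δ * n) * u * ((G y)⁻¹ s t * K s t)
        + (2 - δ * n) * ((G y)⁻¹ s t * (halfLogDeriv f t y * W s))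
        + (1 - δ * n) * ((G y)⁻¹ s t * (halfLogDeriv f s y *
            (W t + (2 - δ * n) * halfLogDeriv f t y * u)))
        - (G y)⁻¹ s t * (halfLogDeriv f t y * (W s + (2 - δ * n) * halfLogDeriv f s y * u))
        + ((G y)⁻¹ s t * G y s t) * ∑ m, raise G (halfLogDeriv f) y m *
            (W m + (2 - δ * n) * halfLogDeriv f m y * u) := by
    intro s t
    have c : ∀ a b : ℝ, (f y)⁻¹ * a * (f y * b) = a * b := fun a b => by field_simp
    rw [h.inv_eq hy, h.densHess_eq hP hy, Matrix.smul_apply, smul_eq_mul, c]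
    ring
  simp only [e, Finset.sum_add_distrib, Finset.sum_sub_distrib, ← Finset.mul_sum, ← Finset.sum_mul,
    q (fun t => W t + (2 - δ * n) * halfLogDeriv f t y * u),
    q' (fun t => W t + (2 - δ * n) * halfLogDeriv f t y * u), q', hg]
  have e2 : ∑ m, raise G (halfLogDeriv f) y m * (W m + (2 - δ * n) * halfLogDeriv f m y * u)
      = ∑ m, raise G (halfLogDeriv f) y m * W m
        + (2 - δ * n) * u * ∑ m, raise G (halfLogDeriv f) y m * halfLogDeriv f m y := by
    rw [Finset.mul_sum, ← Finset.sum_add_distrib]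
    exact Finset.sum_congr rfl fun m _ => by ring
  rw [e2]
  ring

/-- The curvature of a sum of a connection and a tensor field. -/
lemma curvMatrix_add (hU : IsOpen U) (hΓ : SymmOn Γ U) (sΓ : CoeffSmoothOn Γ U)
    (sL : CoeffSmoothOn L U) (h : ∀ z ∈ U, Γ' z = Γ z + L z) (hy : y ∈ U) (i k : Fin n) :
    curvMatrix Γ' i k y = curvMatrix Γ i k y + covTensorMatrix Γ L i k y
      - covTensorMatrix Γ L k i y
      + (connMatrix L i y * connMatrix L k y - connMatrix L k y * connMatrix L i y) := by
  have hA : ∀ s, ∀ z ∈ U, connMatrix Γ' s z = connMatrix Γ s z + connMatrix L s z := by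
    intro s z hz
    ext a b
    simp only [connMatrix, Matrix.of_apply, Matrix.add_apply, h z hz, Pi.add_apply]
  have hd : ∀ s t, mderiv t (connMatrix Γ' s) y
      = mderiv t (connMatrix Γ s) y + mderiv t (connMatrix L s) y := by
    intro s t
    rw [mderiv_congr hU hy (hA s)]
    exact mderiv_add ((sΓ.connMatrix s).matDiffAt hU hy) ((sL.connMatrix s).matDiffAt hU hy) t
  rw [curvMatrix, curvMatrix, covTensorMatrix_eq, covTensorMatrix_eq, hd, hd, hA _ y hy, hA _ y hy]
  simp only [hΓ y hy _ i k]
  noncomm_ring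

/-- The scalar curvatures of conformal metrics. -/
lemma IsConformalOn.scalarCurvature_eq (h : IsConformalOn G H f U) (hy : y ∈ U) :
    f y * scalarCurvature H y = scalarCurvature G y
      - 2 * (n - 1) * (∑ s, ∑ t, (G y)⁻¹ s t * covForm (christoffel G) (halfLogDeriv f) y s t)
      - (n - 1) * (n - 2) * (∑ m, raise G (halfLogDeriv f) y m * halfLogDeriv f m y) := by
  have hf := (h.pos y hy).ne'
  have hφ := h.contDiffOn_halfLogDeriv
  have sΓ := coeffSmoothOn_christoffel h.isOpen h.left
  have sH := coeffSmoothOn_christoffel h.isOpen h.right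
  have hΓ := symmOn_christoffel h.isOpen h.left
  have hΓH := symmOn_christoffel h.isOpen h.right
  set φ := halfLogDeriv f
  set K := covForm (christoffel G) φ y
  set N := ∑ m, raise G φ y m * φ m y
  set Δ := ∑ s, ∑ t, (G y)⁻¹ s t * K s t
  have sL : CoeffSmoothOn (confTensor 1 G φ) U := by
    intro k i j
    refine ((sH k i j).sub (sΓ k i j)).congr fun z hz => ?_
    rw [h.christoffel_eq hz]
    simp only [Pi.add_apply]; ring
  -- Symmetry of ∇φ is not invoked: both orders of the indices of K are kept, and the trace with the
  -- symmetric inverse metric merges them.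
  have hR : ∀ j k, ricci (christoffel H) y j k = ricci (christoffel G) y j k
      + (K k j + K j k - n * K k j) + (n - 2) * (φ k y * φ j y) - G y k j * (Δ + (n - 2) * N) := by
    intro j k
    rw [ricci_eq h.isOpen hΓH hy, ricci_eq h.isOpen hΓ hy]
    simp only [curvMatrix_add h.isOpen hΓ sΓ sL (fun z hz => h.christoffel_eq hz) hy,
      Matrix.add_apply, Matrix.sub_apply, Finset.sum_add_distrib, Finset.sum_sub_distrib]
    have t1 : ∑ i, covTensorMatrix (christoffel G) (confTensor 1 G φ) i k y i j
        = K k j + K j k - G y k j * Δ := by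
      simp only [covTensorMatrix, Matrix.of_apply,
        covDerivTensor_confTensor h.isOpen h.left hφ hy, one_mul, Finset.sum_sub_distrib,
        Finset.sum_add_distrib, Finset.sum_ite_eq', Finset.mem_univ, if_true, ← Finset.mul_sum]
      rfl
    have t2 : ∑ i, covTensorMatrix (christoffel G) (confTensor 1 G φ) k i y i j
        = n * K k j := by
      have : ∑ i, G y i j * ∑ l, (G y)⁻¹ i l * K k l = K k j := by
        simp only [Finset.mul_sum, ← mul_assoc]
        rw [Finset.sum_comm]
        simp only [← Finset.sum_mul, h.left.apply_comm hy _ j, h.left.sum_mul_inv hy]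
        simp
      simp only [covTensorMatrix, Matrix.of_apply,
        covDerivTensor_confTensor h.isOpen h.left hφ hy, one_mul, Finset.sum_sub_distrib,
        Finset.sum_add_distrib, Finset.sum_ite_eq', Finset.mem_univ, if_true]
      change _ - ∑ i, G y i j * ∑ l, (G y)⁻¹ i l * K k l = _
      rw [this]
      simp [K]
    have t3 : ∑ i, (connMatrix (confTensor 1 G φ) i y * connMatrix (confTensor 1 G φ) k y) i j
        = n * (2 * (φ k y * φ j y) - G y k j * N) := by
      simp only [Matrix.mul_apply, connMatrix, Matrix.of_apply]
      rw [Finset.sum_comm]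
      simp only [← Finset.sum_mul]
      have : ∀ m, ∑ i, confTensor 1 G φ y i i m = n * φ m y := contract_confTensor h.left hy
      simp only [this, mul_assoc, ← Finset.mul_sum, mul_comm (φ _ y) (confTensor _ _ _ _ _ _ _)]
      rw [sum_confTensor_mul (fun m => φ m y)]
      ring
    have t4 : ∑ i, (connMatrix (confTensor 1 G φ) k y * connMatrix (confTensor 1 G φ) i y) i j
        = (n + 2) * (φ k y * φ j y) - 2 * (G y k j * N) := by
      rw [← sum_confTensor_sq h.left hy]
      simp only [Matrix.mul_apply, connMatrix, Matrix.of_apply]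
      rw [Finset.sum_comm]
      refine Finset.sum_congr rfl fun s _ => Finset.sum_congr rfl fun u _ => ?_
      congr 1
      simp only [confTensor, h.left.apply_comm hy k s]
      ring
    rw [t1, t2, t3, t4]
    ring
  have hg : ∑ j, ∑ k, (G y)⁻¹ j k * G y k j = n := by
    simp [h.left.sum_inv_mul hy]
  have hN : ∑ j, ∑ k, (G y)⁻¹ j k * (φ k y * φ j y) = N := by
    refine Finset.sum_congr rfl fun s _ => ?_
    rw [raise, Finset.sum_mul]
    exact Finset.sum_congr rfl fun t _ => by ring
  have hK : ∑ j, ∑ k, (G y)⁻¹ j k * K k j = Δ := by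
    rw [Finset.sum_comm]
    exact Finset.sum_congr rfl fun s _ => Finset.sum_congr rfl fun t _ => by
      rw [h.left.inv_apply_comm hy]
  have e : ∀ j k, f y * ((H y)⁻¹ j k * ricci (christoffel H) y j k)
      = (G y)⁻¹ j k * ricci (christoffel G) y j k + ((G y)⁻¹ j k * K j k)
        + (1 - n) * ((G y)⁻¹ j k * K k j) + (n - 2) * ((G y)⁻¹ j k * (φ k y * φ j y))
        - ((G y)⁻¹ j k * G y k j) * (Δ + (n - 2) * N) := by
    intro j k
    rw [h.inv_eq hy, hR, Matrix.smul_apply, smul_eq_mul, ← mul_assoc, ← mul_assoc,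
      mul_inv_cancel₀ hf]
    ring
  simp only [scalarCurvature, Finset.mul_sum, e, Finset.sum_add_distrib, Finset.sum_sub_distrib]
  simp only [← Finset.mul_sum, ← Finset.sum_mul, hN, hK, hg]
  ring

/-- The zeroth order part of `lowerTerms` for a conformal change. -/
lemma lowerMatrix_confTensor (hn : 2 < n) (hU : IsOpen U) (hG : IsMetricOn G U)
    (hφ : ∀ i, ContDiffOn ℝ ∞ (φ i) U) (hy : y ∈ U) (i j : Fin n) :
    lowerMatrix δ (christoffel G) (confTensor 1 G φ) y i j
      = -((2 + n * (1 - 2 * δ)) * (δ * n - 2) / (n - 2)) * G y i j *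
        ∑ s, ∑ t, (G y)⁻¹ s t * covForm (christoffel G) φ y s t := by
  have hn0 : (n : ℝ) ≠ 0 := by positivity
  have hn2 : (n : ℝ) - 2 ≠ 0 := by
    have : (2 : ℝ) < n := by exact_mod_cast hn
    linarith
  have e3 : ∑ s, covDerivTensor (christoffel G) (reduced (confTensor 1 G φ)) y s s i j
      = - (G y i j * ∑ s, ∑ t, (G y)⁻¹ s t * covForm (christoffel G) φ y s t) := by
    simp only [covDerivTensor_congr hU hy (fun z hz => reduced_confTensor (φ := φ) hG hz),
      covDerivTensor_confTensor hU hG hφ hy, zero_mul, zero_sub, Finset.sum_neg_distrib,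
      ← Finset.mul_sum]
  have e4 : ∑ s, contract (confTensor 1 G φ) y s * confTensor 1 G φ y s i j
      = n * (2 * (φ i y * φ j y) - G y i j * ∑ u, raise G φ y u * φ u y) := by
    simp only [contract_confTensor hG hy, mul_assoc, ← Finset.mul_sum,
      mul_comm (φ _ y) (confTensor _ _ _ _ _ _ _)]
    rw [sum_confTensor_mul (fun m => φ m y)]
    ring
  simp only [lowerMatrix, Matrix.add_apply, Matrix.smul_apply, Matrix.of_apply, smul_eq_mul,
    Matrix.sum_apply, lowerSlice]
  -- The coefficient of φ_i φ_j is n²c₂ + 2nc₄ + (n + 2)c₅ and that of g_ij |φ|² is -(nc₄ + 2c₅).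
  -- Both vanish, so only the divergence term survives.
  rw [e3, e4, sum_confTensor_sq hG hy, contract_confTensor hG hy, contract_confTensor hG hy]
  field_simp
  ring

/-- The reduced difference of connections is -g_ij φ^s, so the first order part sees only the
gradient of the trace of `P`. It is the opposite of the first order change of the second order
operator. -/
lemma IsConformalOn.lowerTerms_eq (hn : 2 < n) (h : IsConformalOn G H f U)
    (hP : FieldSmoothOn P U) (hy : y ∈ U) :
    lowerTerms δ (christoffel G) (christoffel H - christoffel G) P y
      = -(2 + n * (1 - 2 * δ)) * (∑ m, raise G (halfLogDeriv f) y m *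
          densGrad (christoffel G) δ (metricTrace G P) y m)
        - ((2 + n * (1 - 2 * δ)) * (δ * n - 2) / (n - 2)) *
        (∑ s, ∑ t, (G y)⁻¹ s t * covForm (christoffel G) (halfLogDeriv f) y s t)
          * metricTrace G P y := by
  have hL : ∀ z ∈ U, (christoffel H - christoffel G) z = confTensor 1 G (halfLogDeriv f) z := by
    intro z hz
    rw [Pi.sub_apply, h.christoffel_eq hz]; abel
  rw [lowerTerms_congr h.isOpen hy hL, ConformalSchwarzian.lowerTerms_eq, reduced_confTensor h.left hy]
  have e₁ : ∑ s, ∑ i, ∑ j, confTensor 0 G (halfLogDeriv f) y s i j *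
      covDeriv (christoffel G) δ P y s i j
      = -∑ m, raise G (halfLogDeriv f) y m * densGrad (christoffel G) δ (metricTrace G P) y m := by
    simp only [← sum_metric_covDeriv h.isOpen h.left hP hy, Finset.mul_sum,
      ← Finset.sum_neg_distrib, confTensor]
    exact Finset.sum_congr rfl fun s _ => Finset.sum_congr rfl fun i _ =>
      Finset.sum_congr rfl fun j _ => by ring
  simp only [covMatrix, Matrix.of_apply, e₁, metricTrace,
    lowerMatrix_confTensor hn h.isOpen h.left h.contDiffOn_halfLogDeriv hy]
  rw [sub_eq_add_neg, neg_mul, mul_neg]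
  congr 1
  simp only [Finset.mul_sum, ← Finset.sum_neg_distrib]
  exact Finset.sum_congr rfl fun i _ => Finset.sum_congr rfl fun j _ => by
    simp only [← Finset.mul_sum]; ring

/-- `𝒜` vanishes on conformal metrics. -/
lemma IsConformalOn.coordA_eq_zero (h : IsConformalOn G H f U) (hP : FieldSmoothOn P U)
    (hy : y ∈ U) (k : Fin n) : coordA δ G H P y k = 0 := by
  have hL : (christoffel H - christoffel G) y = confTensor 1 G (halfLogDeriv f) y := by
    rw [Pi.sub_apply, h.christoffel_eq hy]; abel
  have e : ∑ i, ∑ j, confTensor 0 G (halfLogDeriv f) y k i j * P y i j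
      = -(raise G (halfLogDeriv f) y k * metricTrace G P y) := by
    simp only [metricTrace, confTensor, zero_mul, zero_sub, Finset.mul_sum, ← Finset.sum_neg_distrib]
    exact Finset.sum_congr rfl fun i _ => Finset.sum_congr rfl fun j _ => by ring
  rw [coordA, h.coordGradTrace_eq hP hy, reduced_congr hL, reduced_confTensor h.left hy, e]
  ring

/-- `ℬ` vanishes on conformal metrics. -/
lemma IsConformalOn.coordB_eq_zero (hn : 2 < n) (h : IsConformalOn G H f U)
    (hP : FieldSmoothOn P U) (hy : y ∈ U) : coordB δ G H P y = 0 := by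
  have hn1 : (n : ℝ) - 1 ≠ 0 := by
    have : (2 : ℝ) < n := by exact_mod_cast hn
    linarith
  have hn2 : (n : ℝ) - 2 ≠ 0 := by
    have : (2 : ℝ) < n := by exact_mod_cast hn
    linarith
  have e : coordScalarTrace H P y - coordScalarTrace G P y
      = (f y * scalarCurvature H y - scalarCurvature G y) * metricTrace G P y := by
    rw [coordScalarTrace_eq, coordScalarTrace_eq, h.metricTrace_eq hy]; ring
  -- The gradient terms cancel outright. The divergence of φ disappears because (2 - δn) - c₃ = 2(n
  -- - 1)c₆, and |φ|² because (2 - δn)(n - δn) = (n - 1)(n - 2)c₆.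
  rw [coordB, h.coordLaplaceTrace_eq hP hy, h.lowerTerms_eq hn hP hy, e, h.scalarCurvature_eq hy]
  field_simp
  ring

end

/-! ### Additivity of the two-metric operators -/

section

variable {G₁ G₂ G₃ : Coord n → Matrix (Fin n) (Fin n) ℝ} {U : Set (Coord n)} {y : Coord n}
  {δ : ℝ} {P : Coord n → Fin n → Fin n → ℝ}

/-- Every term is a difference of an expression in the second metric and the same expression in the
first, since `reduced` is linear. -/
lemma coordA_add (k : Fin n) :
    coordA δ G₁ G₂ P y k + coordA δ G₂ G₃ P y k = coordA δ G₁ G₃ P y k := by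
  simp only [coordA, reduced_sub, sub_mul, Finset.sum_sub_distrib]
  ring

/-- The only term not visibly a difference is `lowerTerms`. Taking the flat connection of the chart,
`0`, as common reference makes it one. -/
lemma coordB_add (hn : 2 < n) (hU : IsOpen U) (h₁ : IsMetricOn G₁ U) (h₂ : IsMetricOn G₂ U)
    (h₃ : IsMetricOn G₃ U) (hy : y ∈ U) :
    coordB δ G₁ G₂ P y + coordB δ G₂ G₃ P y = coordB δ G₁ G₃ P y := by
  have c : ∀ {G H : Coord n → Matrix (Fin n) (Fin n) ℝ}, IsMetricOn G U → IsMetricOn H U →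
      lowerTerms δ (christoffel G) (christoffel H - christoffel G) P y
        = lowerTerms δ 0 (christoffel H) P y - lowerTerms δ 0 (christoffel G) P y :=
    fun hG hH => lowerTerms_cocycle hn hU (symmOn_christoffel hU hG) (symmOn_christoffel hU hH)
      (coeffSmoothOn_christoffel hU hG) (coeffSmoothOn_christoffel hU hH) hy
  simp only [coordB, c h₁ h₂, c h₂ h₃, c h₁ h₃]
  ring

end

/-! ### Matrices of linear maps and changes of frame -/

/-- The matrix of a linear map in the standard basis. -/
def linMatrix (A : Coord n →L[ℝ] Coord n) : Matrix (Fin n) (Fin n) ℝ :=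
  Matrix.of fun i a => A (EuclideanSpace.single a (1 : ℝ)) i

lemma apply_single_eq_sum (A : Coord n →L[ℝ] Coord n) (i : Fin n) :
    A (EuclideanSpace.single i (1 : ℝ))
      = ∑ a, linMatrix A a i • EuclideanSpace.single a (1 : ℝ) := by
  ext b
  simp [linMatrix, Finset.sum_apply, Pi.single_apply]

lemma linMatrix_comp (A B : Coord n →L[ℝ] Coord n) :
    linMatrix (A.comp B) = linMatrix A * linMatrix B := by
  ext i a
  simp only [linMatrix, Matrix.of_apply, ContinuousLinearMap.comp_apply, Matrix.mul_apply]
  conv_lhs => rw [apply_single_eq_sum B, map_sum]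
  simp [Finset.sum_apply, linMatrix, mul_comm]

lemma linMatrix_id : linMatrix (ContinuousLinearMap.id ℝ (Coord n)) = 1 := by
  ext i a
  simp [linMatrix, Matrix.one_apply]

lemma jacobian_eq {F : Coord n → Coord n} {y : Coord n} (hF : DifferentiableAt ℝ F y) :
    jacobian F y = linMatrix (fderiv ℝ F y) := by
  ext a i
  have := ((EuclideanSpace.proj a : Coord n →L[ℝ] ℝ).hasFDerivAt.comp y hF.hasFDerivAt).fderiv
  have h2 : (fun z => F z a) = (EuclideanSpace.proj a : Coord n →L[ℝ] ℝ) ∘ F := rfl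
  simp only [jacobian, Matrix.of_apply, pderiv]
  rw [h2, this]; rfl

lemma jacobian_comp {F K : Coord n → Coord n} {y : Coord n} (hF : DifferentiableAt ℝ F y)
    (hK : DifferentiableAt ℝ K (F y)) :
    jacobian (K ∘ F) y = jacobian K (F y) * jacobian F y := by
  rw [jacobian_eq (hK.comp y hF), jacobian_eq hK, jacobian_eq hF, fderiv_comp y hK hF,
    linMatrix_comp]

lemma jacobian_congr {F K : Coord n → Coord n} {U : Set (Coord n)} {y : Coord n} (hU : IsOpen U)
    (h : ∀ z ∈ U, F z = K z) (hy : y ∈ U) : jacobian F y = jacobian K y := by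
  ext a i
  exact pderiv_congr hU hy (fun z hz => by rw [h z hz]) i

lemma jacobian_id (y : Coord n) : jacobian (fun z : Coord n => z) y = 1 := by
  rw [jacobian_eq differentiableAt_fun_id, fderiv_fun_id, linMatrix_id]

lemma transpose_mul_mul_linMatrix {W : Type*} [AddCommGroup W] [Module ℝ W]
    (B : LinearMap.BilinForm ℝ W) (D : Coord n →ₗ[ℝ] W) (A : Coord n →L[ℝ] Coord n) :
    (linMatrix A)ᵀ * (Matrix.of fun i j => B (D (EuclideanSpace.single i (1 : ℝ)))
        (D (EuclideanSpace.single j (1 : ℝ)))) * linMatrix A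
      = Matrix.of fun i j => B (D (A (EuclideanSpace.single i (1 : ℝ))))
        (D (A (EuclideanSpace.single j (1 : ℝ)))) := by
  ext i j
  simp only [apply_single_eq_sum A, map_sum, map_smul, LinearMap.sum_apply, LinearMap.smul_apply,
    Matrix.mul_apply, Matrix.transpose_apply, Matrix.of_apply, Finset.sum_mul, smul_eq_mul,
    Finset.mul_sum]
  exact Finset.sum_congr rfl fun a _ => Finset.sum_congr rfl fun b _ => by ring

lemma pullMetric_comp {F K : Coord n → Coord n} {G : Coord n → Matrix (Fin n) (Fin n) ℝ}
    {y : Coord n} (hF : DifferentiableAt ℝ F y) (hK : DifferentiableAt ℝ K (F y)) :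
    pullMetric (K ∘ F) G y = pullMetric F (pullMetric K G) y := by
  simp only [pullMetric, jacobian_comp hF hK, Matrix.transpose_mul, Function.comp_apply,
    Matrix.mul_assoc]

/-- Functoriality: multiplicativity of |det|^(-δ), together with the expansion of a product of sums
into a sum over multi-indices. -/
lemma changeFrame_changeFrame {k : ℕ} (δ : ℝ) (A B : Matrix (Fin n) (Fin n) ℝ)
    (p : (Fin k → Fin n) → ℝ) :
    changeFrame δ A (changeFrame δ B p) = changeFrame δ (A * B) p := by
  funext i
  have e : ∀ b : Fin k → Fin n, ∏ r, (A * B) (i r) (b r)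
      = ∑ a : Fin k → Fin n, ∏ r, A (i r) (a r) * B (a r) (b r) := by
    intro b
    simp only [Matrix.mul_apply]
    rw [Finset.prod_univ_sum, Fintype.piFinset_univ]
  simp only [changeFrame, Matrix.det_mul, abs_mul,
    Real.mul_rpow (abs_nonneg A.det) (abs_nonneg B.det), e, mul_assoc]
  congr 1
  simp only [Finset.mul_sum, Finset.sum_mul, Finset.prod_mul_distrib]
  rw [Finset.sum_comm]
  exact Finset.sum_congr rfl fun b _ => Finset.sum_congr rfl fun a _ => by ring

lemma changeFrame_one {k : ℕ} (δ : ℝ) (p : (Fin k → Fin n) → ℝ) :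
    changeFrame δ (1 : Matrix (Fin n) (Fin n) ℝ) p = p := by
  funext i
  have e : ∀ a : Fin k → Fin n, ∏ r, (1 : Matrix (Fin n) (Fin n) ℝ) (i r) (a r)
      = if a = i then 1 else 0 := by
    intro a
    split_ifs with h
    · subst h; simp
    · obtain ⟨r, hr⟩ := Function.ne_iff.1 h
      exact Finset.prod_eq_zero (Finset.mem_univ r) (by rw [Matrix.one_apply_ne' hr])
  simp [changeFrame, e]

lemma changeFrame_zero_apply (δ : ℝ) (J : Matrix (Fin n) (Fin n) ℝ) (p : (Fin 0 → Fin n) → ℝ)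
    (i : Fin 0 → Fin n) : changeFrame δ J p i = |J.det| ^ (-δ) * p i := by
  simp [changeFrame, Subsingleton.elim default i]

lemma changeFrame_one_apply (δ : ℝ) (J : Matrix (Fin n) (Fin n) ℝ) (v : Fin n → ℝ)
    (i : Fin 1 → Fin n) :
    changeFrame δ J (fun a => v (a 0)) i = |J.det| ^ (-δ) * ∑ a, J (i 0) a * v a := by
  rw [changeFrame]
  congr 1
  refine Fintype.sum_equiv (Equiv.funUnique (Fin 1) (Fin n)) _ _ fun a => ?_
  simp

lemma changeFrame_two_apply (δ : ℝ) (J : Matrix (Fin n) (Fin n) ℝ) (p : (Fin 2 → Fin n) → ℝ) :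
    (Matrix.of fun i j => changeFrame δ J p ![i, j])
      = |J.det| ^ (-δ) • (J * (Matrix.of fun i j => p ![i, j]) * Jᵀ) := by
  ext i j
  simp only [changeFrame, Matrix.of_apply, Matrix.smul_apply, smul_eq_mul]
  congr 1
  rw [← (finTwoArrowEquiv (Fin n)).symm.sum_comp, Fintype.sum_prod_type, Finset.sum_comm]
  simp only [Matrix.mul_apply, Matrix.of_apply, Matrix.transpose_apply, Finset.sum_mul]
  refine Finset.sum_congr rfl fun b _ => Finset.sum_congr rfl fun a _ => ?_
  simp [Fin.prod_univ_two, finTwoArrowEquiv]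
  ring

/-! ### Diffeomorphisms in coordinates -/

section

variable {M : Type*} [TopologicalSpace M] [ChartedSpace (Coord n) M]

/-- The expression of a map in the charts centred at `c` and `c'`. -/
def coordMap (f : M → M) (c c' : M) (z : Coord n) : Coord n :=
  extChartAt (𝓡 n) c' (f ((extChartAt (𝓡 n) c).symm z))

/-- The domain of the expression of a map in the charts centred at `c` and `c'`. -/
def coordDomain (f : M → M) (c c' : M) : Set (Coord n) :=
  (extChartAt (𝓡 n) c).target ∩
    (extChartAt (𝓡 n) c).symm ⁻¹' (f ⁻¹' (extChartAt (𝓡 n) c').source)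

lemma isOpen_coordDomain {f : M → M} (hf : Continuous f) (c c' : M) :
    IsOpen (coordDomain (n := n) f c c') :=
  (continuousOn_extChartAt_symm c).isOpen_inter_preimage (isOpen_extChartAt_target c)
    ((isOpen_extChartAt_source c').preimage hf)

lemma extChartAt_mem_coordDomain (f : M → M) (x : M) :
    extChartAt (𝓡 n) x x ∈ coordDomain (n := n) f x (f x) :=
  ⟨mem_extChartAt_target x, by simp⟩

lemma coordMap_extChartAt (f : M → M) (x : M) :
    coordMap f x (f x) (extChartAt (𝓡 n) x x) = extChartAt (𝓡 n) (f x) (f x) := by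
  simp [coordMap]

lemma symm_coordMap {f : M → M} {c c' : M} {z : Coord n} (hz : z ∈ coordDomain f c c') :
    (extChartAt (𝓡 n) c').symm (coordMap f c c' z) = f ((extChartAt (𝓡 n) c).symm z) :=
  (extChartAt (𝓡 n) c').left_inv hz.2

lemma coordMap_mem_target {f : M → M} {c c' : M} {z : Coord n} (hz : z ∈ coordDomain f c c') :
    coordMap f c c' z ∈ (extChartAt (𝓡 n) c').target := (extChartAt (𝓡 n) c').map_source hz.2

lemma coordMap_coordMap {f h : M → M} {c c' c'' : M} {z : Coord n} (hz : z ∈ coordDomain f c c') :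
    coordMap h c' c'' (coordMap f c c' z) = coordMap (fun p => h (f p)) c c'' z := by
  rw [coordMap, symm_coordMap hz]; rfl

lemma coordMap_mem_coordDomain_symm (f : M ≃ₘ⟮𝓡 n, 𝓡 n⟯ M) {c c' : M} {z : Coord n}
    (hz : z ∈ coordDomain f c c') : coordMap f c c' z ∈ coordDomain f.symm c' c := by
  refine ⟨coordMap_mem_target hz, ?_⟩
  rw [Set.mem_preimage, Set.mem_preimage, symm_coordMap hz, f.symm_apply_apply]
  exact (extChartAt (𝓡 n) c).map_target hz.1

lemma coordMap_symm_coordMap (f : M ≃ₘ⟮𝓡 n, 𝓡 n⟯ M) {c c' : M} {z : Coord n}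
    (hz : z ∈ coordDomain f c c') : coordMap f.symm c' c (coordMap f c c' z) = z := by
  rw [coordMap, symm_coordMap hz, f.symm_apply_apply]
  exact (extChartAt (𝓡 n) c).right_inv hz.1

lemma coordMap_coordMap_symm (f : M ≃ₘ⟮𝓡 n, 𝓡 n⟯ M) {c c' : M} {w : Coord n}
    (hw : w ∈ coordDomain f.symm c' c) : coordMap f c c' (coordMap f.symm c' c w) = w := by
  rw [coordMap, symm_coordMap hw, f.apply_symm_apply]
  exact (extChartAt (𝓡 n) c').right_inv hw.1

variable [IsManifold (𝓡 n) ∞ M]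

lemma contDiffOn_coordMap (f : M ≃ₘ⟮𝓡 n, 𝓡 n⟯ M) (c c' : M) :
    ContDiffOn ℝ ∞ (coordMap (n := n) f c c') (coordDomain f c c') := by
  rw [← contMDiffOn_iff_contDiffOn]
  refine (contMDiffOn_extChartAt (I := 𝓡 n) (n := ∞) (x := c')).comp
    (f.contMDiff.comp_contMDiffOn ((contMDiffOn_extChartAt_symm c).mono Set.inter_subset_left)) ?_
  intro z hz
  rw [← extChartAt_source (𝓡 n)]
  exact hz.2

lemma differentiableAt_coordMap (f : M ≃ₘ⟮𝓡 n, 𝓡 n⟯ M) {c c' : M} {z : Coord n}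
    (hz : z ∈ coordDomain f c c') : DifferentiableAt ℝ (coordMap (n := n) f c c') z :=
  ((contDiffOn_coordMap f c c').contDiffAt
    ((isOpen_coordDomain f.continuous c c').mem_nhds hz)).differentiableAt (by simp)

lemma jacobian_symm_mul (f : M ≃ₘ⟮𝓡 n, 𝓡 n⟯ M) {c c' : M} {z : Coord n}
    (hz : z ∈ coordDomain f c c') :
    jacobian (coordMap f.symm c' c) (coordMap f c c' z) * jacobian (coordMap f c c') z = 1 := by
  have h1 := differentiableAt_coordMap f hz
  have h2 := differentiableAt_coordMap f.symm (coordMap_mem_coordDomain_symm f hz)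
  rw [← jacobian_comp h1 h2, jacobian_congr (F := coordMap f.symm c' c ∘ coordMap f c c') (K := fun w => w)
    (isOpen_coordDomain f.continuous c c')
    (fun w hw => coordMap_symm_coordMap f hw) hz, jacobian_id]

lemma isCoordMap_coordMap (f : M ≃ₘ⟮𝓡 n, 𝓡 n⟯ M) (c c' : M) :
    IsCoordMap (coordMap (n := n) f c c') (coordDomain f c c') (coordDomain f.symm c' c) where
  isOpen_source := isOpen_coordDomain f.continuous c c'
  isOpen_target := isOpen_coordDomain f.symm.continuous c' c
  mapsTo := fun _ hz => coordMap_mem_coordDomain_symm f hz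
  smooth := contDiffOn_coordMap f c c'
  det_ne := fun z hz h0 => by
    have := congrArg Matrix.det (jacobian_symm_mul f hz)
    rw [Matrix.det_mul, h0, mul_zero, Matrix.det_one] at this
    exact zero_ne_one this

lemma IsCoordMap.restrict {F : Coord n → Coord n} {U V U' V' : Set (Coord n)}
    (h : IsCoordMap F U V) (hU : IsOpen U') (hV : IsOpen V') (hUU : U' ⊆ U)
    (hUV : Set.MapsTo F U' V') : IsCoordMap F U' V' :=
  ⟨hU, hV, hUV, h.smooth.mono hUU, fun z hz => h.det_ne z (hUU hz)⟩

end

/-! ### Differentials of diffeomorphisms, and metrics in charts -/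

section

variable {M : Type*} [TopologicalSpace M] [ChartedSpace (Coord n) M]

lemma mdifferentiableAt_diffeomorph (f : M ≃ₘ⟮𝓡 n, 𝓡 n⟯ M) (p : M) :
    MDifferentiableAt (𝓡 n) (𝓡 n) f p := f.mdifferentiable (by simp) p

/-- All tangent spaces are definitionally `Coord n`. Taking the vectors there allows the base point
to be replaced by an equal one without transport. -/
lemma PseudoMetric.val_congr (g : PseudoMetric n M) {p q : M} (h : p = q) (v w : Coord n) :
    g.val p v w = g.val q v w := by
  subst h; rfl

lemma mapJacobian_comp (f h : M ≃ₘ⟮𝓡 n, 𝓡 n⟯ M) (p : M) :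
    mapJacobian (n := n) (fun q => h (f q)) p = mapJacobian h (f p) * mapJacobian f p := by
  have e : mapJacobian (n := n) (fun q => h (f q)) p
      = linMatrix (mfderiv (𝓡 n) (𝓡 n) (h ∘ f) p) := rfl
  rw [e, mfderiv_comp p (mdifferentiableAt_diffeomorph h _) (mdifferentiableAt_diffeomorph f p)]
  exact linMatrix_comp _ _

/-- The conformal relation is evaluated at ψ⁻¹ x on the images of vectors under dψ⁻¹, where dψ dψ⁻¹
= 1. The new factor is the inverse of the old one composed with ψ⁻¹. -/
lemma IsConformal.symm {g g' : PseudoMetric n M} {ψ : M ≃ₘ⟮𝓡 n, 𝓡 n⟯ M}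
    (h : IsConformal g' g ψ) : IsConformal g g' ψ.symm := by
  obtain ⟨φ, hs, hpos, he⟩ := h
  refine ⟨fun x => (φ (ψ.symm x))⁻¹, ?_, fun x => inv_pos.2 (hpos _), fun x v w => ?_⟩
  · exact (hs.comp ψ.symm.contMDiff).inv₀ fun x => (hpos _).ne'
  · have e : ∀ u : TangentSpace (𝓡 n) x, (show Coord n from mfderiv (𝓡 n) (𝓡 n) ψ (ψ.symm x)
        (mfderiv (𝓡 n) (𝓡 n) ψ.symm x u)) = (show Coord n from u) := by
      intro u
      have h1 := mfderiv_comp_apply x (mdifferentiableAt_diffeomorph ψ _)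
        (mdifferentiableAt_diffeomorph ψ.symm x) u
      have h2 : (ψ ∘ ψ.symm : M → M) = id := funext ψ.apply_symm_apply
      rw [h2, mfderiv_id] at h1
      exact h1.symm
    have := he (ψ.symm x) (mfderiv (𝓡 n) (𝓡 n) ψ.symm x v) (mfderiv (𝓡 n) (𝓡 n) ψ.symm x w)
    have h3 := (g.val_congr (ψ.apply_symm_apply x) _ _).symm.trans this
    have h4 := (congrArg₂ (fun v w : Coord n => g.val x v w) (e v) (e w)).symm.trans h3
    rw [eq_inv_mul_iff_mul_eq₀ (hpos _).ne']
    exact h4.symm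

lemma mapJacobian_symm_mul (f : M ≃ₘ⟮𝓡 n, 𝓡 n⟯ M) (p : M) :
    mapJacobian (n := n) f.symm (f p) * mapJacobian f p = 1 := by
  rw [← mapJacobian_comp]
  have e : (fun q => f.symm (f q)) = (id : M → M) := funext f.symm_apply_apply
  have e' : mapJacobian (n := n) (id : M → M) p = linMatrix (mfderiv (𝓡 n) (𝓡 n) (id : M → M) p) :=
    rfl
  rw [e, e', mfderiv_id]
  exact linMatrix_id

variable [IsManifold (𝓡 n) ∞ M]

lemma mdifferentiableAt_extChartAt_of_mem {c p : M} (hp : p ∈ (extChartAt (𝓡 n) c).source) :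
    MDifferentiableAt (𝓡 n) 𝓘(ℝ, Coord n) (extChartAt (𝓡 n) c) p :=
  have : IsManifold (𝓡 n) 1 M := IsManifold.of_le (n := ∞) (by simp)
  mdifferentiableAt_extChartAt (by rwa [← extChartAt_source (𝓡 n)])

lemma mdifferentiableAt_extChartAt_symm {c : M} {z : Coord n}
    (hz : z ∈ (extChartAt (𝓡 n) c).target) :
    MDifferentiableAt 𝓘(ℝ, Coord n) (𝓡 n) (extChartAt (𝓡 n) c).symm z :=
  (((contMDiffOn_extChartAt_symm (n := ∞) c) z hz).contMDiffAt
    ((isOpen_extChartAt_target c).mem_nhds hz)).mdifferentiableAt (by simp)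

/-! ### Jacobian matrices -/

lemma chartJacobian_self (x : M) : chartJacobian (n := n) x x = 1 := by
  have : IsManifold (𝓡 n) 1 M := IsManifold.of_le (n := ∞) (by simp)
  have : chartJacobian (n := n) x x
      = linMatrix (mfderiv (𝓡 n) 𝓘(ℝ, Coord n) (extChartAt (𝓡 n) x) x) := rfl
  rw [this, mfderiv_extChartAt_self]
  exact linMatrix_id

/-- Chain rule for the two descriptions of `f` followed by the chart at `c'`. It converts
push-forward in preferred frames into push-forward in arbitrary charts. -/
lemma chartJacobian_mul_mapJacobian (f : M ≃ₘ⟮𝓡 n, 𝓡 n⟯ M) {c c' p : M}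
    (hp : p ∈ (extChartAt (𝓡 n) c).source) (hp' : f p ∈ (extChartAt (𝓡 n) c').source) :
    chartJacobian c' (f p) * mapJacobian f p
      = jacobian (coordMap f c c') (extChartAt (𝓡 n) c p) * chartJacobian (n := n) c p := by
  have hz : extChartAt (𝓡 n) c p ∈ coordDomain f c c' :=
    ⟨(extChartAt (𝓡 n) c).map_source hp, by
      rw [Set.mem_preimage, (extChartAt (𝓡 n) c).left_inv hp]; exact hp'⟩
  have hd := differentiableAt_coordMap f hz
  have e1 : mfderiv (𝓡 n) 𝓘(ℝ, Coord n) (extChartAt (𝓡 n) c' ∘ f) p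
      = (mfderiv (𝓡 n) 𝓘(ℝ, Coord n) (extChartAt (𝓡 n) c') (f p)).comp (mfderiv (𝓡 n) (𝓡 n) f p) :=
    mfderiv_comp p (mdifferentiableAt_extChartAt_of_mem hp') (mdifferentiableAt_diffeomorph f p)
  have e2 : mfderiv (𝓡 n) 𝓘(ℝ, Coord n) (coordMap f c c' ∘ extChartAt (𝓡 n) c) p
      = (mfderiv 𝓘(ℝ, Coord n) 𝓘(ℝ, Coord n) (coordMap f c c') (extChartAt (𝓡 n) c p)).comp
        (mfderiv (𝓡 n) 𝓘(ℝ, Coord n) (extChartAt (𝓡 n) c) p) :=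
    mfderiv_comp p hd.mdifferentiableAt (mdifferentiableAt_extChartAt_of_mem hp)
  have e3 : (extChartAt (𝓡 n) c' ∘ f) =ᶠ[nhds p] (coordMap f c c' ∘ extChartAt (𝓡 n) c) := by
    filter_upwards [(isOpen_extChartAt_source c).mem_nhds hp] with q hq
    simp only [coordMap, Function.comp_apply, (extChartAt (𝓡 n) c).left_inv hq]
  rw [e3.mfderiv_eq, e2, mfderiv_eq_fderiv] at e1
  have e4 := congrArg linMatrix e1
  rw [jacobian_eq hd]
  exact (linMatrix_comp _ _).symm.trans (e4.symm.trans (linMatrix_comp _ _))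

lemma jacobian_coordMap_extChartAt (f : M ≃ₘ⟮𝓡 n, 𝓡 n⟯ M) (x : M) :
    jacobian (coordMap (n := n) f x (f x)) (extChartAt (𝓡 n) x x) = mapJacobian f x := by
  have := chartJacobian_mul_mapJacobian f (mem_extChartAt_source (I := 𝓡 n) x)
    (mem_extChartAt_source (I := 𝓡 n) (f x))
  rw [chartJacobian_self, chartJacobian_self, one_mul, mul_one] at this
  exact this.symm

/-! ### Metrics in coordinates -/

lemma mfderiv_symm_coordMap (f : M ≃ₘ⟮𝓡 n, 𝓡 n⟯ M) {c c' : M} {z : Coord n}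
    (hz : z ∈ coordDomain f c c') (v : Coord n) :
    (show Coord n from mfderiv 𝓘(ℝ, Coord n) (𝓡 n) (extChartAt (𝓡 n) c').symm (coordMap f c c' z)
      (fderiv ℝ (coordMap f c c') z v))
      = (show Coord n from mfderiv (𝓡 n) (𝓡 n) f ((extChartAt (𝓡 n) c).symm z)
        (mfderiv 𝓘(ℝ, Coord n) (𝓡 n) (extChartAt (𝓡 n) c).symm z v)) := by
  have hd := differentiableAt_coordMap f hz
  have e1 := mfderiv_comp_apply z (mdifferentiableAt_diffeomorph f _)
    (mdifferentiableAt_extChartAt_symm hz.1) v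
  have e2 := mfderiv_comp_apply z (mdifferentiableAt_extChartAt_symm (coordMap_mem_target hz))
    hd.mdifferentiableAt v
  have e3 : (f ∘ (extChartAt (𝓡 n) c).symm)
      =ᶠ[nhds z] ((extChartAt (𝓡 n) c').symm ∘ coordMap f c c') := by
    filter_upwards [(isOpen_coordDomain f.continuous c c').mem_nhds hz] with w hw
    exact (symm_coordMap hw).symm
  have e4 : (show Coord n →L[ℝ] Coord n from
        mfderiv 𝓘(ℝ, Coord n) (𝓡 n) (f ∘ (extChartAt (𝓡 n) c).symm) z)
      = (show Coord n →L[ℝ] Coord n from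
        mfderiv 𝓘(ℝ, Coord n) (𝓡 n) ((extChartAt (𝓡 n) c').symm ∘ coordMap f c c') z) :=
    e3.mfderiv_eq
  rw [mfderiv_eq_fderiv] at e2
  exact e2.symm.trans ((congrArg (fun A : Coord n →L[ℝ] Coord n => A v) e4).symm.trans e1)

lemma PseudoMetric.pullMetric_coord (g : PseudoMetric n M) (f : M ≃ₘ⟮𝓡 n, 𝓡 n⟯ M) {c c' : M}
    {z : Coord n} (hz : z ∈ coordDomain f c c') (i j : Fin n) :
    pullMetric (coordMap f c c') (g.coord c') z i j
      = g.val (f ((extChartAt (𝓡 n) c).symm z))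
        (mfderiv (𝓡 n) (𝓡 n) f _ (coordVector c z i))
        (mfderiv (𝓡 n) (𝓡 n) f _ (coordVector c z j)) := by
  rw [pullMetric, jacobian_eq (differentiableAt_coordMap f hz)]
  have e := transpose_mul_mul_linMatrix
    (g.val ((extChartAt (𝓡 n) c').symm (coordMap f c c' z)))
    (mfderiv 𝓘(ℝ, Coord n) (𝓡 n) (extChartAt (𝓡 n) c').symm (coordMap f c c' z)).toLinearMap
    (fderiv ℝ (coordMap f c c') z)
  refine (congrFun (congrFun e i) j).trans ?_
  refine (g.val_congr (symm_coordMap hz) _ _).trans ?_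
  exact congrArg₂ (fun v w : Coord n => g.val (f ((extChartAt (𝓡 n) c).symm z)) v w)
    (mfderiv_symm_coordMap f hz _) (mfderiv_symm_coordMap f hz _)

lemma mfderiv_extChartAt_symm_apply {c : M} {z : Coord n}
    (hz : z ∈ (extChartAt (𝓡 n) c).target) (v : Coord n) :
    mfderiv (𝓡 n) 𝓘(ℝ, Coord n) (extChartAt (𝓡 n) c) ((extChartAt (𝓡 n) c).symm z)
      (mfderiv 𝓘(ℝ, Coord n) (𝓡 n) (extChartAt (𝓡 n) c).symm z v) = v := by
  have : IsManifold (𝓡 n) 1 M := IsManifold.of_le (n := ∞) (by simp)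
  have := mfderiv_extChartAt_comp_mfderivWithin_extChartAt_symm (I := 𝓡 n) hz
  rw [ModelWithCorners.range_eq_univ, mfderivWithin_univ] at this
  exact congrArg (fun A : Coord n →L[ℝ] Coord n => A v) this

lemma mfderiv_symm_extChartAt_apply {c : M} {z : Coord n}
    (hz : z ∈ (extChartAt (𝓡 n) c).target)
    (v : TangentSpace (𝓡 n) ((extChartAt (𝓡 n) c).symm z)) :
    mfderiv 𝓘(ℝ, Coord n) (𝓡 n) (extChartAt (𝓡 n) c).symm z
      (mfderiv (𝓡 n) 𝓘(ℝ, Coord n) (extChartAt (𝓡 n) c) ((extChartAt (𝓡 n) c).symm z) v) = v := by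
  have : IsManifold (𝓡 n) 1 M := IsManifold.of_le (n := ∞) (by simp)
  have := mfderivWithin_extChartAt_symm_comp_mfderiv_extChartAt (I := 𝓡 n) hz
  rw [ModelWithCorners.range_eq_univ, mfderivWithin_univ] at this
  exact congrArg (fun A : Coord n →L[ℝ] Coord n => A v) this

lemma PseudoMetric.isMetricOn_coord (g : PseudoMetric n M) (c : M) :
    IsMetricOn (g.coord c) (extChartAt (𝓡 n) c).target where
  smooth := g.smooth c
  symm := fun z _ => by
    ext i j
    exact g.symm _ _ _
  det_ne := fun z hz h0 => by
    -- A kernel vector of the component matrix gives a tangent vector orthogonal to all coordinate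
    -- vectors. These span the tangent space, so nondegeneracy makes it zero, and the inverse
    -- differential of the chart then makes the kernel vector zero.
    obtain ⟨v, hv, hGv⟩ := Matrix.exists_mulVec_eq_zero_iff.2 h0
    set D : Coord n →ₗ[ℝ] TangentSpace (𝓡 n) ((extChartAt (𝓡 n) c).symm z) :=
      (mfderiv 𝓘(ℝ, Coord n) (𝓡 n) (extChartAt (𝓡 n) c).symm z).toLinearMap
    set B := g.val ((extChartAt (𝓡 n) c).symm z)
    have expand : ∀ w : Coord n, w = ∑ a, w a • EuclideanSpace.single a (1 : ℝ) := by
      intro w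
      ext b
      simp [Finset.sum_apply, Pi.single_apply]
    have hB : ∀ a, B (D (EuclideanSpace.single a (1 : ℝ))) (D (WithLp.toLp 2 v)) = 0 := by
      intro a
      rw [expand (WithLp.toLp 2 v), map_sum, map_sum]
      simp only [map_smul, smul_eq_mul]
      refine Eq.trans ?_ (congrFun hGv a)
      exact Finset.sum_congr rfl fun b _ => mul_comm _ _
    have hX : D (WithLp.toLp 2 v) = 0 := by
      refine g.nondegenerate _ _ fun Y => ?_
      have hY : D (mfderiv (𝓡 n) 𝓘(ℝ, Coord n) (extChartAt (𝓡 n) c)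
        ((extChartAt (𝓡 n) c).symm z) Y) = Y := mfderiv_symm_extChartAt_apply hz Y
      rw [g.symm, ← hY]
      generalize (mfderiv (𝓡 n) 𝓘(ℝ, Coord n) (extChartAt (𝓡 n) c)
        ((extChartAt (𝓡 n) c).symm z) Y) = w
      have := expand w
      rw [this, map_sum, map_sum, LinearMap.sum_apply]
      refine Finset.sum_eq_zero fun a _ => ?_
      rw [map_smul, map_smul, LinearMap.smul_apply]
      exact (congrArg _ (hB a)).trans (smul_zero _)
    have h := mfderiv_extChartAt_symm_apply hz (WithLp.toLp 2 v)
    have h' : (0 : Coord n) = WithLp.toLp 2 v := by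
      rw [← h]
      refine Eq.trans ?_ (congrArg _ hX).symm
      exact (map_zero _).symm
    exact hv (funext fun i => (congrArg (fun w : Coord n => w i) h').symm)

/-- A conformal diffeomorphism in coordinates. -/
lemma isConformalOn_coord {g g' : PseudoMetric n M} {ψ : M ≃ₘ⟮𝓡 n, 𝓡 n⟯ M}
    (h : IsConformal g' g ψ) : ∃ φ : M → ℝ, ∀ c c' : M,
      IsConformalOn (g'.coord c) (pullMetric (coordMap ψ c c') (g.coord c'))
        (fun z => φ ((extChartAt (𝓡 n) c).symm z)) (coordDomain ψ c c') := by
  obtain ⟨φ, hs, hpos, he⟩ := h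
  refine ⟨φ, fun c c' => ⟨isOpen_coordDomain ψ.continuous c c',
    (g'.isMetricOn_coord c).mono Set.inter_subset_left,
    ((g.isMetricOn_coord c').mono Set.inter_subset_left).pullMetric (isCoordMap_coordMap ψ c c'),
    ?_, fun z _ => hpos _, fun z hz => ?_⟩⟩
  · rw [← contMDiffOn_iff_contDiffOn]
    exact hs.comp_contMDiffOn ((contMDiffOn_extChartAt_symm c).mono Set.inter_subset_left)
  · ext i j
    rw [g.pullMetric_coord ψ hz]
    exact he _ _ _

end

section

variable {M : Type*} [TopologicalSpace M] [ChartedSpace (Coord n) M]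

/-! ### Tensor densities in coordinates -/

/-- The components of a field of degree two are smooth in every chart. -/
def DensityField.IsSmooth₂ (P : DensityField n M 2) (δ : ℝ) : Prop :=
  ∀ c : M, FieldSmoothOn (P.coord₂ δ c) (extChartAt (𝓡 n) c).target

lemma DensityField.IsSymbol.isSmooth₂ {P : DensityField n M 2} {δ : ℝ} (h : P.IsSymbol δ) :
    P.IsSmooth₂ δ := fun c i j => h.smooth c ![i, j]

/-- To evaluate a pulled back operator at `x`, it suffices to present its value at `f x` as the
push-forward of some components `v`. -/
lemma push_symm_apply {k : ℕ} {δ : ℝ} (f : M ≃ₘ⟮𝓡 n, 𝓡 n⟯ M) {Q : DensityField n M k} {x : M}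
    {v : (Fin k → Fin n) → ℝ} (h : Q (f x) = changeFrame δ (mapJacobian f x) v) :
    push δ f.symm Q x = v := by
  have e : push δ f.symm Q x = changeFrame δ (mapJacobian f.symm (f x)) (Q (f x)) := rfl
  rw [e, h, changeFrame_changeFrame, mapJacobian_symm_mul, changeFrame_one]

variable [IsManifold (𝓡 n) ∞ M]

lemma coord_push {k : ℕ} (δ : ℝ) (f : M ≃ₘ⟮𝓡 n, 𝓡 n⟯ M) (P : DensityField n M k) {c c' : M}
    {z : Coord n} (hz : z ∈ coordDomain f c c') :
    (push δ f P).coord δ c' (coordMap f c c' z)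
      = changeFrame δ (jacobian (coordMap f c c') z) (P.coord δ c z) := by
  rw [DensityField.coord, symm_coordMap hz, push, f.symm_apply_apply, changeFrame_changeFrame,
    chartJacobian_mul_mapJacobian f ((extChartAt (𝓡 n) c).map_target hz.1) hz.2,
    (extChartAt (𝓡 n) c).right_inv hz.1, ← changeFrame_changeFrame]
  rfl

lemma isPushField_push (δ : ℝ) (f : M ≃ₘ⟮𝓡 n, 𝓡 n⟯ M) (P : DensityField n M 2) (c c' : M) :
    IsPushField (coordMap f c c') (coordDomain f c c') δ (P.coord₂ δ c)
      ((push δ f P).coord₂ δ c') := by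
  intro z hz
  refine Eq.trans ?_ (changeFrame_two_apply δ _ _)
  ext i j
  simp only [Matrix.of_apply, DensityField.coord₂, coord_push δ f P hz]

/-- The components of a push-forward are smooth. -/
lemma fieldSmoothOn_push {δ : ℝ} (f : M ≃ₘ⟮𝓡 n, 𝓡 n⟯ M) {P : DensityField n M 2} {c : M}
    (hP : FieldSmoothOn (P.coord₂ δ c) (extChartAt (𝓡 n) c).target) (c' : M) :
    FieldSmoothOn ((push δ f P).coord₂ δ c') (coordDomain f.symm c' c) := by
  have hF := isCoordMap_coordMap f.symm c' c
  have hJ := (isCoordMap_coordMap f c c').matSmoothOn_jacobian.comp hF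
  have hP' : MatSmoothOn (fun w => Matrix.of (P.coord₂ δ c (coordMap f.symm c' c w)))
      (coordDomain f.symm c' c) := fun i j =>
    (hP i j).comp hF.smooth fun w hw => coordMap_mem_target hw
  have hd : ContDiffOn ℝ ∞ (fun w => |(jacobian (coordMap (n := n) f c c')
      (coordMap f.symm c' c w)).det| ^ (-δ)) (coordDomain f.symm c' c) := by
    intro w hw
    have h0 := (isCoordMap_coordMap f c c').det_ne _ (hF.mapsTo hw)
    exact (((contDiffOn_det hJ) w hw).abs h0).rpow_const_of_ne (abs_ne_zero.2 h0)
  intro i j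
  refine (hd.mul (((hJ.mul hP').mul hJ.transpose) i j)).congr fun w hw => ?_
  have := isPushField_push δ f P c c' _ (hF.mapsTo hw)
  have e := congrFun (congrFun this i) j
  rw [coordMap_coordMap_symm f hw] at e
  exact e

/-- Smoothness is local: around each point the source chart is the one centred at its preimage under
`f`. -/
lemma DensityField.IsSmooth₂.push {δ : ℝ} {P : DensityField n M 2} (hP : P.IsSmooth₂ δ)
    (f : M ≃ₘ⟮𝓡 n, 𝓡 n⟯ M) : (push δ f P).IsSmooth₂ δ := by
  intro c' i j w hw
  have hw' : w ∈ coordDomain f.symm c' (f.symm ((extChartAt (𝓡 n) c').symm w)) :=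
    ⟨hw, mem_extChartAt_source _⟩
  exact ((fieldSmoothOn_push f (hP _) c' i j).contDiffAt
    ((isOpen_coordDomain f.symm.continuous _ _).mem_nhds hw')).contDiffWithinAt

end

/-! ### Operators of a diffeomorphism as two-metric operators -/

section

variable {M : Type*} [TopologicalSpace M] [ChartedSpace (Coord n) M] [IsManifold (𝓡 n) ∞ M]
  {g : PseudoMetric n M} {δ : ℝ} {P : DensityField n M 2}

/-- The metric `f^* g` in the chart centred at `x`. -/
def pullCoord (g : PseudoMetric n M) (f : M ≃ₘ⟮𝓡 n, 𝓡 n⟯ M) (x : M) :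
    Coord n → Matrix (Fin n) (Fin n) ℝ :=
  pullMetric (coordMap f x (f x)) (g.coord (f x))

lemma isMetricOn_pullCoord (g : PseudoMetric n M) (f : M ≃ₘ⟮𝓡 n, 𝓡 n⟯ M) (x : M) :
    IsMetricOn (pullCoord g f x) (coordDomain f x (f x)) :=
  ((g.isMetricOn_coord _).mono Set.inter_subset_left).pullMetric (isCoordMap_coordMap f x (f x))

/-- Pulling back an operator built from `g` gives the operator built from f^*g, by naturality
between the charts at `x` and `f x`. The next two lemmas have the same mechanism. -/
lemma pullbackOp_gradTrace (f : M ≃ₘ⟮𝓡 n, 𝓡 n⟯ M) (hP : P.IsSmooth₂ δ) (x : M)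
    (k : Fin 1 → Fin n) : pullbackOp δ f (gradTrace g δ) P x k
      = coordGradTrace (pullCoord g f x) δ (P.coord₂ δ x) (extChartAt (𝓡 n) x x) (k 0) := by
  refine congrFun (push_symm_apply (v := fun k => coordGradTrace (pullCoord g f x) δ
    (P.coord₂ δ x) (extChartAt (𝓡 n) x x) (k 0)) f ?_) k
  funext a
  rw [changeFrame_one_apply, ← jacobian_coordMap_extChartAt]
  refine Eq.trans ?_ (coordGradTrace_natural (isCoordMap_coordMap f x (f x))
    ((g.isMetricOn_coord _).mono Set.inter_subset_left)
    (fun i j => (hP x i j).mono Set.inter_subset_left) (fieldSmoothOn_push f (hP x) (f x))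
    (isPushField_push δ f P x (f x)) (extChartAt_mem_coordDomain f x) (a 0))
  rw [coordMap_extChartAt]
  rfl

lemma pullbackOp_laplaceTrace (f : M ≃ₘ⟮𝓡 n, 𝓡 n⟯ M) (hP : P.IsSmooth₂ δ) (x : M)
    (k : Fin 0 → Fin n) : pullbackOp δ f (laplaceTrace g δ) P x k
      = coordLaplaceTrace (pullCoord g f x) δ (P.coord₂ δ x) (extChartAt (𝓡 n) x x) := by
  refine congrFun (push_symm_apply (v := fun _ => coordLaplaceTrace (pullCoord g f x) δ
    (P.coord₂ δ x) (extChartAt (𝓡 n) x x)) f ?_) k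
  funext a
  rw [changeFrame_zero_apply, ← jacobian_coordMap_extChartAt]
  refine Eq.trans ?_ (coordLaplaceTrace_natural (isCoordMap_coordMap f x (f x))
    ((g.isMetricOn_coord _).mono Set.inter_subset_left)
    (fun i j => (hP x i j).mono Set.inter_subset_left) (fieldSmoothOn_push f (hP x) (f x))
    (isPushField_push δ f P x (f x)) (extChartAt_mem_coordDomain f x))
  rw [coordMap_extChartAt]
  rfl

lemma pullbackOp_scalarTrace (f : M ≃ₘ⟮𝓡 n, 𝓡 n⟯ M) (x : M)
    (k : Fin 0 → Fin n) : pullbackOp δ f (scalarTrace g δ) P x k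
      = coordScalarTrace (pullCoord g f x) (P.coord₂ δ x) (extChartAt (𝓡 n) x x) := by
  refine congrFun (push_symm_apply (v := fun _ => coordScalarTrace (pullCoord g f x)
    (P.coord₂ δ x) (extChartAt (𝓡 n) x x)) f ?_) k
  funext a
  rw [changeFrame_zero_apply, ← jacobian_coordMap_extChartAt]
  refine Eq.trans ?_ (coordScalarTrace_natural (isCoordMap_coordMap f x (f x))
    ((g.isMetricOn_coord _).mono Set.inter_subset_left)
    (isPushField_push δ f P x (f x)) (extChartAt_mem_coordDomain f x))
  rw [coordMap_extChartAt]
  rfl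

lemma ell_eq (f : M ≃ₘ⟮𝓡 n, 𝓡 n⟯ M) {x : M} {z : Coord n} (hz : z ∈ coordDomain f x (f x)) :
    ell g f x z = (christoffel (pullCoord g f x) - christoffel (g.coord x)) z := by
  funext k i j
  have := pullbackConnection_christoffel (isCoordMap_coordMap f x (f x))
    ((g.isMetricOn_coord (f x)).mono Set.inter_subset_left) hz
  exact congrArg (fun t : Fin n → Fin n → Fin n → ℝ => t k i j - christoffel (g.coord x) z k i j)
    this

/-- From here on the diffeomorphism enters only through the second metric f^*g. -/
lemma schwarzianA_eq (f : M ≃ₘ⟮𝓡 n, 𝓡 n⟯ M) (hP : P.IsSmooth₂ δ) (x : M) (k : Fin 1 → Fin n) :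
    schwarzianA g δ f P x k
      = coordA δ (g.coord x) (pullCoord g f x) (P.coord₂ δ x) (extChartAt (𝓡 n) x x) (k 0) := by
  simp only [schwarzianA, pullbackOp_gradTrace f hP,
    reduced_congr (ell_eq (g := g) f (extChartAt_mem_coordDomain f x))]
  rfl

lemma schwarzianB_eq (f : M ≃ₘ⟮𝓡 n, 𝓡 n⟯ M) (hP : P.IsSmooth₂ δ) (x : M) (k : Fin 0 → Fin n) :
    schwarzianB g δ f P x k
      = coordB δ (g.coord x) (pullCoord g f x) (P.coord₂ δ x) (extChartAt (𝓡 n) x x) := by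
  simp only [schwarzianB, pullbackOp_laplaceTrace f hP, pullbackOp_scalarTrace f,
    lowerTerms_congr (isOpen_coordDomain f.continuous x (f x)) (extChartAt_mem_coordDomain f x)
      (fun z hz => ell_eq (g := g) f hz)]
  rfl

end

/-! ### Conformal invariance -/

section

variable {G H G' H' : Coord n → Matrix (Fin n) (Fin n) ℝ} {U V : Set (Coord n)} {y : Coord n}
  {δ : ℝ} {P : Coord n → Fin n → Fin n → ℝ} {f₁ f₂ : Coord n → ℝ}

lemma coordA_self (k : Fin n) : coordA δ G G P y k = 0 := by
  have := coordA_add (δ := δ) (G₁ := G) (G₂ := G) (G₃ := G) (P := P) (y := y) k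
  linarith

lemma coordB_self (hn : 2 < n) (hU : IsOpen U) (h : IsMetricOn G U) (hy : y ∈ U) :
    coordB δ G G P y = 0 := by
  have := coordB_add (δ := δ) (P := P) hn hU h h h hy
  linarith

/-- `𝒜` only depends on the conformal classes of the metrics. -/
lemma coordA_conformal (h₁ : IsConformalOn G G' f₁ U) (h₂ : IsConformalOn H H' f₂ U)
    (hP : FieldSmoothOn P U) (hy : y ∈ U) (k : Fin n) :
    coordA δ G H P y k = coordA δ G' H' P y k := by
  have e₁ := coordA_add (δ := δ) (G₁ := G) (G₂ := G') (G₃ := H') (P := P) (y := y) k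
  have e₂ := coordA_add (δ := δ) (G₁ := G) (G₂ := H) (G₃ := H') (P := P) (y := y) k
  rw [h₁.coordA_eq_zero hP hy] at e₁
  rw [h₂.coordA_eq_zero hP hy] at e₂
  linarith

/-- `ℬ` only depends on the conformal classes of the metrics. -/
lemma coordB_conformal (hn : 2 < n) (h₁ : IsConformalOn G G' f₁ U) (h₂ : IsConformalOn H H' f₂ U)
    (hP : FieldSmoothOn P U) (hy : y ∈ U) :
    coordB δ G H P y = coordB δ G' H' P y := by
  have e₁ := coordB_add (δ := δ) (P := P) hn h₁.isOpen h₁.left h₁.right h₂.right hy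
  have e₂ := coordB_add (δ := δ) (P := P) hn h₁.isOpen h₁.left h₂.left h₂.right hy
  rw [h₁.coordB_eq_zero hn hP hy] at e₁
  rw [h₂.coordB_eq_zero hn hP hy] at e₂
  linarith

lemma IsConformalOn.mono (h : IsConformalOn G H f₁ U) (hV : IsOpen V) (hVU : V ⊆ U) :
    IsConformalOn G H f₁ V :=
  ⟨hV, h.left.mono hVU, h.right.mono hVU, h.smooth.mono hVU, fun z hz => h.pos z (hVU hz),
    fun z hz => h.eq z (hVU hz)⟩

lemma IsConformalOn.pullMetric {F : Coord n → Coord n} (h : IsConformalOn G H f₁ V)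
    (hF : IsCoordMap F U V) :
    IsConformalOn (pullMetric F G) (pullMetric F H) (fun z => f₁ (F z)) U where
  isOpen := hF.isOpen_source
  left := h.left.pullMetric hF
  right := h.right.pullMetric hF
  smooth := h.smooth.comp hF.smooth hF.mapsTo
  pos := fun z hz => h.pos _ (hF.mapsTo hz)
  eq := fun z hz => by
    simp only [ConformalSchwarzian.pullMetric, h.eq _ (hF.mapsTo hz), Matrix.mul_smul,
      Matrix.smul_mul]

lemma IsConformalOn.congr_right (h : IsConformalOn G H f₁ U) (hH : ∀ z ∈ U, H z = H' z)
    (hH' : IsMetricOn H' U) : IsConformalOn G H' f₁ U :=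
  ⟨h.isOpen, h.left, hH', h.smooth, h.pos, fun z hz => (hH z hz).symm.trans (h.eq z hz)⟩

end

/-! ### Conjugation by ψ and conclusion -/

section

variable {M : Type*} [TopologicalSpace M] [ChartedSpace (Coord n) M]

/-- The domain on which the two expressions of `ψ ∘ f` are compared. -/
def compDomain (ψ f : M ≃ₘ⟮𝓡 n, 𝓡 n⟯ M) (x : M) : Set (Coord n) :=
  coordDomain ψ x (ψ x) ∩ (coordDomain f x (f x) ∩
    coordDomain (fun p => ψ (f p)) x (ψ (f x)))

lemma isOpen_compDomain (ψ f : M ≃ₘ⟮𝓡 n, 𝓡 n⟯ M) (x : M) : IsOpen (compDomain ψ f x) :=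
  (isOpen_coordDomain ψ.continuous _ _).inter ((isOpen_coordDomain f.continuous _ _).inter
    (isOpen_coordDomain (ψ.continuous.comp f.continuous) _ _))

lemma extChartAt_mem_compDomain (ψ f : M ≃ₘ⟮𝓡 n, 𝓡 n⟯ M) (x : M) :
    extChartAt (𝓡 n) x x ∈ compDomain ψ f x :=
  ⟨extChartAt_mem_coordDomain ψ x, extChartAt_mem_coordDomain f x,
    extChartAt_mem_coordDomain (fun p => ψ (f p)) x⟩

lemma coordMap_mem_coordDomain {f h e : M → M} (he : ∀ p, h (f p) = e p) {c c' c'' : M}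
    {z : Coord n} (hz : z ∈ coordDomain f c c') (hz' : z ∈ coordDomain e c c'') :
    coordMap f c c' z ∈ coordDomain h c' c'' := by
  refine ⟨coordMap_mem_target hz, ?_⟩
  rw [Set.mem_preimage, Set.mem_preimage, symm_coordMap hz, he]
  exact hz'.2

/-- The target chart is centred at `f x`. This allows its centre to be replaced by a propositionally
equal point, as needed for the conjugate at ψ x. -/
lemma PseudoMetric.pullCoord_eq (g : PseudoMetric n M) (f : M ≃ₘ⟮𝓡 n, 𝓡 n⟯ M) {x q : M}
    (h : f x = q) : pullCoord g f x = pullMetric (coordMap f x q) (g.coord q) := by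
  subst h; rfl

lemma conj_apply (ψ f : M ≃ₘ⟮𝓡 n, 𝓡 n⟯ M) (p : M) :
    ((ψ.symm.trans f).trans ψ) (ψ p) = ψ (f p) := by
  simp

lemma DensityField.IsSmooth₂.compDomain {δ : ℝ} {P : DensityField n M 2} (hP : P.IsSmooth₂ δ)
    {ψ f : M ≃ₘ⟮𝓡 n, 𝓡 n⟯ M} {x : M} : FieldSmoothOn (P.coord₂ δ x) (compDomain ψ f x) :=
  fun i j => (hP x i j).mono fun _ h => h.1.1

variable [IsManifold (𝓡 n) ∞ M] {g g' : PseudoMetric n M} {δ : ℝ} {P : DensityField n M 2}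

/-- Functoriality of pullback. The composite of the chart expressions agrees with that of the
composite map only where all of them are defined, hence the open set `W`. -/
lemma pullMetric_coordMap_comp (f h : M ≃ₘ⟮𝓡 n, 𝓡 n⟯ M) {e : M → M}
    (he : ∀ p, h (f p) = e p) {c c' c'' : M} {W : Set (Coord n)} (hW : IsOpen W)
    (hf : W ⊆ coordDomain f c c') (hh : W ⊆ coordDomain e c c'')
    (G : Coord n → Matrix (Fin n) (Fin n) ℝ) {z : Coord n} (hz : z ∈ W) :
    pullMetric (coordMap f c c') (pullMetric (coordMap h c' c'') G) z
      = pullMetric (coordMap e c c'') G z := by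
  have e₁ : ∀ w ∈ W, (coordMap h c' c'' ∘ coordMap f c c') w = coordMap e c c'' w := by
    intro w hw
    rw [Function.comp_apply, coordMap_coordMap (hf hw)]
    simp only [he]
  rw [← pullMetric_comp (differentiableAt_coordMap f (hf hz))
    (differentiableAt_coordMap h (coordMap_mem_coordDomain he (hf hz) (hh hz))), pullMetric,
    pullMetric, jacobian_congr hW e₁ hz, e₁ z hz]

section

variable (ψ f : M ≃ₘ⟮𝓡 n, 𝓡 n⟯ M) (x : M)

/-- The metric `ψ^* (h^* g)` with `h = ψ ∘ f ∘ ψ⁻¹`, in the chart centred at `x`. -/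
def conjCoord (g : PseudoMetric n M) : Coord n → Matrix (Fin n) (Fin n) ℝ :=
  pullMetric (coordMap ψ x (ψ x)) (pullCoord g ((ψ.symm.trans f).trans ψ) (ψ x))

/-- The open set on which `h = ψ ∘ f ∘ ψ⁻¹` is expressed in the charts at `ψ x` and `h (ψ x)`. -/
def conjDomain : Set (Coord n) :=
  coordDomain ψ.symm (ψ x) x ∩
    coordDomain ((ψ.symm.trans f).trans ψ) (ψ x) (((ψ.symm.trans f).trans ψ) (ψ x))

lemma isCoordMap_conj : IsCoordMap (coordMap ψ x (ψ x)) (compDomain ψ f x) (conjDomain ψ f x) :=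
  (isCoordMap_coordMap ψ x (ψ x)).restrict (isOpen_compDomain ψ f x)
    ((isOpen_coordDomain ψ.symm.continuous _ _).inter
      (isOpen_coordDomain ((ψ.symm.trans f).trans ψ).continuous _ _)) Set.inter_subset_left
    fun z hz => ⟨coordMap_mem_coordDomain_symm ψ hz.1, by
      refine coordMap_mem_coordDomain (conj_apply ψ f) hz.1 ?_
      rw [conj_apply]
      exact hz.2.2⟩

variable {ψ f x}

/-- As (ψfψ⁻¹)ψ = ψf, both sides are the pullback of `g` by ψ ∘ f. -/
lemma conjCoord_eq {z : Coord n} (hz : z ∈ compDomain ψ f x) :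
    pullMetric (coordMap f x (f x)) (pullCoord g ψ (f x)) z = conjCoord ψ f x g z := by
  rw [conjCoord, g.pullCoord_eq _ (conj_apply ψ f x), pullCoord,
    pullMetric_coordMap_comp ψ _ (conj_apply ψ f) (isOpen_compDomain ψ f x)
      (fun _ h => h.1) (fun _ h => h.2.2) _ hz,
    pullMetric_coordMap_comp f ψ (fun _ => rfl) (isOpen_compDomain ψ f x)
      (fun _ h => h.2.1) (fun _ h => h.2.2) _ hz]

lemma isMetricOn_conjDomain_left : IsMetricOn (g.coord (ψ x)) (conjDomain ψ f x) :=
  (g.isMetricOn_coord _).mono fun _ h => h.1.1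

lemma isMetricOn_conjDomain_right :
    IsMetricOn (pullCoord g ((ψ.symm.trans f).trans ψ) (ψ x)) (conjDomain ψ f x) :=
  (isMetricOn_pullCoord g _ _).mono Set.inter_subset_right

lemma pullbackOp_schwarzianA (hP : P.IsSmooth₂ δ) (k : Fin 1 → Fin n) :
    pullbackOp δ ψ (schwarzianA g δ ((ψ.symm.trans f).trans ψ)) P x k
      = coordA δ (pullCoord g ψ x) (conjCoord ψ f x g) (P.coord₂ δ x)
        (extChartAt (𝓡 n) x x) (k 0) := by
  refine congrFun (push_symm_apply (v := fun k => coordA δ (pullCoord g ψ x) (conjCoord ψ f x g)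
    (P.coord₂ δ x) (extChartAt (𝓡 n) x x) (k 0)) ψ ?_) k
  funext a
  rw [changeFrame_one_apply, ← jacobian_coordMap_extChartAt, schwarzianA_eq _ (hP.push ψ),
    ← coordMap_extChartAt]
  exact coordA_natural (isCoordMap_conj ψ f x) isMetricOn_conjDomain_left
    isMetricOn_conjDomain_right hP.compDomain
    (fun i j => (fieldSmoothOn_push ψ (hP x) (ψ x) i j).mono Set.inter_subset_left)
    (fun z hz => isPushField_push δ ψ P x (ψ x) z hz.1) (extChartAt_mem_compDomain ψ f x) (a 0)

lemma pullbackOp_schwarzianB (hP : P.IsSmooth₂ δ) (k : Fin 0 → Fin n) :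
    pullbackOp δ ψ (schwarzianB g δ ((ψ.symm.trans f).trans ψ)) P x k
      = coordB δ (pullCoord g ψ x) (conjCoord ψ f x g) (P.coord₂ δ x)
        (extChartAt (𝓡 n) x x) := by
  refine congrFun (push_symm_apply (v := fun _ => coordB δ (pullCoord g ψ x) (conjCoord ψ f x g)
    (P.coord₂ δ x) (extChartAt (𝓡 n) x x)) ψ ?_) k
  funext a
  rw [changeFrame_zero_apply, ← jacobian_coordMap_extChartAt, schwarzianB_eq _ (hP.push ψ),
    ← coordMap_extChartAt]
  exact coordB_natural (isCoordMap_conj ψ f x) isMetricOn_conjDomain_left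
    isMetricOn_conjDomain_right hP.compDomain
    (fun i j => (fieldSmoothOn_push ψ (hP x) (ψ x) i j).mono Set.inter_subset_left)
    (fun z hz => isPushField_push δ ψ P x (ψ x) z hz.1) (extChartAt_mem_compDomain ψ f x)

/-- Conjugating by a conformal map changes the metrics conformally. -/
lemma IsConformal.exists_isConformalOn (h : IsConformal g' g ψ) (f : M ≃ₘ⟮𝓡 n, 𝓡 n⟯ M) (x : M) :
    ∃ f₁ f₂ : Coord n → ℝ,
      IsConformalOn (g'.coord x) (pullCoord g ψ x) f₁ (compDomain ψ f x) ∧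
      IsConformalOn (pullCoord g' f x) (conjCoord ψ f x g) f₂ (compDomain ψ f x) := by
  obtain ⟨φ, hφ⟩ := isConformalOn_coord h
  have hU := isOpen_compDomain ψ f x
  have hV : IsOpen (coordDomain f.symm (f x) x ∩ coordDomain (n := n) ψ (f x) (ψ (f x))) :=
    (isOpen_coordDomain f.symm.continuous _ _).inter (isOpen_coordDomain ψ.continuous _ _)
  have hF : IsCoordMap (coordMap f x (f x)) (compDomain ψ f x)
      (coordDomain f.symm (f x) x ∩ coordDomain ψ (f x) (ψ (f x))) :=
    (isCoordMap_coordMap f x (f x)).restrict hU hV (fun _ h => h.2.1) fun z hz =>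
      ⟨coordMap_mem_coordDomain_symm f hz.2.1,
        coordMap_mem_coordDomain (fun _ => rfl) hz.2.1 hz.2.2⟩
  -- The first relation is the conformality of ψ at `x`. The second is its conformality at `f x`,
  -- pulled back by `f`.
  refine ⟨_, _, (hφ x (ψ x)).mono hU Set.inter_subset_left,
    (((hφ (f x) (ψ (f x))).mono hV Set.inter_subset_right).pullMetric hF).congr_right
      (fun z hz => conjCoord_eq hz) ?_⟩
  exact isMetricOn_conjDomain_right.pullMetric (isCoordMap_conj ψ f x)

lemma schwarzianA_conj (h : IsConformal g' g ψ) (hP : P.IsSmooth₂ δ) (f : M ≃ₘ⟮𝓡 n, 𝓡 n⟯ M) :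
    schwarzianA g' δ f P = pullbackOp δ ψ (schwarzianA g δ ((ψ.symm.trans f).trans ψ)) P := by
  funext x k
  obtain ⟨f₁, f₂, h₁, h₂⟩ := h.exists_isConformalOn f x
  rw [schwarzianA_eq f hP, pullbackOp_schwarzianA hP]
  exact coordA_conformal h₁ h₂ hP.compDomain (extChartAt_mem_compDomain ψ f x) (k 0)

lemma schwarzianB_conj (hn : 2 < n) (h : IsConformal g' g ψ) (hP : P.IsSmooth₂ δ)
    (f : M ≃ₘ⟮𝓡 n, 𝓡 n⟯ M) :
    schwarzianB g' δ f P = pullbackOp δ ψ (schwarzianB g δ ((ψ.symm.trans f).trans ψ)) P := by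
  funext x k
  obtain ⟨f₁, f₂, h₁, h₂⟩ := h.exists_isConformalOn f x
  rw [schwarzianB_eq f hP, pullbackOp_schwarzianB hP]
  exact coordB_conformal hn h₁ h₂ hP.compDomain (extChartAt_mem_compDomain ψ f x)

/-- For conformal `ψ : (M, g') → (M, g)`, the operator `𝒜` of `g` at `ψ` compares `g` with `g'`. -/
lemma schwarzianA_eq_of_isConformal (h : IsConformal g' g ψ) (hP : P.IsSmooth₂ δ) (x : M)
    (k : Fin 1 → Fin n) : schwarzianA g δ ψ P x k
      = coordA δ (g.coord x) (g'.coord x) (P.coord₂ δ x) (extChartAt (𝓡 n) x x) (k 0) := by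
  obtain ⟨φ, hφ⟩ := isConformalOn_coord h
  rw [schwarzianA_eq ψ hP, ← coordA_add (G₂ := g'.coord x),
    add_eq_left]
  exact (hφ x (ψ x)).coordA_eq_zero (fun i j => (hP x i j).mono Set.inter_subset_left)
    (extChartAt_mem_coordDomain ψ x) (k 0)

lemma schwarzianB_eq_of_isConformal (hn : 2 < n) (h : IsConformal g' g ψ) (hP : P.IsSmooth₂ δ)
    (x : M) (k : Fin 0 → Fin n) : schwarzianB g δ ψ P x k
      = coordB δ (g.coord x) (g'.coord x) (P.coord₂ δ x) (extChartAt (𝓡 n) x x) := by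
  obtain ⟨φ, hφ⟩ := isConformalOn_coord h
  have hc := hφ x (ψ x)
  rw [schwarzianB_eq ψ hP, ← coordB_add hn hc.isOpen
    ((g.isMetricOn_coord x).mono Set.inter_subset_left) hc.left (isMetricOn_pullCoord g ψ x)
    (extChartAt_mem_coordDomain ψ x), add_eq_left]
  exact hc.coordB_eq_zero hn (fun i j => (hP x i j).mono Set.inter_subset_left)
    (extChartAt_mem_coordDomain ψ x)

/-- The two sides compare (g', g) and (g, g'), whose sum compares g' with itself. -/
lemma schwarzianA_symm (h : IsConformal g' g ψ) (hP : P.IsSmooth₂ δ) :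
    schwarzianA g' δ ψ.symm P = -schwarzianA g δ ψ P := by
  funext x k
  rw [Pi.neg_apply, Pi.neg_apply, schwarzianA_eq_of_isConformal h.symm hP,
    schwarzianA_eq_of_isConformal h hP, eq_neg_iff_add_eq_zero, coordA_add, coordA_self]

lemma schwarzianB_symm (hn : 2 < n) (h : IsConformal g' g ψ) (hP : P.IsSmooth₂ δ) :
    schwarzianB g' δ ψ.symm P = -schwarzianB g δ ψ P := by
  funext x k
  have hU := isOpen_extChartAt_target (I := 𝓡 n) x
  have hx := mem_extChartAt_target (I := 𝓡 n) x
  have hg := g.isMetricOn_coord x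
  have hg' := g'.isMetricOn_coord x
  rw [Pi.neg_apply, Pi.neg_apply, schwarzianB_eq_of_isConformal hn h.symm hP,
    schwarzianB_eq_of_isConformal hn h hP, eq_neg_iff_add_eq_zero,
    coordB_add hn hU hg' hg hg' hx, coordB_self hn hU hg' hx]

end

end

end ConformalSchwarzian

end

theorem proposition4p8 {n : ℕ} {M : Type*} [TopologicalSpace M]
    [ChartedSpace (EuclideanSpace ℝ (Fin n)) M] [IsManifold (𝓡 n) ∞ M]
    (δ : ℝ) (g g' : PseudoMetric n M) (ψ : M ≃ₘ⟮𝓡 n, 𝓡 n⟯ M) :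
    (IsConformal g' g ψ →
      ∀ P : DensityField n M 2, P.IsSymbol δ →
        (∀ f : M ≃ₘ⟮𝓡 n, 𝓡 n⟯ M,
          schwarzianA g' δ f P
            = pullbackOp δ ψ (schwarzianA g δ ((ψ.symm.trans f).trans ψ)) P ∧
          (2 < n → schwarzianB g' δ f P
            = pullbackOp δ ψ (schwarzianB g δ ((ψ.symm.trans f).trans ψ)) P)) ∧
        schwarzianA g' δ ψ.symm P = -schwarzianA g δ ψ P ∧
        (2 < n → schwarzianB g' δ ψ.symm P = -schwarzianB g δ ψ P)) ∧
    (IsConformal g g' ψ →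
      ∀ P : DensityField n M 2, P.IsSymbol δ →
        schwarzianA g' δ ψ P = -schwarzianA g δ ψ.symm P ∧
        (2 < n → schwarzianB g' δ ψ P = -schwarzianB g δ ψ.symm P)) := by
  refine ⟨fun h P hP => ⟨fun f => ⟨schwarzianA_conj h hP.isSmooth₂ f,
    fun hn => schwarzianB_conj hn h hP.isSmooth₂ f⟩,
    schwarzianA_symm h hP.isSmooth₂, fun hn => schwarzianB_symm hn h hP.isSmooth₂⟩,
    fun h P hP => ?_⟩
  -- The second form of the corollary is the first one applied to ψ⁻¹, which is conformal in the
  -- opposite direction.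
  have e : ψ.symm.symm = ψ := Diffeomorph.ext fun _ => rfl
  have h' := h.symm
  exact ⟨by simpa only [e] using schwarzianA_symm h' hP.isSmooth₂,
    fun hn => by simpa only [e] using schwarzianB_symm hn h' hP.isSmooth₂⟩
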